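/- **Setting.** Let $k$ be a field, $A$ a Hopf algebra over $k$ with invertible antipode, and $\Lambda^1$ a finite-dimensional right crossed (Drinfeld–Yetter) $A$-module, with braiding $\Psi(v\otimes w)=w_{(0)}\otimes v\triangleleft w_{(1)}$. Let $\varpi:A^+=\ker\epsilon\to\Lambda^1$ be a surjective morphism of crossed modules, where $A^+$ carries right multiplication and the right adjoint coaction $a\mapsto a_{(2)}\otimes (Sa_{(1)})a_{(3)}$, and put $\pi_\epsilon(a)=a-\epsilon(a)$. Put $[m,-\Psi]=\sum_{j<m}(-1)^j\Psi_1\cdots\Psi_j$, $[m,-\Psi]!=(\mathrm{id}\otimes[m-1,-\Psi]!)[m,-\Psi]$, and let $\Lambda=B_-(\Lambda^1)=T\Lambda^1/\oplus_m\ker[m,-\Psi]!$ be the braided exterior algebra. It is a super-braided Hopf algebra with $\Lambda^1$ primitive; its coproduct is written $\omega_{(1)}\otimes\omega_{(2)}$ and its antipode $S$. Let $\Omega=A\otimes\Lambda$ be the exterior algebra with product $(a\eta)(b\omega)=ab_{(1)}(\eta\triangleleft b_{(2)})\omega$. Its exterior derivative is given by $\mathrm d a=a_{(1)}\varpi\pi_\epsilon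 a_{(2)}$ on $A$ and $\mathrm d(a\eta)=(\mathrm da)\eta+a\,\mathrm d\eta$, where $\mathrm d$ on $\Lambda$ is the super-derivation of degree one with $\mathrm d\varpi(a)=-(\varpi\pi_\epsilon a_{(1)})(\varpi\pi_\epsilon a_{(2)})$ for $a\in A^+$. Let $g\in\Lambda^1\otimes\Lambda^1$ be a bi-invariant (central and coinvariant) metric with inverse $(\ ,\ )$, used to identify $\Lambda^1$ with its right dual. Let $\langle\ ,\ \rangle$ be the induced pairing on $\Lambda$: in degree $m$ it is the nested evaluation of $(\ ,\ )$ against $[m,-\Psi]!$ applied to the second argument, and it is zero when degrees differ. Let $\exp=\sum_i b_i\otimes c_i\in\Lambda\otimes\Lambda$ be its coevaluation, $\sum_i\langle x,b_i\rangle c_i=x$. Suppose that $\Lambda$ has top degree $n$, that $\Lambda^n$ is one-dimensional, spanned by a central and bi-invariant form $\mathrm{Vol}$, and let $\int\mathrm{Vol}=1$ and $\int=0$ in lower degrees. The Hodge star is the super-braided Fourier transform $\sharp\omega=\sum_i\left(\int\omega b_i\right)c_i$ on $\Lambda$. Extend $\sharp$ and $S$ to $\Omega$ as bimodule maps. For $\eta\in\Lambda^1$,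 $\omega\in\Lambda$ and $a,b\in A$ put $(a\eta)\vdash(b\omega)=ab_{(1)}\langle\eta\triangleleft b_{(2)},\omega_{(1)}\rangle\omega_{(2)}$. Put $$\delta=(S\sharp)^{-1}\mathrm d(S\sharp),\qquad \square=\mathrm d\delta+\delta\mathrm d,\qquad \mathcal L_\eta\omega=\eta\vdash\mathrm d\omega+\mathrm d(\eta\vdash\omega)\quad(\eta\in\Omega^1,\ \omega\in\Omega),$$ $$L_\delta(\omega,\eta)=\delta(\omega\eta)-(\delta\omega)\eta-(-1)^{|\omega|}\omega\,\delta\eta .$$ **Statement.** $S\sharp$ is invertible on $\Omega$, and for all $f\in A$ and $\omega\in\Omega$ $$\delta(f\omega)=f\delta\omega+(-1)^n(\mathrm df)\vdash\omega,$$ $$\square(f\omega)=(\square f)\omega+f\square\omega+L_\delta(\mathrm df,\omega)+(-1)^n\mathcal L_{\mathrm df}\omega .$$ Moreover, let $\{e_a\}$ be any basis of $\Lambda^1$, let $g_{ab}=(e_a,e_b)$, and let $\partial^a:A\to A$ be the partial derivatives determined by $\mathrm df=(\partial^af)e_a$ (summation understood). Then for all $f\in A$ and all $\alpha=\alpha^ae_a\in\Omega^1$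 with $\alpha^a\in A$ $$\delta\alpha=\alpha^a\delta e_a+(-1)^ng_{ab}\partial^a\alpha^b,\qquad \square f=(\partial^af)\delta e_a+(-1)^ng_{ab}\partial^a\partial^bf,$$ $$\square\alpha=\alpha^a\square e_a+(\square\alpha^a)e_a+\partial^a\alpha^b\bigl(L_\delta(e_a,e_b)+(-1)^n\mathcal L_{e_a}e_b\bigr)+(-1)^n\partial^a\partial^b\alpha^c\bigl(e_a\vdash(e_be_c)+g_{bc}e_a-g_{ab}e_c\bigr),$$ and if $\delta\alpha=0$ then $$\square\alpha=\alpha^a\delta\mathrm de_a+\partial^a\alpha^b\bigl(\delta(e_ae_b)+(-1)^ne_a\vdash\mathrm de_b\bigr)+(-1)^n\partial^a\partial^b\alpha^c\,e_a\vdash(e_be_c).$$ -/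

import Mathlib

open scoped TensorProduct
open Coalgebra (comul counit)

noncomputable section

namespace BraidedHodge

/-! ### Right crossed (Drinfeld–Yetter) modules -/

/-- A right crossed module `V` over a Hopf algebra `A`: a right action `v ◁ a = act v a`, a right
coaction `coact v = v₀ ⊗ v₁`, and the compatibility
`(v ◁ a)₀ ⊗ (v ◁ a)₁ = v₀ ◁ a₂ ⊗ S(a₁) v₁ a₃`. -/
class CrossedModule (k A V : Type*) [Field k] [Ring A] [HopfAlgebra k A]
    [AddCommGroup V] [Module k V] where
  act : V →ₗ[k] A →ₗ[k] V
  coact : V →ₗ[k] V ⊗[k] A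
  act_one : ∀ v, act v 1 = v
  act_mul : ∀ v a b, act v (a * b) = act (act v a) b
  coact_counit : ∀ v, TensorProduct.rid k V ((counit (R := k) (A := A)).lTensor V (coact v)) = v
  coact_coassoc : ∀ v, TensorProduct.assoc k V A A (coact.rTensor A (coact v)) =
    (comul (R := k) (A := A)).lTensor V (coact v)
  /- Going through the arrows: `v ⊗ a ↦ (v₀ ⊗ v₁) ⊗ (a₂ ⊗ (a₁ ⊗ a₃))`, then
  `↦ (v₀ ⊗ a₂) ⊗ (v₁ ⊗ (a₁ ⊗ a₃))`, then `↦ (v₀ ◁ a₂) ⊗ S(a₁) (v₁ a₃)`. -/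
  compat : coact ∘ₗ TensorProduct.lift act =
    TensorProduct.map (TensorProduct.lift act)
        (LinearMap.mul' k A ∘ₗ
          TensorProduct.map (HopfAlgebra.antipode k) (LinearMap.mul' k A) ∘ₗ
          (TensorProduct.leftComm k A A A).toLinearMap) ∘ₗ
      (TensorProduct.tensorTensorTensorComm k V A A (A ⊗[k] A)).toLinearMap ∘ₗ
      TensorProduct.map coact
        ((TensorProduct.leftComm k A A A).toLinearMap ∘ₗ
          (comul (R := k) (A := A)).lTensor A ∘ₗ comul)

section Basic

variable (k A V : Type*) [Field k] [Ring A] [HopfAlgebra k A]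
  [AddCommGroup V] [Module k V] [CrossedModule k A V]

/-- The right action as a map `V ⊗ A → V`. -/
def actLin : V ⊗[k] A →ₗ[k] V := TensorProduct.lift CrossedModule.act

/-- The tensor product action `(v ⊗ w) ◁ a = v ◁ a₁ ⊗ w ◁ a₂`. -/
def actTwo : (V ⊗[k] V) ⊗[k] A →ₗ[k] V ⊗[k] V :=
  TensorProduct.map (actLin k A V) (actLin k A V) ∘ₗ
    (TensorProduct.tensorTensorTensorComm k V V A A).toLinearMap ∘ₗ
    (comul (R := k) (A := A)).lTensor (V ⊗[k] V)

/-- The tensor product coaction `v ⊗ w ↦ (v₀ ⊗ w₀) ⊗ v₁ w₁`. -/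
def coactTwo : V ⊗[k] V →ₗ[k] (V ⊗[k] V) ⊗[k] A :=
  TensorProduct.map LinearMap.id (LinearMap.mul' k A) ∘ₗ
    (TensorProduct.tensorTensorTensorComm k V A V A).toLinearMap ∘ₗ
    TensorProduct.map CrossedModule.coact CrossedModule.coact

/-- The braiding `Ψ(v ⊗ w) = w₀ ⊗ v ◁ w₁`. -/
def braiding : V ⊗[k] V →ₗ[k] V ⊗[k] V :=
  (actLin k A V).lTensor V ∘ₗ (TensorProduct.leftComm k V V A).toLinearMap ∘ₗ
    (CrossedModule.coact (k := k) (A := A) (V := V)).lTensor V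

/-- The right adjoint coaction `Ad_R(a) = a₂ ⊗ S(a₁) a₃`. -/
def adR : A →ₗ[k] A ⊗[k] A :=
  (LinearMap.mul' k A ∘ₗ (HopfAlgebra.antipode k).rTensor A).lTensor A ∘ₗ
    (TensorProduct.leftComm k A A A).toLinearMap ∘ₗ
    (comul (R := k) (A := A)).lTensor A ∘ₗ comul

/-- The augmentation ideal `A⁺ = ker ε`. -/
abbrev Augmentation : Submodule k A := LinearMap.ker (counit (R := k) (A := A))

/-- The counit projection `π_ε : A → A⁺`, `a ↦ a - ε(a)`. -/
def piEps : A →ₗ[k] Augmentation k A :=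
  LinearMap.codRestrict _ (LinearMap.id - Algebra.linearMap k A ∘ₗ counit) (by intro a; simp)

/-- A bicovariant first order calculus: a surjective morphism of right crossed modules
`ϖ : A⁺ → V`, where `A⁺` carries right multiplication and the right adjoint coaction. (For
`a ∈ A⁺` one has `π_ε(ab) = ab`, and `Ad_R(a) ∈ A⁺ ⊗ A` is fixed by `π_ε ⊗ id`.) -/
structure Calculus where
  varpi : Augmentation k A →ₗ[k] V
  surjective : Function.Surjective varpi
  map_act : ∀ (a : Augmentation k A) (b : A),
    varpi (piEps k A ((a : A) * b)) = CrossedModule.act (k := k) (A := A) (varpi a) b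
  map_coact : ∀ a : Augmentation k A,
    CrossedModule.coact (k := k) (A := A) (varpi a) = (varpi ∘ₗ piEps k A).rTensor A (adR k A (a : A))

/-- A bi-invariant metric `g = g¹ ⊗ g² ∈ V ⊗ V`: it is coinvariant, central, and has an inverse
`( , ) : V ⊗ V → k`, that is `(v, g¹) g² = v = g¹ (g², v)`. -/
structure Metric where
  tensor : V ⊗[k] V
  form : V →ₗ[k] V →ₗ[k] k
  coinvariant : coactTwo k A V tensor = tensor ⊗ₜ[k] (1 : A)
  central : ∀ a : A, actTwo k A V (tensor ⊗ₜ[k] a) = counit (R := k) a • tensor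
  form_left : ∀ v, TensorProduct.lid k V ((form v).rTensor V tensor) = v
  form_right : ∀ v, TensorProduct.rid k V ((form.flip v).lTensor V tensor) = v

end Basic

/-! ### The tensor algebra as a super-braided Hopf algebra -/

section Tensor

variable (k A V : Type*) [Field k] [Ring A] [HopfAlgebra k A]
  [AddCommGroup V] [Module k V] [CrossedModule k A V]

/-- The degree `n` component `V^{⊗ n}` of the tensor algebra. -/
abbrev tensorDeg (n : ℕ) : Submodule k (TensorAlgebra k V) :=
  LinearMap.range (TensorAlgebra.ι k : V →ₗ[k] TensorAlgebra k V) ^ n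

/-- Concatenation `v ⊗ x ↦ v x`, which identifies `V ⊗ V^{⊗ n}` with `V^{⊗ (n+1)}`. -/
def cons : V ⊗[k] TensorAlgebra k V →ₗ[k] TensorAlgebra k V :=
  TensorProduct.lift (LinearMap.mul k (TensorAlgebra k V) ∘ₗ TensorAlgebra.ι k)

/-- One step `(x, w) ↦ (v x, v ⊗ x)` of the recursion for `split`. -/
def splitStep : V →ₗ[k] Module.End k (TensorAlgebra k V × (V ⊗[k] TensorAlgebra k V)) :=
  LinearMap.mk₂ k (fun v p => (TensorAlgebra.ι k v * p.1, v ⊗ₜ[k] p.1))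
    (by intros; simp [add_mul, TensorProduct.add_tmul])
    (by intros; simp [TensorProduct.smul_tmul'])
    (by intros; simp [mul_add, TensorProduct.tmul_add])
    (by intros; simp [TensorProduct.tmul_smul])

/-- The inverse of concatenation: `v x ↦ v ⊗ x`, and `1 ↦ 0`. -/
def split : TensorAlgebra k V →ₗ[k] V ⊗[k] TensorAlgebra k V :=
  LinearMap.snd k _ _ ∘ₗ
    LinearMap.applyₗ ((1 : TensorAlgebra k V), (0 : V ⊗[k] TensorAlgebra k V)) ∘ₗ
    (TensorAlgebra.lift k (splitStep k V)).toLinearMap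

variable {k V} in
/-- `id ⊗ f`, i.e. `v x ↦ v f(x)`. -/
def shift (f : Module.End k (TensorAlgebra k V)) : Module.End k (TensorAlgebra k V) :=
  cons k V ∘ₗ f.lTensor V ∘ₗ split k V

/-- `braidAt i` is the braiding `Ψ` acting in the tensor factors `i+1, i+2`
(numbered from `1`) of a tensor power of `V`. -/
def braidAt : ℕ → Module.End k (TensorAlgebra k V)
  | 0 => cons k V ∘ₗ (cons k V).lTensor V ∘ₗ
      (TensorProduct.assoc k V V (TensorAlgebra k V)).toLinearMap ∘ₗ
      (braiding k A V).rTensor (TensorAlgebra k V) ∘ₗ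
      (TensorProduct.assoc k V V (TensorAlgebra k V)).symm.toLinearMap ∘ₗ
      (split k V).lTensor V ∘ₗ split k V
  | i + 1 => shift (braidAt i)

/-- The composite `Ψ₁ Ψ₂ ⋯ Ψ_j`. -/
def braidChain : ℕ → Module.End k (TensorAlgebra k V)
  | 0 => 1
  | j + 1 => braidChain j * braidAt k A V j

/-- The braided integer `[n, -Ψ] = id - Ψ₁ + Ψ₁Ψ₂ - ⋯ + (-1)^{n-1} Ψ₁⋯Ψ_{n-1}`, to be used on
`V^{⊗ n}`. -/
def braidedInt (n : ℕ) : Module.End k (TensorAlgebra k V) :=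
  ∑ j ∈ Finset.range n, ((-1 : k) ^ j) • braidChain k A V j

/-- The braided factorial `[n, -Ψ]! = (id ⊗ [n-1, -Ψ]!) [n, -Ψ]`, to be used on `V^{⊗ n}`. -/
def braidedFactorial : ℕ → Module.End k (TensorAlgebra k V)
  | 0 => 1
  | n + 1 => shift (braidedFactorial n) * braidedInt k A V (n + 1)

/-- The direct sum `⊕ₙ [n, -Ψ]!` over all degrees; its kernel is `⊕ₙ ker [n, -Ψ]!`. -/
def factorialSum : Module.End k (TensorAlgebra k V) :=
  DirectSum.toModule k ℕ (TensorAlgebra k V)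
      (fun n => braidedFactorial k A V n ∘ₗ (tensorDeg k V n).subtype) ∘ₗ
    (DirectSum.decomposeLinearEquiv (tensorDeg k V)).toLinearMap

/-- One step `f ↦ (a ↦ (v ◁ a₁) f(a₂))` of the recursion for the action on the tensor algebra. -/
def actStep : V →ₗ[k] Module.End k (A →ₗ[k] TensorAlgebra k V) :=
  LinearMap.mk₂ k
    (fun v f => LinearMap.mul' k (TensorAlgebra k V) ∘ₗ
      TensorProduct.map (TensorAlgebra.ι k ∘ₗ CrossedModule.act v) f ∘ₗ comul)
    (by intros; simp [LinearMap.comp_add, LinearMap.add_comp, TensorProduct.map_add_left])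
    (by intros; simp [LinearMap.comp_smul, LinearMap.smul_comp, TensorProduct.map_smul_left])
    (by intros; simp [LinearMap.comp_add, LinearMap.add_comp, TensorProduct.map_add_right])
    (by intros; simp [LinearMap.comp_smul, LinearMap.smul_comp, TensorProduct.map_smul_right])

/-- The right action on the tensor algebra: `1 ◁ a = ε(a)`, `(v x) ◁ a = (v ◁ a₁)(x ◁ a₂)`. -/
def actT : TensorAlgebra k V →ₗ[k] A →ₗ[k] TensorAlgebra k V :=
  LinearMap.applyₗ (Algebra.linearMap k (TensorAlgebra k V) ∘ₗ counit) ∘ₗ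
    (TensorAlgebra.lift k (actStep k A V)).toLinearMap

/-- The right coaction on the tensor algebra: the algebra map extending the one on `V`. -/
def coactT : TensorAlgebra k V →ₐ[k] TensorAlgebra k V ⊗[k] A :=
  TensorAlgebra.lift k ((TensorAlgebra.ι k).rTensor A ∘ₗ CrossedModule.coact)

/-- The parity automorphism `x ↦ (-1)^{|x|} x`. -/
def parityT : TensorAlgebra k V →ₐ[k] TensorAlgebra k V :=
  TensorAlgebra.lift k (-TensorAlgebra.ι k)

/-- `v ↦ (a ⊗ d ↦ (v ◁ a) d)`. -/
def actMul : V →ₗ[k] (A ⊗[k] TensorAlgebra k V →ₗ[k] TensorAlgebra k V) :=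
  LinearMap.mk₂ k
    (fun v w => TensorProduct.lift
      (LinearMap.mul k (TensorAlgebra k V) ∘ₗ TensorAlgebra.ι k ∘ₗ CrossedModule.act v) w)
    (by intro v v' w; induction w using TensorProduct.induction_on <;>
          simp_all [add_add_add_comm])
    (by intro c v w; induction w using TensorProduct.induction_on <;> simp_all)
    (by intros; simp)
    (by intros; simp)

/-- Left multiplication by `v ⊗ 1 + 1 ⊗ v` in the super-braided tensor product algebra, whose
product is `(a ⊗ b)(c ⊗ d) = (-1)^{|b||c|} a c₀ ⊗ (b ◁ c₁) d`. Explicitly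
`c ⊗ d ↦ v c ⊗ d + (-1)^{|c|} c₀ ⊗ (v ◁ c₁) d`. -/
def coprodStep :
    V →ₗ[k] Module.End k (TensorAlgebra k V ⊗[k] TensorAlgebra k V) :=
  LinearMap.mk₂ k
    (fun v w =>
      (LinearMap.mulLeft k (TensorAlgebra.ι k v)).rTensor (TensorAlgebra k V) w +
      (actMul k A V v).lTensor (TensorAlgebra k V)
        (TensorProduct.assoc k (TensorAlgebra k V) A (TensorAlgebra k V)
          (((coactT k A V).toLinearMap ∘ₗ (parityT k V).toLinearMap).rTensor
            (TensorAlgebra k V) w)))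
    (by
      intro v v' w
      simp only [map_add, LinearMap.lTensor_add, LinearMap.add_apply]
      rw [show LinearMap.mulLeft k (TensorAlgebra.ι k v + TensorAlgebra.ι k v') =
        LinearMap.mulLeft k (TensorAlgebra.ι k v) + LinearMap.mulLeft k (TensorAlgebra.ι k v') by
          ext; simp [add_mul], LinearMap.rTensor_add, LinearMap.add_apply]
      abel)
    (by
      intro c v w
      simp only [map_smul, LinearMap.lTensor_smul, LinearMap.smul_apply]
      rw [show LinearMap.mulLeft k (c • TensorAlgebra.ι k v) =
        c • LinearMap.mulLeft k (TensorAlgebra.ι k v) by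
          ext; simp, LinearMap.rTensor_smul, LinearMap.smul_apply, smul_add])
    (by intro v w w'; simp only [map_add]; abel)
    (by intro c v w; simp only [map_smul, smul_add])

/-- The super-braided coproduct of the tensor algebra: the multiplicative extension of
`v ↦ v ⊗ 1 + 1 ⊗ v`. -/
def coprodT : TensorAlgebra k V →ₗ[k] TensorAlgebra k V ⊗[k] TensorAlgebra k V :=
  LinearMap.applyₗ ((1 : TensorAlgebra k V) ⊗ₜ[k] (1 : TensorAlgebra k V)) ∘ₗ
    (TensorAlgebra.lift k (coprodStep k A V)).toLinearMap

variable {k A V}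

/-- `contract g v` removes the first letter by pairing it with `v`: `w y ↦ (v, w) y`, `1 ↦ 0`. -/
def contract (g : Metric k A V) : V →ₗ[k] Module.End k (TensorAlgebra k V) :=
  LinearMap.mk₂ k
    (fun v y => TensorProduct.lid k (TensorAlgebra k V)
      ((g.form v).rTensor (TensorAlgebra k V) (split k V y)))
    (by intros; simp [LinearMap.rTensor_add])
    (by intros; simp [LinearMap.rTensor_smul])
    (by intros; simp)
    (by intros; simp)

/-- The nested evaluation `(v₁⋯vₙ, w₁⋯wₘ) ↦ δ_{nm} (vₙ, w₁)(vₙ₋₁, w₂)⋯(v₁, wₙ)`. -/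
def nestedEval (g : Metric k A V) :
    TensorAlgebra k V →ₗ[k] TensorAlgebra k V →ₗ[k] k :=
  LinearMap.compRight k (TensorAlgebra.algebraMapInv (R := k) (M := V)).toLinearMap ∘ₗ
    (TensorAlgebra.lift k (contract g)).toLinearMap

/-- The duality pairing `⟨x, y⟩ = ev(x, [n, -Ψ]! y)` on `V^{⊗ n} × V^{⊗ n}`, zero when degrees do
not match. Here the metric makes `V` its own right dual. -/
def pairT (g : Metric k A V) : TensorAlgebra k V →ₗ[k] TensorAlgebra k V →ₗ[k] k :=
  (nestedEval g).compl₂ (factorialSum k A V)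

end Tensor

/-! ### The braided exterior algebra `Λ = B₋(V)` -/

section Exterior

variable (k A V : Type*) [Field k] [Ring A] [HopfAlgebra k A]
  [AddCommGroup V] [Module k V] [CrossedModule k A V]

/-- The braided exterior algebra `B₋(V) = T V / ⊕ₙ ker [n, -Ψ]!`. -/
abbrev BExt : Type _ :=
  RingQuot (fun x y : TensorAlgebra k V => factorialSum k A V x = 0 ∧ y = 0)

/-- The quotient map `T V → B₋(V)`. -/
def proj : TensorAlgebra k V →ₐ[k] BExt k A V :=
  RingQuot.mkAlgHom k (fun x y : TensorAlgebra k V => factorialSum k A V x = 0 ∧ y = 0)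

/-- The inclusion `V → B₋(V)` in degree one. -/
def incl : V →ₗ[k] BExt k A V := (proj k A V).toLinearMap ∘ₗ TensorAlgebra.ι k

/-- The degree `n` component of `B₋(V)`. -/
def extDeg (n : ℕ) : Submodule k (BExt k A V) :=
  (tensorDeg k V n).map (proj k A V).toLinearMap

variable {k A V} in
/-- The linear map on `B₋(V)` induced by a linear map on `T V`: the unique `h` such that
`h ∘ proj = f`. -/
def induced {M : Type*} [AddCommMonoid M] [Module k M] (f : TensorAlgebra k V →ₗ[k] M) :
    BExt k A V →ₗ[k] M :=
  Classical.epsilon fun h : BExt k A V →ₗ[k] M => ∀ x, h (proj k A V x) = f x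

/-- The right action of `A` on `B₋(V)`. -/
def actE : BExt k A V →ₗ[k] A →ₗ[k] BExt k A V :=
  induced (LinearMap.compRight k (proj k A V).toLinearMap ∘ₗ actT k A V)

/-- The right coaction of `A` on `B₋(V)`. -/
def coactE : BExt k A V →ₗ[k] BExt k A V ⊗[k] A :=
  induced ((proj k A V).toLinearMap.rTensor A ∘ₗ (coactT k A V).toLinearMap)

/-- The super-braided coproduct of `B₋(V)`. -/
def coprodE : BExt k A V →ₗ[k] BExt k A V ⊗[k] BExt k A V :=
  induced (TensorProduct.map (proj k A V).toLinearMap (proj k A V).toLinearMap ∘ₗ coprodT k A V)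

/-- The counit of `B₋(V)`. -/
def counitE : BExt k A V →ₗ[k] k :=
  induced (TensorAlgebra.algebraMapInv (R := k) (M := V)).toLinearMap

/-- The super-braided antipode of `B₋(V)`: the convolution inverse of the identity. -/
def antipodeE : BExt k A V →ₗ[k] BExt k A V :=
  Classical.epsilon fun S : BExt k A V →ₗ[k] BExt k A V =>
    LinearMap.mul' k (BExt k A V) ∘ₗ S.rTensor (BExt k A V) ∘ₗ coprodE k A V =
        Algebra.linearMap k (BExt k A V) ∘ₗ counitE k A V ∧
      LinearMap.mul' k (BExt k A V) ∘ₗ S.lTensor (BExt k A V) ∘ₗ coprodE k A V =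
        Algebra.linearMap k (BExt k A V) ∘ₗ counitE k A V

/-- The (non-degenerate) pairing `⟨ , ⟩` induced on `B₋(V)`. -/
def pairE {k A V} [Field k] [Ring A] [HopfAlgebra k A] [AddCommGroup V] [Module k V]
    [CrossedModule k A V] (g : Metric k A V) : BExt k A V →ₗ[k] BExt k A V →ₗ[k] k :=
  Classical.epsilon fun P : BExt k A V →ₗ[k] BExt k A V →ₗ[k] k =>
    ∀ x y, P (proj k A V x) (proj k A V y) = pairT g x y

/-- A unique (up to scale), central and bi-invariant top form `vol`, of degree `degree`. -/
structure TopForm where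
  degree : ℕ
  vol : BExt k A V
  vol_ne_zero : vol ≠ 0
  top_eq : extDeg k A V degree = Submodule.span k {vol}
  top : ∀ m, degree < m → extDeg k A V m = ⊥
  central : ∀ a : A, actE k A V vol a = counit (R := k) a • vol
  coinvariant : coactE k A V vol = vol ⊗ₜ[k] (1 : A)

/-- A bicovariant calculus, a bi-invariant metric, and a top form. -/
structure HodgeData where
  calculus : Calculus k A V
  metric : Metric k A V
  topForm : TopForm k A V

/-- Linear endomorphisms of `B₋(V)` that raise the degree by one and vanish on `1`. -/
abbrev DegreeOneMap : Type _ :=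
  {d : Module.End k (BExt k A V) //
    d 1 = 0 ∧ ∀ n, ∀ x ∈ extDeg k A V n, d x ∈ extDeg k A V (n + 1)}

instance : Nonempty (DegreeOneMap k A V) := ⟨⟨0, by simp⟩⟩

/-- The exterior algebra `Ω = A ⋉ Λ` as a vector space `A ⊗ Λ`; `A ⊗ V` is its degree one part
`Ω¹`. -/
abbrev Omega : Type _ := A ⊗[k] BExt k A V

variable {k A V} in
/-- Given a right action `x ◁ a = r x a` on `X` and a bilinear `β : X × Λ → Λ`, the map
`(a x, b ω) ↦ a b₁ β(x ◁ b₂, ω)` from `(A ⊗ X) × Ω` to `Ω`. -/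
def smash {X : Type*} [AddCommGroup X] [Module k X] (r : X →ₗ[k] A →ₗ[k] X)
    (β : X →ₗ[k] BExt k A V →ₗ[k] BExt k A V) :
    A ⊗[k] X →ₗ[k] Omega k A V →ₗ[k] Omega k A V :=
  TensorProduct.lift <| LinearMap.mk₂ k
    (fun a x => TensorProduct.map (LinearMap.mulLeft k a) (TensorProduct.lift (β ∘ₗ r x)) ∘ₗ
      (TensorProduct.assoc k A A (BExt k A V)).toLinearMap ∘ₗ
      (comul (R := k) (A := A)).rTensor (BExt k A V))
    (by
      intro a a' x
      rw [show LinearMap.mulLeft k (a + a') = LinearMap.mulLeft k a + LinearMap.mulLeft k a' by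
        ext; simp [add_mul], TensorProduct.map_add_left, LinearMap.add_comp])
    (by
      intro c a x
      rw [show LinearMap.mulLeft k (c • a) = c • LinearMap.mulLeft k a by
        ext; simp, TensorProduct.map_smul_left, LinearMap.smul_comp])
    (by
      intro a x x'
      rw [show TensorProduct.lift (β ∘ₗ r (x + x')) =
        TensorProduct.lift (β ∘ₗ r x) + TensorProduct.lift (β ∘ₗ r x') by
          ext; simp, TensorProduct.map_add_right, LinearMap.add_comp])
    (by
      intro c a x
      rw [show TensorProduct.lift (β ∘ₗ r (c • x)) = c • TensorProduct.lift (β ∘ₗ r x) by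
          ext; simp, TensorProduct.map_smul_right, LinearMap.smul_comp])

/-- The product `(a η)(b ω) = a b₁ (η ◁ b₂) ω` of the super-bosonisation `Ω`. -/
def mulO : Omega k A V →ₗ[k] Omega k A V →ₗ[k] Omega k A V :=
  smash (actE k A V) (LinearMap.mul k (BExt k A V))

variable {k} in
/-- A function `f ∈ A` as an element of `Ω⁰`. -/
def fn (f : A) : Omega k A V := f ⊗ₜ[k] (1 : BExt k A V)

/-- The inclusion `Ω¹ = A ⊗ V → Ω`. -/
def ofOne : A ⊗[k] V →ₗ[k] Omega k A V := (incl k A V).lTensor A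

end Exterior

/-! ### Hodge theory -/

namespace HodgeData

variable {k A V : Type*} [Field k] [Ring A] [HopfAlgebra k A]
  [AddCommGroup V] [Module k V] [CrossedModule k A V] (H : HodgeData k A V)

/-- The degree `n` of the top form. -/
abbrev deg : ℕ := H.topForm.degree

/-- The integral on `Λ`: `∫ vol = 1`, and zero in the other degrees. -/
def integral : BExt k A V →ₗ[k] k :=
  Classical.epsilon fun I : BExt k A V →ₗ[k] k =>
    I H.topForm.vol = 1 ∧ ∀ m, m ≠ H.deg → ∀ x ∈ extDeg k A V m, I x = 0

/-- The coevaluation element `exp = b_i ⊗ c_i` of the pairing: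
`⟨x, b_i⟩ c_i = x` and `b_i ⟨c_i, y⟩ = y`. -/
def exp : BExt k A V ⊗[k] BExt k A V :=
  Classical.epsilon fun E : BExt k A V ⊗[k] BExt k A V =>
    (∀ x, TensorProduct.lid k _ ((pairE H.metric x).rTensor (BExt k A V) E) = x) ∧
      ∀ y, TensorProduct.rid k _ (((pairE H.metric).flip y).lTensor (BExt k A V) E) = y

/-- The Hodge star on `Λ`: the super-braided Fourier transform `ω ↦ ∫ (ω b_i) c_i` for
`exp = b_i ⊗ c_i`. As the metric makes `V` its own right dual, the target `B₋(V*)` of the Fourier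
transform is identified with `B₋(V)` from the start. -/
def sharp : BExt k A V →ₗ[k] BExt k A V :=
  (TensorProduct.lid k (BExt k A V)).toLinearMap ∘ₗ
    (H.integral ∘ₗ LinearMap.mul' k (BExt k A V)).rTensor (BExt k A V) ∘ₗ
    (TensorProduct.assoc k (BExt k A V) (BExt k A V) (BExt k A V)).symm.toLinearMap ∘ₗ
    (TensorProduct.mk k (BExt k A V) (BExt k A V ⊗[k] BExt k A V)).flip H.exp

/-- The composite `S ♯` on `Ω`, both maps being extended as bimodule maps. -/
def antipodeSharp : Module.End k (Omega k A V) :=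
  (antipodeE k A V).lTensor A ∘ₗ H.sharp.lTensor A

/-- The interior product `η ⊢ ω = ⟨η, ω₁⟩ ω₂` on `Λ`, for `η ∈ V` and the braided coproduct. -/
def intE : V →ₗ[k] BExt k A V →ₗ[k] BExt k A V :=
  LinearMap.mk₂ k
    (fun v w => TensorProduct.lid k (BExt k A V)
      ((pairE H.metric (incl k A V v)).rTensor (BExt k A V) (coprodE k A V w)))
    (by intros; simp [LinearMap.rTensor_add])
    (by intros; simp [LinearMap.rTensor_smul])
    (by intros; simp)
    (by intros; simp)

/-- The interior product `(a η) ⊢ (b ω) = (a η b, ω₁) ω₂ = a b₁ ((η ◁ b₂) ⊢ ω)` on `Ω`. -/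
def intO : A ⊗[k] V →ₗ[k] Omega k A V →ₗ[k] Omega k A V :=
  smash CrossedModule.act H.intE

/-- The differential on functions, `d a = a₁ ϖ(π_ε a₂) ∈ Ω¹`. -/
def dFn : A →ₗ[k] A ⊗[k] V :=
  (H.calculus.varpi ∘ₗ piEps k A).lTensor A ∘ₗ comul

/-- The differential on `Λ`: the super-derivation, of degree one, given on `V` by the
Maurer–Cartan equation `d ϖ(a) = - ϖ(π_ε a₁) ϖ(π_ε a₂)`. -/
def dE : Module.End k (BExt k A V) :=
  (Classical.epsilon fun d : DegreeOneMap k A V =>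
    (∀ a : Augmentation k A, d.1 (incl k A V (H.calculus.varpi a)) =
      - LinearMap.mul' k (BExt k A V)
          (TensorProduct.map (incl k A V ∘ₗ H.calculus.varpi ∘ₗ piEps k A)
            (incl k A V ∘ₗ H.calculus.varpi ∘ₗ piEps k A) (comul (R := k) (a : A)))) ∧
    ∀ p, ∀ x ∈ extDeg k A V p, ∀ y,
      d.1 (x * y) = d.1 x * y + ((-1 : k) ^ p) • (x * d.1 y)).1

/-- The exterior derivative on `Ω`: `d(a η) = (d a) η + a (d η)`. -/
def d : Module.End k (Omega k A V) :=
  TensorProduct.lift <| LinearMap.mk₂ k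
    (fun a η => mulO k A V (ofOne k A V (H.dFn a)) (1 ⊗ₜ[k] η) + a ⊗ₜ[k] H.dE η)
    (by intros; simp only [map_add, LinearMap.add_apply, TensorProduct.add_tmul]; abel)
    (by intros; simp only [map_smul, LinearMap.smul_apply, TensorProduct.smul_tmul', smul_add])
    (by intros; simp only [map_add, TensorProduct.tmul_add]; abel)
    (by intros; simp only [map_smul, TensorProduct.tmul_smul, smul_add])

/-- The codifferential `δ = (S♯)⁻¹ d (S♯)`. -/
def codiff : Module.End k (Omega k A V) :=
  Ring.inverse H.antipodeSharp * H.d * H.antipodeSharp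

/-- The Hodge Laplacian `□ = d δ + δ d`. -/
def box : Module.End k (Omega k A V) := H.d * H.codiff + H.codiff * H.d

/-- The Lie derivative `ℒ_η ω = η ⊢ d ω + d (η ⊢ ω)` along `η ∈ Ω¹`. -/
def lie (η : A ⊗[k] V) (ω : Omega k A V) : Omega k A V :=
  H.intO η (H.d ω) + H.d (H.intO η ω)

/-- The Leibnizator `L_δ(ω, η) = δ(ω η) - (δ ω) η - (-1)^p ω (δ η)` for `ω` of degree `p`. -/
def leibnizator (p : ℕ) (ω η : Omega k A V) : Omega k A V :=
  H.codiff (mulO k A V ω η) - mulO k A V (H.codiff ω) η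
    - ((-1 : k) ^ p) • mulO k A V ω (H.codiff η)

/-- The partial derivatives defined by `d f = ∑ₐ (∂ᵃ f) eₐ`. -/
def partialDeriv {ι : Type*} (e : Module.Basis ι k V) (a : ι) (f : A) : A :=
  TensorProduct.rid k A ((e.coord a).lTensor A (H.dFn f))

/-- An element of `V` as an element of `Ω¹ ⊆ Ω`. -/
def form (_H : HodgeData k A V) (v : V) : Omega k A V := ofOne k A V (1 ⊗ₜ[k] v)

end HodgeData

end BraidedHodge

end

noncomputable section

set_option linter.unusedSectionVars false
set_option linter.unusedSimpArgs false

namespace BraidedHodge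

open LinearMap (mulLeft mulRight)
open WithConv

/-! ### One-sided convolution with functionals -/

section Convolution

variable {k A M N : Type*} [Field k] [Ring A] [HopfAlgebra k A]
  [AddCommGroup M] [Module k M] [AddCommGroup N] [Module k N]

/-! The theorem rests on one identity in Λ: S♯ turns the interior product by a one-form into left
exterior multiplication, S♯(v ⊢ ω) = (-1)^n v · S♯ω (`antipodeE_sharp_intE`). Extended to Ω
(`antipodeSharp_intO`) and combined with d(fω) = (df)ω + f dω (`d_smul`), it gives δ(fω) = f δω +
(-1)^n df ⊢ ω after conjugation by S♯. Invertibility comes from the same identity: S♯Vol = 1 and the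
image of S♯ is stable under left multiplication by Λ¹, so S♯ is onto the finite-dimensional space Λ.
As S♯1 has top degree, d S♯1 = 0 and δ vanishes on functions. The Laplacian formulas are then
bookkeeping with the two Leibniz rules and e_a ⊢ e_b = g_ab.

The identity itself is integration by parts. Let t_ij be the coaction coefficients of a basis. Λ
carries braided skew derivations with ∂_i(xy) = (∂_i x)y + (-1)^{|x|} Σ_j (x ◁ t_ij) ∂_j y, and
interior products are their combinations with coefficients g_ab. They lower the degree and Λ^{n+1} =
0, so ∫∂_i = 0. Now ⟨♯x, y⟩ = ∫xy, and the adjoint of ∂_i for the pairing is right multiplication by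
Σ_m g^{im} e_m, so ♯∂_i x is expressed by right multiplications on ♯x. The antipode moves the
generator to the left, and coinvariance of g absorbs the coaction coefficients.

Most of the length goes into the quotient Λ, whose structure maps are picked by `Classical.epsilon`
and are known only once a map with the required property is exhibited. Contracting the first letter
of [n,-Ψ]x gives ∂_i x (`coordContract_braidedInt`), hence ⟨x e_j, y⟩ = ⟨x, D_j y⟩ with D_j = Σ_i
(e_j, e_i)∂_i. Therefore the sum of the kernels of the braided factorials is the radical of the
pairing (`mem_radical_iff_factorialSum`) and the largest ∂-stable subspace of ker ε (`le_radical`).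
This criterion makes action, parity, product and grading descend. The coproduct descends because
contracting its first leg is a composite of operators D_j (`interior_mem_radical`), the pairing
because of a second adjunction (`pairT_mul_ι_right`), the antipode because convolution inverses are
unique (`antipodeE_proj`). Bijectivity of the antipode of A enters through S⁻¹, in the invariance of
the form and in `sharp_actE`. -/

/-- The operator `a ↦ φ(a₁) a₂`. -/
def convLeft (φ : A →ₗ[k] k) : A →ₗ[k] A :=
  (TensorProduct.lid k A).toLinearMap ∘ₗ φ.rTensor A ∘ₗ comul

/-- The operator `a ↦ a₁ φ(a₂)`. -/
def convRight (φ : A →ₗ[k] k) : A →ₗ[k] A :=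
  (TensorProduct.rid k A).toLinearMap ∘ₗ φ.lTensor A ∘ₗ comul

/-- Coassociativity: both sides are f(a₁) ⊗ g(a₂)φ(a₃). With its mirror image and
`map_comp_convLeft_comul`, where φ reads the middle leg, it carries matrix coefficients through
diagonal actions. -/
theorem map_convRight_comul (φ : A →ₗ[k] k) (f : A →ₗ[k] M) (g : A →ₗ[k] N) (a : A) :
    TensorProduct.map f g (comul (convRight φ a)) =
      TensorProduct.map f (g ∘ₗ convRight φ) (comul a) := by
  have h := Coalgebra.coassoc_apply (R := k) a
  -- An arbitrary tensor w replaces Δa so that the identity can be checked on pure tensors;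
  -- coassociativity enters through `h` only.
  have h1 : ∀ w : A ⊗[k] A, TensorProduct.map f g (comul (R := k)
      (TensorProduct.rid k A (φ.lTensor A w))) =
      TensorProduct.map f (g ∘ₗ (TensorProduct.rid k A).toLinearMap ∘ₗ φ.lTensor A)
        (TensorProduct.assoc k A A A ((comul (R := k)).rTensor A w)) := by
    intro w
    induction w using TensorProduct.induction_on with
    | zero => simp
    | add x y hx hy => simp only [map_add, hx, hy]
    | tmul x y =>
      simp only [LinearMap.lTensor_tmul, TensorProduct.rid_tmul, map_smul, LinearMap.rTensor_tmul]
      generalize comul (R := k) x = z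
      induction z using TensorProduct.induction_on with
      | zero => simp
      | add x y hx hy => simp only [smul_add, map_add, hx, hy, TensorProduct.add_tmul]
      | tmul x z => simp
  rw [convRight, LinearMap.comp_apply, LinearMap.comp_apply, LinearEquiv.coe_coe, h1, h]
  rw [← LinearMap.comp_apply, LinearMap.map_comp_lTensor]
  rfl

theorem map_convLeft_comul (φ : A →ₗ[k] k) (f : A →ₗ[k] M) (g : A →ₗ[k] N) (a : A) :
    TensorProduct.map f g (comul (convLeft φ a)) =
      TensorProduct.map (f ∘ₗ convLeft φ) g (comul a) := by
  have h := Coalgebra.coassoc_symm_apply (R := k) a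
  have h1 : ∀ w : A ⊗[k] A, TensorProduct.map f g (comul (R := k)
      (TensorProduct.lid k A (φ.rTensor A w))) =
      TensorProduct.map (f ∘ₗ (TensorProduct.lid k A).toLinearMap ∘ₗ φ.rTensor A) g
        ((TensorProduct.assoc k A A A).symm ((comul (R := k)).lTensor A w)) := by
    intro w
    induction w using TensorProduct.induction_on with
    | zero => simp
    | add x y hx hy => simp only [map_add, hx, hy]
    | tmul x y =>
      simp only [LinearMap.lTensor_tmul, TensorProduct.lid_tmul, map_smul, LinearMap.rTensor_tmul]
      generalize comul (R := k) y = z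
      induction z using TensorProduct.induction_on with
      | zero => simp
      | add x y hx hy => simp only [smul_add, map_add, hx, hy, TensorProduct.tmul_add]
      | tmul x z => simp [TensorProduct.smul_tmul']
  rw [convLeft, LinearMap.comp_apply, LinearMap.comp_apply, LinearEquiv.coe_coe, h1, h]
  rw [← LinearMap.comp_apply, LinearMap.map_comp_rTensor]
  rfl

theorem map_comp_convLeft_comul (φ : A →ₗ[k] k) (f : A →ₗ[k] M) (g : A →ₗ[k] N) (a : A) :
    TensorProduct.map f (g ∘ₗ convLeft φ) (comul a) =
      TensorProduct.map (f ∘ₗ convRight φ) g (comul a) := by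
  have h := Coalgebra.coassoc_symm_apply (R := k) a
  have h1 : ∀ w : A ⊗[k] (A ⊗[k] A),
      TensorProduct.map f (g ∘ₗ (TensorProduct.lid k A).toLinearMap ∘ₗ φ.rTensor A) w =
      TensorProduct.map (f ∘ₗ (TensorProduct.rid k A).toLinearMap ∘ₗ φ.lTensor A) g
        ((TensorProduct.assoc k A A A).symm w) := by
    intro w
    induction w using TensorProduct.induction_on with
    | zero => simp
    | add x y hx hy => simp only [map_add, hx, hy]
    | tmul x z =>
      induction z using TensorProduct.induction_on with
      | zero => simp
      | add x y hx hy => simp only [map_add, hx, hy, TensorProduct.tmul_add]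
      | tmul y z => simp [TensorProduct.smul_tmul']
  have h2 := h1 ((comul (R := k)).lTensor A (comul (R := k) a))
  rw [h, ← LinearMap.comp_apply, LinearMap.map_comp_lTensor, ← LinearMap.comp_apply
    (TensorProduct.map (f ∘ₗ (TensorProduct.rid k A).toLinearMap ∘ₗ φ.lTensor A) g),
    LinearMap.map_comp_rTensor] at h2
  exact h2

theorem convLeft_convRight (φ ψ : A →ₗ[k] k) (a : A) :
    convLeft φ (convRight ψ a) = convRight ψ (convLeft φ a) := by
  have h := map_convRight_comul ψ φ (LinearMap.id : A →ₗ[k] A) a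
  have h' := congrArg (TensorProduct.lid k A) h
  have h1 : ∀ w : A ⊗[k] A, TensorProduct.lid k A (TensorProduct.map φ (convRight ψ) w) =
      convRight ψ (TensorProduct.lid k A (φ.rTensor A w)) := by
    intro w
    induction w using TensorProduct.induction_on with
    | zero => simp
    | add x y hx hy => simp only [map_add, hx, hy]
    | tmul x z => simp
  rw [LinearMap.id_comp, h1] at h'
  exact h'

@[simp] theorem counit_convRight (φ : A →ₗ[k] k) (a : A) :
    counit (R := k) (convRight φ a) = φ a := by
  have h := congrArg (fun w => φ (TensorProduct.lid k A w)) (Coalgebra.rTensor_counit_comul (R := k) a)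
  simp only [TensorProduct.lid_tmul, one_smul] at h
  rw [← h]
  simp only [convRight, LinearMap.comp_apply, LinearEquiv.coe_coe]
  generalize comul (R := k) a = w
  induction w using TensorProduct.induction_on with
  | zero => simp
  | add x y hx hy => simp only [map_add, hx, hy]
  | tmul x z => simp [mul_comm]

theorem convRight_one (φ : A →ₗ[k] k) : convRight φ (1 : A) = φ 1 • 1 := by
  simp [convRight, Algebra.TensorProduct.one_def]

end Convolution

/-! ### Matrix coefficients of a crossed module -/

section Coefficients

variable {k : Type*} (A : Type*) {V ι : Type*} [Field k] [Ring A] [HopfAlgebra k A]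
  [AddCommGroup V] [Module k V] [CrossedModule k A V] (e : Module.Basis ι k V)

/-- Matrix coefficients of the action: `e_j ◁ a = ∑ᵢ ρᵢⱼ(a) eᵢ`. -/
def actCoeff (i j : ι) : A →ₗ[k] k := e.coord i ∘ₗ CrossedModule.act (e j)

/-- Matrix coefficients of the coaction: `e_j ↦ ∑ᵢ eᵢ ⊗ tᵢⱼ`. -/
def coactCoeff (i j : ι) : A :=
  TensorProduct.lid k A ((e.coord i).rTensor A (CrossedModule.coact (e j)))

variable [Fintype ι]

theorem act_basis (j : ι) (a : A) :
    CrossedModule.act (k := k) (e j) a = ∑ i, actCoeff A e i j a • e i :=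
  (e.sum_repr _).symm

theorem sum_basis_tmul {M : Type*} [AddCommGroup M] [Module k M] (w : V ⊗[k] M) :
    ∑ i, e i ⊗ₜ[k] TensorProduct.lid k M ((e.coord i).rTensor M w) = w := by
  induction w using TensorProduct.induction_on with
  | zero => simp
  | add x y hx hy => simp only [map_add, TensorProduct.tmul_add, Finset.sum_add_distrib, hx, hy]
  | tmul x z =>
    simp only [LinearMap.rTensor_tmul, TensorProduct.lid_tmul, ← TensorProduct.smul_tmul,
      ← TensorProduct.sum_tmul, Module.Basis.coord_apply, e.sum_repr]

theorem coact_basis (j : ι) :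
    CrossedModule.coact (k := k) (A := A) (e j) = ∑ i, e i ⊗ₜ[k] coactCoeff A e i j :=
  (sum_basis_tmul e _).symm

theorem basis_tmul_injective {M : Type*} [AddCommGroup M] [Module k M] {f g : ι → M}
    (h : ∑ i, e i ⊗ₜ[k] f i = ∑ i, e i ⊗ₜ[k] g i) : f = g := by
  classical
  funext i
  have := congrArg (fun w => TensorProduct.lid k M ((e.coord i).rTensor M w)) h
  simpa [Finsupp.single_apply, ite_smul] using this

variable [DecidableEq ι]

theorem counit_coactCoeff (i j : ι) :
    counit (R := k) (coactCoeff A e i j) = if i = j then 1 else 0 := by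
  have h := CrossedModule.coact_counit (k := k) (A := A) (e j)
  rw [coact_basis] at h
  have h' := congrArg (e.coord i) h
  simpa [Finsupp.single_apply, eq_comm] using h'

theorem comul_coactCoeff (i j : ι) :
    comul (R := k) (coactCoeff A e i j) = ∑ l, coactCoeff A e i l ⊗ₜ[k] coactCoeff A e l j := by
  have h := CrossedModule.coact_coassoc (k := k) (A := A) (e j)
  rw [coact_basis] at h
  simp only [map_sum, LinearMap.rTensor_tmul, LinearMap.lTensor_tmul, coact_basis,
    TensorProduct.sum_tmul, TensorProduct.assoc_tmul] at h
  rw [Finset.sum_comm] at h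
  simp only [← TensorProduct.tmul_sum] at h
  exact (congrFun (basis_tmul_injective e h) i).symm

theorem actCoeff_one (i j : ι) : actCoeff A e i j 1 = if i = j then 1 else 0 := by
  simp [actCoeff, CrossedModule.act_one, Finsupp.single_apply, eq_comm]

/-- The action is on the right, so the matrix of ab is that of b times that of a. This reversal is
why S⁻¹, and not S, inverts the matrix ρ in the convolution algebra. -/
theorem actCoeff_mul (i j : ι) (a b : A) :
    actCoeff A e i j (a * b) = ∑ l, actCoeff A e l j a * actCoeff A e i l b := by
  simp only [actCoeff, LinearMap.comp_apply, CrossedModule.act_mul]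
  refine (congrArg (fun v => e.coord i (CrossedModule.act v b)) (act_basis A e j a)).trans ?_
  simp only [map_sum, LinearMap.sum_apply, map_smul, LinearMap.smul_apply, smul_eq_mul]
  rfl

theorem convRight_actCoeff_mul (i j : ι) (a b : A) :
    convRight (actCoeff A e i j) (a * b) =
      ∑ l, convRight (actCoeff A e l j) a * convRight (actCoeff A e i l) b := by
  simp only [convRight, LinearMap.comp_apply, Bialgebra.comul_mul]
  generalize comul (R := k) a = x
  generalize comul (R := k) b = y
  induction x using TensorProduct.induction_on with
  | zero => simp
  | add x x' hx hx' => simp only [add_mul, map_add, hx, hx', Finset.sum_add_distrib]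
  | tmul x x' =>
    induction y using TensorProduct.induction_on with
    | zero => simp
    | add y y' hy hy' => simp only [mul_add, map_add, hy, hy', Finset.sum_add_distrib]
    | tmul y y' =>
      simp [actCoeff_mul, Finset.sum_smul, smul_smul, mul_comm]

/-- The crossed module compatibility `a₁ v₁ ⊗ …` solved for the antipode. -/
theorem sum_convRight_mul_coactCoeff (i j : ι) (a : A) :
    ∑ l, convRight (actCoeff A e l j) a * coactCoeff A e i l =
      ∑ l, coactCoeff A e l j * convLeft (actCoeff A e i l) a := by
  let g : A →ₗ[k] A := ∑ l, (actCoeff A e l j).smulRight (coactCoeff A e i l)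
  let f : A →ₗ[k] A := ∑ l, mulLeft k (coactCoeff A e l j) ∘ₗ convLeft (actCoeff A e i l)
  have hgf : toConv g = toConv (HopfAlgebra.antipode k) * toConv f := by
    ext a
    have h := LinearMap.congr_fun (CrossedModule.compat (k := k) (A := A) (V := V)) (e j ⊗ₜ[k] a)
    simp only [LinearMap.comp_apply, TensorProduct.lift.tmul, act_basis, map_sum, map_smul,
      coact_basis, TensorProduct.map_tmul, TensorProduct.sum_tmul] at h
    have h' := congrArg (fun w => TensorProduct.lid k A ((e.coord i).rTensor A w)) h
    simp only [map_sum, map_smul, LinearMap.rTensor_tmul, TensorProduct.lid_tmul,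
      Module.Basis.coord_apply, Module.Basis.repr_self, Finsupp.single_apply, ite_smul, one_smul,
      zero_smul, Finset.sum_ite_eq', Finset.mem_univ, if_true] at h'
    have hg : g a = ∑ l, actCoeff A e l j a • coactCoeff A e i l := by simp [g]
    change g a = _
    rw [hg, h', LinearMap.convMul_apply]
    simp only [f, WithConv.ofConv_toConv]
    generalize comul (R := k) a = w
    induction w using TensorProduct.induction_on with
    | zero => simp
    | add x y hx hy => simp only [map_add, TensorProduct.tmul_add, Finset.sum_add_distrib, hx, hy]
    | tmul x y =>
      simp only [LinearMap.lTensor_tmul, TensorProduct.map_tmul, LinearMap.mul'_apply,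
        LinearMap.sum_apply, Finset.mul_sum, LinearMap.comp_apply, convLeft]
      refine Finset.sum_congr rfl fun l _ => ?_
      generalize comul (R := k) y = z
      induction z using TensorProduct.induction_on with
      | zero => simp
      | add x y hx hy => simp only [map_add, TensorProduct.tmul_add, mul_add, hx, hy]
      | tmul y z =>
        simp [actCoeff]
  -- Compatibility says g = S * f for convolution, and convolving on the left with the identity
  -- cancels S.
  have hf : toConv (LinearMap.id : A →ₗ[k] A) * toConv g = toConv f := by
    rw [hgf, ← mul_assoc, LinearMap.id_mul_antipode, one_mul]
  have h := congrArg (fun F => F.ofConv a) hf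
  simp only [LinearMap.convMul_def, WithConv.ofConv_toConv, LinearMap.comp_apply] at h
  rw [show ∑ l, coactCoeff A e l j * convLeft (actCoeff A e i l) a = f a by simp [f], ← h]
  simp only [convRight, LinearMap.comp_apply, g]
  generalize comul (R := k) a = w
  induction w using TensorProduct.induction_on with
  | zero => simp
  | add x y hx hy => simp only [map_add, add_mul, Finset.sum_add_distrib, hx, hy]
  | tmul x y => simp [Finset.mul_sum]

end Coefficients

/-! ### The metric in coordinates -/

section MetricCoordinates

variable {k A V ι : Type*} [Field k] [Ring A] [HopfAlgebra k A]
  [AddCommGroup V] [Module k V] [CrossedModule k A V] (g : Metric k A V)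
  (e : Module.Basis ι k V)

/-- The coefficients of the tensor `g = ∑ gⁱʲ eᵢ ⊗ eⱼ`. -/
def Metric.coeff (i j : ι) : k := (e.tensorProduct e).coord (i, j) g.tensor

variable [Fintype ι] [DecidableEq ι]

theorem Metric.tensor_eq :
    g.tensor = ∑ i, ∑ j, g.coeff e i j • e i ⊗ₜ[k] e j := by
  conv_lhs => rw [← (e.tensorProduct e).sum_repr g.tensor]
  rw [Fintype.sum_prod_type]
  simp [Metric.coeff]

theorem Metric.sum_form_coeff (a c : ι) :
    ∑ i, g.form (e a) (e i) * g.coeff e i c = if a = c then 1 else 0 := by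
  have h := congrArg (e.coord c) (g.form_left (e a))
  rw [g.tensor_eq e] at h
  simpa [Finsupp.single_apply, mul_comm, TensorProduct.smul_tmul', smul_smul] using h

theorem Metric.sum_coeff_form (a c : ι) :
    ∑ i, g.coeff e a i * g.form (e i) (e c) = if a = c then 1 else 0 := by
  have h := congrArg (e.coord a) (g.form_right (e c))
  rw [g.tensor_eq e] at h
  simpa [Finsupp.single_apply, mul_comm, TensorProduct.smul_tmul', smul_smul, eq_comm] using h

theorem Metric.sum_coactCoeff_mul (i r : ι) :
    ∑ j, ∑ m, g.coeff e j m • (coactCoeff A e i j * coactCoeff A e r m) =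
      g.coeff e i r • (1 : A) := by
  have h := g.coinvariant
  rw [g.tensor_eq e] at h
  simp only [coactTwo, LinearMap.comp_apply, map_sum, map_smul, TensorProduct.map_tmul,
    coact_basis, LinearEquiv.coe_coe, TensorProduct.sum_tmul, TensorProduct.tmul_sum,
    TensorProduct.tensorTensorTensorComm_tmul, LinearMap.mul'_apply, LinearMap.id_apply] at h
  have h' := congrArg (fun w => TensorProduct.lid k A
    (((e.tensorProduct e).coord (i, r)).rTensor A w)) h
  simpa [Finsupp.single_apply, ite_and, ← TensorProduct.smul_tmul', smul_smul, Finset.smul_sum] using h'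

/-- If a matrix `t` with a left inverse preserves a tensor, then it preserves the inverse form. -/
theorem Metric.sum_form_mul_of_sum_coeff_mul {C : Type*} [Ring C] [Algebra k C]
    {t s : Matrix ι ι C} (hst : s * t = 1)
    (h : ∀ i r, ∑ j, ∑ m, g.coeff e j m • (t i j * t r m) = g.coeff e i r • (1 : C)) (i m : ι) :
    ∑ a, ∑ b, g.form (e a) (e b) • (t a i * t b m) = g.form (e i) (e m) • (1 : C) := by
  let G : Matrix ι ι C := Matrix.of fun i j => algebraMap k C (g.coeff e i j)
  let F : Matrix ι ι C := Matrix.of fun i j => algebraMap k C (g.form (e i) (e j))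
  let tT : Matrix ι ι C := Matrix.of fun i j => t j i
  have hGF : G * F = 1 := by
    ext i j
    simp only [G, F, Matrix.mul_apply, Matrix.of_apply, ← map_mul, ← map_sum, g.sum_coeff_form,
      Matrix.one_apply]
    split_ifs <;> simp
  have hFG : F * G = 1 := by
    ext i j
    simp only [G, F, Matrix.mul_apply, Matrix.of_apply, ← map_mul, ← map_sum, g.sum_form_coeff,
      Matrix.one_apply]
    split_ifs <;> simp
  have htG : t * (G * tT) = G := by
    ext i r
    simp only [G, tT, Matrix.mul_apply, Matrix.of_apply, Finset.mul_sum]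
    rw [← mul_one (algebraMap k C _), ← Algebra.smul_def, ← h]
    refine Finset.sum_congr rfl fun j _ => Finset.sum_congr rfl fun m _ => ?_
    rw [← Algebra.smul_def, mul_smul_comm]
  -- Invariance of the tensor is t G tᵀ = G, so G tᵀ F is a right inverse of t. It equals the given
  -- left inverse, hence is a left inverse as well, which is tᵀ F t = F. Only the scalar matrices G
  -- and F are moved past other entries, so C may be noncommutative.
  have htw : t * (G * tT * F) = 1 := by rw [← mul_assoc, htG, hGF]
  have hwt : G * tT * F * t = 1 := by rw [← left_inv_eq_right_inv hst htw, hst]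
  have hF : tT * (F * t) = F := by
    calc tT * (F * t) = F * (G * tT * F * t) := by
          simp only [← mul_assoc, hFG, one_mul]
      _ = F := by rw [hwt, mul_one]
  have h' := congrFun (congrFun hF i) m
  simp only [F, tT, Matrix.mul_apply, Matrix.of_apply, Finset.mul_sum] at h'
  rw [Algebra.smul_def, mul_one, ← h']
  refine Finset.sum_congr rfl fun a _ => Finset.sum_congr rfl fun b _ => ?_
  rw [← Algebra.smul_def, mul_smul_comm]

/-- The form of the metric is coinvariant. -/
theorem Metric.sum_form_coactCoeff_mul (i m : ι) :
    ∑ a, ∑ b, g.form (e a) (e b) • (coactCoeff A e a i * coactCoeff A e b m) =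
      g.form (e i) (e m) • (1 : A) := by
  refine g.sum_form_mul_of_sum_coeff_mul e (C := A)
    (t := Matrix.of fun i j => coactCoeff A e i j)
    (s := Matrix.of fun i j => HopfAlgebra.antipode k (coactCoeff A e i j)) ?_
    (g.sum_coactCoeff_mul e) i m
  ext i j
  have h := HopfAlgebra.mul_antipode_rTensor_comul_apply (R := k) (coactCoeff A e i j)
  rw [comul_coactCoeff, counit_coactCoeff] at h
  simpa [Matrix.mul_apply, Matrix.one_apply, apply_ite] using h

/-- Iterated coefficients become products in the convolution algebra of functionals on A, the second
ring (after A itself) to which the matrix lemma above is applied. -/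
theorem comp_convLeft_eq_convMul (φ ψ : A →ₗ[k] k) :
    toConv (ψ ∘ₗ convLeft φ) = toConv φ * toConv ψ := by
  ext a
  change ψ (convLeft φ a) = LinearMap.mul' k k (TensorProduct.map φ ψ (comul a))
  simp only [convLeft, LinearMap.comp_apply]
  generalize comul (R := k) a = w
  induction w using TensorProduct.induction_on with
  | zero => simp
  | add x y hx hy => simp only [map_add, hx, hy]
  | tmul x y => simp

/-- The form of the metric is invariant. -/
theorem Metric.sum_form_actCoeff_mul
    (hS : Function.Bijective (HopfAlgebra.antipode k : A →ₗ[k] A)) (i m : ι) (x : A) :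
    ∑ a, ∑ b, g.form (e a) (e b) * actCoeff A e b m (convLeft (actCoeff A e a i) x) =
      g.form (e i) (e m) * counit (R := k) x := by
  let S := LinearEquiv.ofBijective _ hS
  -- This is x₂ S⁻¹(x₁) = ε(x). Because of the reversed product rule for ρ, it makes ρ ∘ S⁻¹ a left
  -- inverse of ρ.
  have hS1 (x : A) : LinearMap.mul' k A (TensorProduct.comm k A A
      ((S.symm : A →ₗ[k] A).rTensor A (comul x))) = algebraMap k A (counit x) := by
    apply hS.1
    rw [Algebra.algebraMap_eq_smul_one, map_smul, HopfAlgebra.antipode_one,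
      ← Algebra.algebraMap_eq_smul_one, ← HopfAlgebra.mul_antipode_lTensor_comul_apply]
    generalize comul (R := k) x = w
    induction w using TensorProduct.induction_on with
    | zero => simp
    | add x y hx hy => simp only [map_add, hx, hy]
    | tmul x y =>
      have : HopfAlgebra.antipode k (S.symm x) = x := S.apply_symm_apply x
      simp [HopfAlgebra.antipode_mul_antidistrib, this]
  have key := g.sum_form_mul_of_sum_coeff_mul e (C := WithConv (A →ₗ[k] k))
    (t := Matrix.of fun i j => toConv (actCoeff A e i j))
    (s := Matrix.of fun i j => toConv (actCoeff A e i j ∘ₗ (S.symm : A →ₗ[k] A))) ?_ ?_ i m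
  · have h := congrArg (fun F => F.ofConv x) key
    simp only [Matrix.of_apply, ← comp_convLeft_eq_convMul] at h
    simpa [LinearMap.sum_apply] using h
  · ext i j x
    have h1 := congrArg (actCoeff A e i j) (hS1 x)
    have h2 : ((1 : Matrix ι ι (WithConv (A →ₗ[k] k))) i j) x =
        actCoeff A e i j (algebraMap k A (counit x)) := by
      rw [Algebra.algebraMap_eq_smul_one, map_smul, actCoeff_one, Matrix.one_apply]
      split_ifs <;> simp
    rw [h2, ← h1, Matrix.mul_apply]
    have h3 : ∀ F : ι → WithConv (A →ₗ[k] k), (∑ l, F l) x = ∑ l, F l x := fun F => by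
      simp
    rw [h3]
    simp only [Matrix.of_apply, LinearMap.convMul_apply]
    generalize comul (R := k) x = w
    induction w using TensorProduct.induction_on with
    | zero => simp
    | add x y hx hy => simp only [map_add, hx, hy, Finset.sum_add_distrib]
    | tmul x y => simp [actCoeff_mul, mul_comm]
  · intro i r
    ext x
    have h := g.central x
    rw [g.tensor_eq e] at h
    have h' := congrArg ((e.tensorProduct e).coord (i, r)) h
    simp only [actTwo, LinearMap.comp_apply, LinearMap.lTensor_tmul] at h'
    have h3 : ∀ F : ι → WithConv (A →ₗ[k] k), (∑ l, F l) x = ∑ l, F l x := fun F => by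
      simp
    have h4 : (g.coeff e i r • (1 : WithConv (A →ₗ[k] k))) x = g.coeff e i r * counit x := by
      simp
    have h5 : ∀ (c : k) (F : WithConv (A →ₗ[k] k)), (c • F) x = c * F x := fun c F => rfl
    simp only [h3, h4, h5, Matrix.of_apply, LinearMap.convMul_apply]
    have h6 : (e.tensorProduct e).coord (i, r) (counit (R := k) x •
        ∑ i, ∑ j, g.coeff e i j • e i ⊗ₜ[k] e j) = g.coeff e i r * counit (R := k) x := by
      simp [Finsupp.single_apply, ite_and, mul_comm]
    rw [← h6, ← h']
    generalize comul (R := k) x = w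
    induction w using TensorProduct.induction_on with
    | zero => simp
    | add x y hx hy =>
      simp only [map_add, hx, hy, Finset.sum_add_distrib, mul_add, TensorProduct.tmul_add]
    | tmul x y =>
      simp only [TensorProduct.sum_tmul, map_sum, ← TensorProduct.smul_tmul', map_smul]
      simp [actLin, actCoeff, mul_comm (e.repr _ i)]

end MetricCoordinates

/-! ### The tensor algebra: induction and splitting -/

section TensorBasics

variable {k A V ι : Type*} [Field k] [Ring A] [HopfAlgebra k A]
  [AddCommGroup V] [Module k V] [CrossedModule k A V] [Fintype ι]

local notation "T" => TensorAlgebra k V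
local notation "act" => CrossedModule.act (k := k) (A := A) (V := V)
local notation "ιT" => TensorAlgebra.ι k (M := V)

/-- Strengthening the claim to "P x implies P (x * y)" lets the usual induction append letters one
at a time. Both this and the left version are needed: action and skew derivations are defined from
the first letter, while pairing, coproduct and antipode are governed by the last. -/
theorem tensorAlgebra_induction_right (e : Module.Basis ι k V) {P : T → Prop} (one : P 1)
    (add : ∀ x y, P x → P y → P (x + y)) (smul : ∀ (c : k) x, P x → P (c • x))
    (mul : ∀ x j, P x → P (x * ιT (e j))) (x : T) : P x := by
  have zero : P 0 := by simpa using smul 0 1 one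
  have hsum : ∀ F : ι → T, (∀ i, P (F i)) → P (∑ i, F i) := fun F hF =>
    Finset.sum_induction _ P (fun _ _ => add _ _) zero (fun i _ => hF i)
  suffices h : ∀ y : T, ∀ x, P x → P (x * y) by simpa using h x 1 one
  intro y
  induction y using TensorAlgebra.induction with
  | algebraMap r =>
    intro x hx
    rw [Algebra.algebraMap_eq_smul_one, mul_smul_comm, mul_one]
    exact smul r x hx
  | ι v =>
    intro x hx
    rw [← e.sum_repr v, map_sum, Finset.mul_sum]
    refine hsum _ fun i => ?_
    rw [map_smul, mul_smul_comm]
    exact smul _ _ (mul _ _ hx)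
  | mul a b ha hb => intro x hx; rw [← mul_assoc]; exact hb _ (ha _ hx)
  | add a b ha hb => intro x hx; rw [mul_add]; exact add _ _ (ha _ hx) (hb _ hx)

theorem tensorAlgebra_induction_left (e : Module.Basis ι k V) {P : T → Prop} (one : P 1)
    (add : ∀ x y, P x → P y → P (x + y)) (smul : ∀ (c : k) x, P x → P (c • x))
    (mul : ∀ x j, P x → P (ιT (e j) * x)) (x : T) : P x := by
  have zero : P 0 := by simpa using smul 0 1 one
  have hsum : ∀ F : ι → T, (∀ i, P (F i)) → P (∑ i, F i) := fun F hF =>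
    Finset.sum_induction _ P (fun _ _ => add _ _) zero (fun i _ => hF i)
  suffices h : ∀ y : T, ∀ x, P x → P (y * x) by simpa using h x 1 one
  intro y
  induction y using TensorAlgebra.induction with
  | algebraMap r =>
    intro x hx
    rw [Algebra.algebraMap_eq_smul_one, smul_mul_assoc, one_mul]
    exact smul r x hx
  | ι v =>
    intro x hx
    rw [← e.sum_repr v, map_sum, Finset.sum_mul]
    refine hsum _ fun i => ?_
    rw [map_smul, smul_mul_assoc]
    exact smul _ _ (mul _ _ hx)
  | mul a b ha hb => intro x hx; rw [mul_assoc]; exact ha _ (hb _ hx)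
  | add a b ha hb => intro x hx; rw [add_mul]; exact add _ _ (ha _ hx) (hb _ hx)

/-- The counit of the tensor algebra. -/
local notation "εT" => TensorAlgebra.algebraMapInv (R := k) (M := V)

@[simp] theorem algebraMapInv_ι (v : V) : εT (ιT v) = 0 := by
  simp [TensorAlgebra.algebraMapInv]

theorem cons_tmul (v : V) (x : T) : cons k V (v ⊗ₜ x) = ιT v * x := by
  simp [cons]

theorem split_one : split k V (1 : T) = 0 := by
  simp [split]

theorem splitStep_apply (v : V) (p : T × (V ⊗[k] T)) :
    splitStep k V v p = (ιT v * p.1, v ⊗ₜ[k] p.1) := rfl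

/-- The first component of the recursion only records the word read so far; this is what identifies
the second component in `split_ι_mul`. -/
theorem lift_splitStep_fst (x : T) :
    (TensorAlgebra.lift k (splitStep k V) x (1, 0)).1 = x := by
  have h : ∀ p : T × (V ⊗[k] T), (TensorAlgebra.lift k (splitStep k V) x p).1 = x * p.1 := by
    induction x using TensorAlgebra.induction with
    | algebraMap r => intro p; simp [Algebra.algebraMap_eq_smul_one]
    | ι v => intro p; simp [splitStep_apply]
    | mul a b ha hb => intro p; rw [map_mul, Module.End.mul_apply, ha, hb, mul_assoc]
    | add a b ha hb => intro p; rw [map_add, LinearMap.add_apply, Prod.fst_add, ha, hb, add_mul]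
  simpa using h (1, 0)

theorem split_ι_mul (v : V) (x : T) : split k V (ιT v * x) = v ⊗ₜ x := by
  have := lift_splitStep_fst (k := k) x
  simp [split, splitStep_apply, this]

theorem split_cons (w : V ⊗[k] T) : split k V (cons k V w) = w := by
  induction w using TensorProduct.induction_on with
  | zero => simp
  | add x y hx hy => simp only [map_add, hx, hy]
  | tmul v x => rw [cons_tmul, split_ι_mul]

theorem shift_ι_mul (f : Module.End k T) (v : V) (x : T) : shift f (ιT v * x) = ιT v * f x := by
  simp [shift, split_ι_mul, cons_tmul]

theorem shift_mul (f g : Module.End k T) : shift (f * g) = shift f * shift g := by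
  ext x
  simp only [shift, Module.End.mul_eq_comp, LinearMap.comp_apply, split_cons,
    LinearMap.lTensor_comp]

theorem algebraMapInv_shift (f : Module.End k T) (x : T) : εT (shift f x) = 0 := by
  have h : ∀ w : V ⊗[k] T, εT (cons k V w) = 0 := by
    intro w
    induction w using TensorProduct.induction_on with
    | zero => simp
    | add x y hx hy => simp only [map_add, hx, hy, add_zero]
    | tmul v x => simp [cons_tmul]
  exact h _

theorem contract_one (g : Metric k A V) (v : V) : contract g v (1 : T) = 0 := by
  simp [contract, split_one]

/-- `shift f` leaves the first letter alone. After a contraction this removes the factor id ⊗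
[n-1,-Ψ]! of the braided factorial. -/
theorem contract_shift (g : Metric k A V) (v : V) (f : Module.End k T) (x : T) :
    contract g v (shift f x) = f (contract g v x) := by
  simp only [contract, shift, LinearMap.mk₂_apply, LinearMap.comp_apply, split_cons]
  generalize split k V x = w
  induction w using TensorProduct.induction_on with
  | zero => simp
  | add x y hx hy => simp only [map_add, hx, hy]
  | tmul v x => simp

theorem nestedEval_one (g : Metric k A V) (y : T) : nestedEval g 1 y = εT y := by
  simp [nestedEval]

theorem nestedEval_mul_ι (g : Metric k A V) (x : T) (v : V) (y : T) :
    nestedEval g (x * ιT v) y = nestedEval g x (contract g v y) := by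
  simp [nestedEval]

/-! ### The action on the tensor algebra -/

theorem actT_one (a : A) : actT k A V 1 a = algebraMap k T (counit a) := by
  simp [actT]

variable (e : Module.Basis ι k V)

theorem actT_ι_mul (j : ι) (x : T) (a : A) :
    actT k A V (ιT (e j) * x) a =
      ∑ i, ιT (e i) * actT k A V x (convLeft (actCoeff A e i j) a) := by
  have h : actT k A V (ιT (e j) * x) a = LinearMap.mul' k T (TensorProduct.map
      (TensorAlgebra.ι k ∘ₗ act (e j)) (actT k A V x) (comul a)) := by
    simp [actT, actStep]
  rw [h]
  simp only [convLeft, LinearMap.comp_apply]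
  generalize comul (R := k) a = w
  induction w using TensorProduct.induction_on with
  | zero => simp
  | add x y hx hy => simp only [map_add, mul_add, Finset.sum_add_distrib, hx, hy]
  | tmul x y => simp [act_basis, Finset.sum_mul]

theorem actT_ι (v : V) (a : A) : actT k A V (ιT v) a = ιT (act v a) := by
  have h : ∀ w : A ⊗[k] A, LinearMap.mul' k T (TensorProduct.map
      (TensorAlgebra.ι k ∘ₗ act v) (Algebra.linearMap k T ∘ₗ counit) w) =
      ιT (act v (TensorProduct.rid k A ((counit (R := k)).lTensor A w))) := by
    intro w
    induction w using TensorProduct.induction_on with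
    | zero => simp
    | add x y hx hy => simp only [map_add, hx, hy]
    | tmul x y => simp [Algebra.algebraMap_eq_smul_one]
  have h' := h (comul a)
  rw [Coalgebra.lTensor_counit_comul, TensorProduct.rid_tmul, one_smul] at h'
  rw [← h']
  simp [actT, actStep]

variable [DecidableEq ι]

/-- The action is defined by peeling off the first letter; the rule for the last letter follows
because left and right convolutions commute (`convLeft_convRight`). -/
theorem actT_mul_ι (m : ι) (x : T) (a : A) :
    actT k A V (x * ιT (e m)) a =
      ∑ l, actT k A V x (convRight (actCoeff A e l m) a) * ιT (e l) := by
  induction x using tensorAlgebra_induction_left e generalizing a with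
  | one => simp [actT_ι, actT_one, act_basis, Algebra.algebraMap_eq_smul_one]
  | add x y hx hy => simp only [add_mul, map_add, LinearMap.add_apply, hx, hy,
      Finset.sum_add_distrib]
  | smul c x hx => simp only [smul_mul_assoc, map_smul, LinearMap.smul_apply, hx, Finset.smul_sum]
  | mul x j hx =>
    simp only [mul_assoc, actT_ι_mul, hx, Finset.mul_sum, Finset.sum_mul, convLeft_convRight]
    exact Finset.sum_comm

theorem actT_mul (e : Module.Basis ι k V) (x y : T) (a : A) :
    actT k A V (x * y) a =
      LinearMap.mul' k T (TensorProduct.map (actT k A V x) (actT k A V y) (comul a)) := by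
  induction y using tensorAlgebra_induction_right e generalizing a with
  | one =>
    have h : ∀ w : A ⊗[k] A, LinearMap.mul' k T (TensorProduct.map
        (actT k A V x) (actT k A V 1) w) =
        actT k A V x (TensorProduct.rid k A ((counit (R := k)).lTensor A w)) := by
      intro w
      induction w using TensorProduct.induction_on with
      | zero => simp
      | add x y hx hy => simp only [map_add, hx, hy]
      | tmul x y => simp [Algebra.algebraMap_eq_smul_one, actT_one]
    rw [h, Coalgebra.lTensor_counit_comul, TensorProduct.rid_tmul, one_smul, mul_one]
  | add y y' hy hy' =>
    simp only [mul_add, map_add, LinearMap.add_apply, hy, hy', TensorProduct.map_add_right]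
  | smul c y hy =>
    simp only [mul_smul_comm, map_smul, LinearMap.smul_apply, hy, TensorProduct.map_smul_right]
  | mul y j hy =>
    have h : ∀ w : A ⊗[k] A, LinearMap.mul' k T (TensorProduct.map
        (actT k A V x) (actT k A V (y * ιT (e j))) w) =
        ∑ l, LinearMap.mul' k T (TensorProduct.map (actT k A V x)
          (actT k A V y ∘ₗ convRight (actCoeff A e l j)) w) * ιT (e l) := by
      intro w
      induction w using TensorProduct.induction_on with
      | zero => simp
      | add x y hx hy => simp only [map_add, hx, hy, add_mul, Finset.sum_add_distrib]
      | tmul x y => simp [actT_mul_ι, Finset.mul_sum, mul_assoc]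
    simp only [← mul_assoc, actT_mul_ι _ j, hy, h, map_convRight_comul]

theorem actT_act_one (e : Module.Basis ι k V) (x : T) : actT k A V x 1 = x := by
  induction x using tensorAlgebra_induction_right e with
  | one => simp [actT_one]
  | add x y hx hy => rw [map_add, LinearMap.add_apply, hx, hy]
  | smul c x hx => rw [map_smul, LinearMap.smul_apply, hx]
  | mul x j hx =>
    simp [actT_mul_ι, convRight_one, actCoeff_one, hx, apply_ite (actT k A V x), ite_mul]

theorem actT_act_mul (e : Module.Basis ι k V) (x : T) (a b : A) :
    actT k A V x (a * b) = actT k A V (actT k A V x a) b := by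
  induction x using tensorAlgebra_induction_right e generalizing a b with
  | one => simp [actT_one, Algebra.algebraMap_eq_smul_one, smul_smul, mul_comm]
  | add x y hx hy => simp only [map_add, LinearMap.add_apply, hx, hy]
  | smul c x hx => simp only [map_smul, LinearMap.smul_apply, hx]
  | mul x j hx =>
    simp only [actT_mul_ι, convRight_actCoeff_mul, map_sum, hx, Finset.sum_mul,
      LinearMap.sum_apply]
    exact Finset.sum_comm

theorem actT_mul_coactCoeff (x y : T) (i j : ι) :
    actT k A V (x * y) (coactCoeff A e i j) =
      ∑ l, actT k A V x (coactCoeff A e i l) * actT k A V y (coactCoeff A e l j) := by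
  rw [actT_mul e, comul_coactCoeff]
  simp

theorem algebraMapInv_actT (e : Module.Basis ι k V) (x : T) (a : A) : εT (actT k A V x a) = εT x * counit a := by
  induction x using tensorAlgebra_induction_right e generalizing a with
  | one => simp [actT_one]
  | add x y hx hy => simp only [map_add, LinearMap.add_apply, hx, hy, add_mul]
  | smul c x hx => simp only [map_smul, LinearMap.smul_apply, hx, smul_mul_assoc]
  | mul x j hx => simp [actT_mul_ι]

theorem parityT_ι (v : V) : parityT k V (ιT v) = - ιT v := by
  simp [parityT]

theorem parityT_actT (e : Module.Basis ι k V) (x : T) (a : A) :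
    parityT k V (actT k A V x a) = actT k A V (parityT k V x) a := by
  induction x using tensorAlgebra_induction_right e generalizing a with
  | one => simp [actT_one, Algebra.algebraMap_eq_smul_one]
  | add x y hx hy => simp only [map_add, LinearMap.add_apply, hx, hy]
  | smul c x hx => simp only [map_smul, LinearMap.smul_apply, hx]
  | mul x j hx => simp [actT_mul_ι, parityT_ι, hx]

theorem algebraMapInv_parityT (x : T) : εT (parityT k V x) = εT x := by
  have : (εT).comp (parityT k V) = εT := by
    ext; simp [parityT_ι]
  exact DFunLike.congr_fun this x

/-! ### Braided skew derivations -/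

/-- One step of the recursion `∂ᵢ(v x) = vⁱ x - ∑ⱼ (v ◁ tᵢⱼ) ∂ⱼ x`. -/
def derivStep : V →ₗ[k] Module.End k (T × (ι → T)) :=
  LinearMap.mk₂ k (fun v p => (ιT v * p.1, fun i => e.coord i v • p.1 -
      ∑ j, ιT (act v (coactCoeff A e i j)) * p.2 j))
    (by
      intro v w p
      ext
      · simp [add_mul]
      · simp only [map_add, add_smul, LinearMap.add_apply, add_mul, Finset.sum_add_distrib,
          Prod.snd_add, Pi.add_apply]
        abel)
    (by
      intro c v p
      ext
      · simp
      · simp only [map_smul, LinearMap.smul_apply, smul_mul_assoc, Finset.smul_sum, smul_sub,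
          smul_smul, smul_eq_mul, Prod.smul_snd, Pi.smul_apply])
    (by
      intro v p q
      ext
      · simp [mul_add]
      · simp only [smul_add, mul_add, Finset.sum_add_distrib,
          Prod.snd_add, Prod.fst_add, Pi.add_apply]
        abel)
    (by
      intro c v p
      ext
      · simp
      · simp only [mul_smul_comm, Finset.smul_sum, smul_sub, smul_smul, mul_comm c,
          Prod.smul_snd, Prod.smul_fst, Pi.smul_apply])

theorem derivStep_apply (v : V) (p : T × (ι → T)) :
    derivStep (A := A) e v p = (ιT v * p.1, fun i => e.coord i v • p.1 -
      ∑ j, ιT (act v (coactCoeff A e i j)) * p.2 j) := rfl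

variable (A) in
/-- The braided skew derivation `∂ᵢ` of the tensor algebra dual to the basis vector `eᵢ`. -/
def deriv (i : ι) : Module.End k T :=
  LinearMap.proj i ∘ₗ LinearMap.snd k T (ι → T) ∘ₗ
    LinearMap.applyₗ ((1 : T), (0 : ι → T)) ∘ₗ
    (TensorAlgebra.lift k (derivStep (A := A) e)).toLinearMap

theorem deriv_one (i : ι) : deriv A e i 1 = 0 := by
  simp [deriv]

theorem deriv_ι_mul (i : ι) (v : V) (x : T) :
    deriv A e i (ιT v * x) = e.coord i v • x -
      ∑ j, ιT (act v (coactCoeff A e i j)) * deriv A e j x := by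
  have h : ∀ x : T, (TensorAlgebra.lift k (derivStep (A := A) e) x (1, 0)).1 = x := by
    intro x
    have h : ∀ p : T × (ι → T), (TensorAlgebra.lift k (derivStep (A := A) e) x p).1 = x * p.1 := by
      induction x using TensorAlgebra.induction with
      | algebraMap r => intro p; simp [Algebra.algebraMap_eq_smul_one]
      | ι v => intro p; simp [derivStep_apply]
      | mul a b ha hb => intro p; rw [map_mul, Module.End.mul_apply, ha, hb, mul_assoc]
      | add a b ha hb => intro p; rw [map_add, LinearMap.add_apply, Prod.fst_add, ha, hb, add_mul]
    simpa using h (1, 0)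
  simp [deriv, derivStep_apply, h]

theorem deriv_parityT (i : ι) (x : T) :
    deriv A e i (parityT k V x) = - parityT k V (deriv A e i x) := by
  induction x using tensorAlgebra_induction_left e generalizing i with
  | one => simp [deriv_one]
  | add x y hx hy => simp only [map_add, hx, hy, neg_add]
  | smul c x hx => simp only [map_smul, hx, smul_neg]
  | mul x j hx =>
    simp [parityT_ι, deriv_ι_mul, hx]

/-- Each letter of x that the derivation passes costs a sign and a coaction coefficient; by Δt_ij =
Σ_l t_il ⊗ t_lj these assemble into the action of a single t_ij on the whole of x. -/
theorem deriv_mul_ι (i j : ι) (x : T) :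
    deriv A e i (x * ιT (e j)) = deriv A e i x * ιT (e j) +
      actT k A V (parityT k V x) (coactCoeff A e i j) := by
  induction x using tensorAlgebra_induction_left e generalizing i with
  | one =>
    have := deriv_ι_mul (A := A) e i (e j) 1
    simp only [mul_one, deriv_one, mul_zero, Finset.sum_const_zero, sub_zero] at this
    simp [deriv_one, this, actT_one, counit_coactCoeff, Finsupp.single_apply, eq_comm,
      Algebra.algebraMap_eq_smul_one]
  | add x y hx hy => simp only [map_add, LinearMap.add_apply, add_mul, hx, hy]; abel
  | smul c x hx => simp only [smul_mul_assoc, map_smul, LinearMap.smul_apply, hx, smul_add]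
  | mul x m hx =>
    simp only [mul_assoc, deriv_ι_mul, hx, map_mul, parityT_ι, neg_mul, map_neg,
      LinearMap.neg_apply, actT_mul_coactCoeff, mul_add, Finset.sum_add_distrib, actT_ι,
      sub_mul, smul_mul_assoc, Finset.sum_mul]
    abel

theorem deriv_mul (i : ι) (y x : T) :
    deriv A e i (y * x) = deriv A e i y * x +
      ∑ j, actT k A V (parityT k V y) (coactCoeff A e i j) * deriv A e j x := by
  induction x using tensorAlgebra_induction_right e generalizing i with
  | one => simp [deriv_one]
  | add x y hx hy => simp only [map_add, mul_add, hx, hy, Finset.sum_add_distrib]; abel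
  | smul c x hx => simp only [mul_smul_comm, map_smul, hx, smul_add, Finset.smul_sum]
  | mul x m hx =>
    simp only [← mul_assoc, deriv_mul_ι, hx, map_mul, actT_mul_coactCoeff, mul_add,
      Finset.sum_add_distrib, add_mul, Finset.sum_mul]
    abel

/-- The skew derivations are equivariant. -/
theorem deriv_actT (i : ι) (x : T) (a : A) :
    deriv A e i (actT k A V x a) =
      ∑ j, actT k A V (deriv A e j x) (convLeft (actCoeff A e i j) a) := by
  induction x using tensorAlgebra_induction_right e generalizing i a with
  | one => simp [deriv_one, actT_one, Algebra.algebraMap_eq_smul_one]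
  | add x y hx hy => simp only [map_add, LinearMap.add_apply, hx, hy, Finset.sum_add_distrib]
  | smul c x hx => simp only [map_smul, LinearMap.smul_apply, hx, Finset.smul_sum]
  | mul x m hx =>
    -- The crossed module compatibility, applied to the term x ◁ t_im, is the only nonformal input:
    -- it exchanges acting by a with acting by a coaction coefficient.
    have h := congrArg (actT k A V (parityT k V x)) (sum_convRight_mul_coactCoeff A e i m a)
    simp only [map_sum, actT_act_mul e] at h
    simp only [actT_mul_ι, deriv_mul_ι, map_sum, map_add, LinearMap.add_apply, hx,
      Finset.sum_mul, Finset.sum_add_distrib, parityT_actT e, h, convLeft_convRight]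
    congr 1
    exact Finset.sum_comm

end TensorBasics

/-! ### The grading of the tensor algebra -/

section Grading

variable {k A V ι : Type*} [Field k] [Ring A] [HopfAlgebra k A]
  [AddCommGroup V] [Module k V] [CrossedModule k A V] [Fintype ι] [DecidableEq ι]
  (g : Metric k A V) (e : Module.Basis ι k V)

local notation "T" => TensorAlgebra k V
local notation "act" => CrossedModule.act (k := k) (A := A) (V := V)
local notation "ιT" => TensorAlgebra.ι k (M := V)
local notation "εT" => TensorAlgebra.algebraMapInv (R := k) (M := V)

theorem ι_mul_mem (v : V) {n : ℕ} {x : T} (hx : x ∈ tensorDeg k V n) :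
    ιT v * x ∈ tensorDeg k V (n + 1) := by
  rw [tensorDeg, pow_succ']
  exact Submodule.mul_mem_mul ⟨v, rfl⟩ hx

theorem mul_ι_mem (v : V) {n : ℕ} {x : T} (hx : x ∈ tensorDeg k V n) :
    x * ιT v ∈ tensorDeg k V (n + 1) := by
  rw [tensorDeg, pow_succ]
  exact Submodule.mul_mem_mul hx ⟨v, rfl⟩

theorem tensorDeg_induction_left {P : ∀ (n : ℕ) (x : T), x ∈ tensorDeg k V n → Prop}
    (algebraMap : ∀ r : k, P 0 (algebraMap k T r) (Submodule.algebraMap_mem r))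
    (add : ∀ n x y hx hy, P n x hx → P n y hy → P n (x + y) (add_mem hx hy))
    (mul : ∀ n x v hx, P n x hx → P (n + 1) (ιT v * x) (ι_mul_mem v hx))
    {n : ℕ} {x : T} (hx : x ∈ tensorDeg k V n) : P n x hx :=
  Submodule.pow_induction_on_left' (LinearMap.range ιT) (C := P) algebraMap
    (fun x y i hx hy => add i x y hx hy)
    (fun m hm i x hx h => by obtain ⟨v, rfl⟩ := hm; exact mul i x v hx h) hx

theorem tensorDeg_induction_right {P : ∀ (n : ℕ) (x : T), x ∈ tensorDeg k V n → Prop}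
    (algebraMap : ∀ r : k, P 0 (algebraMap k T r) (Submodule.algebraMap_mem r))
    (add : ∀ n x y hx hy, P n x hx → P n y hy → P n (x + y) (add_mem hx hy))
    (mul : ∀ n x v hx, P n x hx → P (n + 1) (x * ιT v) (mul_ι_mem v hx))
    {n : ℕ} {x : T} (hx : x ∈ tensorDeg k V n) : P n x hx :=
  Submodule.pow_induction_on_right' (LinearMap.range ιT) (C := P) algebraMap
    (fun x y i hx hy => add i x y hx hy)
    (fun i x hx h m hm => by obtain ⟨v, rfl⟩ := hm; exact mul i x v hx h) hx

theorem homogeneous_induction {P : T → Prop} (add : ∀ x y, P x → P y → P (x + y))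
    (h : ∀ n, ∀ x ∈ tensorDeg k V n, P x) (x : T) : P x :=
  DirectSum.Decomposition.inductionOn (tensorDeg k V) (h 0 0 (zero_mem _))
    (fun m => h _ _ m.2) add x

/-- The projection of the tensor algebra to its component of degree `n`. -/
def degProj (n : ℕ) : Module.End k T :=
  (tensorDeg k V n).subtype ∘ₗ DirectSum.component k ℕ (fun n => tensorDeg k V n) n ∘ₗ
    (DirectSum.decomposeLinearEquiv (tensorDeg k V)).toLinearMap

theorem degProj_mem (n : ℕ) (x : T) : degProj n x ∈ tensorDeg k V n :=
  (DirectSum.decompose (tensorDeg k V) x n).2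

theorem degProj_of_mem {n m : ℕ} {x : T} (hx : x ∈ tensorDeg k V m) :
    degProj n x = if n = m then x else 0 := by
  change ((DirectSum.decompose (tensorDeg k V) x n : tensorDeg k V n) : T) = _
  split_ifs with h
  · subst h; exact DirectSum.decompose_of_mem_same _ hx
  · exact DirectSum.decompose_of_mem_ne _ hx (Ne.symm h)

theorem eq_zero_of_degProj {x : T} (h : ∀ n, degProj n x = 0) : x = 0 := by
  classical
  rw [← DirectSum.sum_support_decompose (tensorDeg k V) x]
  exact Finset.sum_eq_zero fun n _ => h n

theorem degProj_comm {f : Module.End k T} (h0 : ∀ x ∈ tensorDeg k V 0, f x = 0)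
    (h : ∀ n, ∀ x ∈ tensorDeg k V (n + 1), f x ∈ tensorDeg k V n) (n : ℕ) (x : T) :
    f (degProj (n + 1) x) = degProj n (f x) := by
  induction x using homogeneous_induction with
  | add x y hx hy => simp only [map_add, hx, hy]
  | h m x hx =>
    rw [degProj_of_mem hx]
    rcases m with _ | m
    · simp [h0 x hx]
    · rw [degProj_of_mem (h m x hx)]
      by_cases hnm : n = m <;> simp [hnm]

theorem mem_tensorDeg_zero {x : T} (hx : x ∈ tensorDeg k V 0) : x = algebraMap k T (εT x) := by
  rw [tensorDeg, pow_zero] at hx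
  obtain ⟨r, rfl⟩ := Submodule.mem_one.mp hx
  simp [TensorAlgebra.algebraMapInv]

theorem algebraMapInv_of_mem {n : ℕ} {x : T} (hx : x ∈ tensorDeg k V (n + 1)) : εT x = 0 := by
  rw [tensorDeg, pow_succ'] at hx
  induction hx using Submodule.mul_induction_on' with
  | mem_mul_mem m hm y hy => obtain ⟨v, rfl⟩ := hm; simp
  | add x _ y _ hx hy => rw [map_add, hx, hy, add_zero]

theorem degProj_zero (x : T) : degProj 0 x = algebraMap k T (εT x) := by
  induction x using homogeneous_induction with
  | add x y hx hy => simp only [map_add, hx, hy]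
  | h m x hx =>
    rw [degProj_of_mem hx]
    rcases m with _ | m
    · simpa using mem_tensorDeg_zero hx
    · simp [algebraMapInv_of_mem hx]

theorem deriv_of_mem_zero (i : ι) {x : T} (hx : x ∈ tensorDeg k V 0) : deriv A e i x = 0 := by
  rw [mem_tensorDeg_zero hx, Algebra.algebraMap_eq_smul_one, map_smul, deriv_one, smul_zero]

theorem deriv_mem {n : ℕ} (i : ι) {x : T} (hx : x ∈ tensorDeg k V (n + 1)) :
    deriv A e i x ∈ tensorDeg k V n := by
  -- The case m = 0 is set apart because m - 1 is truncated there.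
  have key : ∀ m, ∀ x ∈ tensorDeg k V m, ∀ i, m = 0 ∨ deriv A e i x ∈ tensorDeg k V (m - 1) := by
    intro m x hx
    induction hx using tensorDeg_induction_left with
    | algebraMap r => simp
    | add n x y _ _ hx hy =>
      exact fun i => (hx i).elim Or.inl fun h => (hy i).elim Or.inl fun h' => Or.inr <| by
        rw [map_add]; exact add_mem h h'
    | mul n x v hx' hx =>
      refine fun i => Or.inr ?_
      rw [deriv_ι_mul, Nat.add_sub_cancel]
      refine sub_mem (Submodule.smul_mem _ _ hx') (sum_mem fun j _ => ?_)
      rcases n with _ | n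
      · rw [deriv_of_mem_zero e j hx', mul_zero]; exact zero_mem _
      · exact ι_mul_mem _ ((hx j).resolve_left (Nat.succ_ne_zero n))
  exact (key _ x hx i).resolve_left (Nat.succ_ne_zero n)

theorem deriv_degProj (n : ℕ) (i : ι) (x : T) :
    deriv A e i (degProj (n + 1) x) = degProj n (deriv A e i x) :=
  degProj_comm (fun _ hx => deriv_of_mem_zero e i hx) (fun _ _ hx => deriv_mem e i hx) n x

/-! ### Braided factorials and skew derivations -/

/-- Removal of the first letter by pairing with a coordinate function. -/
def coordContract (i : ι) : Module.End k T :=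
  (TensorProduct.lid k T).toLinearMap ∘ₗ (e.coord i).rTensor T ∘ₗ split k V

theorem coordContract_ι_mul (i : ι) (v : V) (x : T) :
    coordContract e i (ιT v * x) = e.coord i v • x := by
  simp [coordContract, split_ι_mul]

theorem coordContract_one (i : ι) : coordContract e i 1 = 0 := by
  simp [coordContract, split_one]

theorem contract_eq_sum (v : V) (x : T) :
    contract g v x = ∑ i, g.form v (e i) • coordContract e i x := by
  simp only [contract, coordContract, LinearMap.mk₂_apply, LinearMap.comp_apply]
  generalize split k V x = w
  induction w using TensorProduct.induction_on with
  | zero => simp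
  | add x y hx hy => simp only [map_add, hx, hy, smul_add, Finset.sum_add_distrib]
  | tmul w x =>
    conv_lhs => rw [← e.sum_repr w]
    simp [Finset.sum_smul, smul_smul, mul_comm, -Module.Basis.sum_repr]

theorem split_eq_sum (x : T) : split k V x = ∑ i, e i ⊗ₜ[k] coordContract e i x :=
  (sum_basis_tmul e _).symm

/-- In coordinates Ψ(v ⊗ e_j) = Σ_i e_i ⊗ (v ◁ t_ij), so reading off the new first letter leaves
exactly the second term of the recursion for ∂_i. -/
theorem coordContract_braidAt_zero (i : ι) (v : V) (x : T) :
    coordContract e i (braidAt k A V 0 (ιT v * x)) =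
      ∑ j, ιT (act v (coactCoeff A e i j)) * coordContract e j x := by
  simp only [braidAt, LinearMap.comp_apply, split_ι_mul, LinearMap.lTensor_tmul, split_eq_sum e x]
  simp only [TensorProduct.tmul_sum, map_sum, LinearEquiv.coe_coe, TensorProduct.assoc_symm_tmul,
    LinearMap.rTensor_tmul, braiding, LinearMap.comp_apply, LinearMap.lTensor_tmul, coact_basis,
    TensorProduct.leftComm_tmul, TensorProduct.sum_tmul, TensorProduct.assoc_tmul, cons_tmul,
    coordContract_ι_mul, actLin, TensorProduct.lift.tmul]
  simp [Finsupp.single_apply]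

/-- `shift 1` is not the identity, since it kills constants; `braidAt` at position zero does not see
them either. -/
theorem braidAt_zero_shift_one (x : T) :
    braidAt k A V 0 (shift 1 x) = braidAt k A V 0 x := by
  have : split k V (shift 1 x) = split k V x := by
    simp [shift, split_cons, Module.End.one_eq_id]
  simp only [braidAt, LinearMap.comp_apply, this]

/-- The chain is defined by adding factors on the right; splitting off Ψ₁ on the left instead yields
the recursion [n+1,-Ψ] = id - Ψ₁(id ⊗ [n,-Ψ]) of `braidedInt_succ`. -/
theorem braidChain_succ (j : ℕ) :
    braidChain k A V (j + 1) = braidAt k A V 0 * shift (braidChain k A V j) := by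
  induction j with
  | zero => ext x; simpa [braidChain] using (braidAt_zero_shift_one (A := A) x).symm
  | succ j ih =>
    change braidChain k A V (j + 1) * shift (braidAt k A V j) =
      braidAt k A V 0 * shift (braidChain k A V j * braidAt k A V j)
    rw [ih, mul_assoc, shift_mul]

theorem braidedInt_succ (n : ℕ) (v : V) (x : T) :
    braidedInt k A V (n + 1) (ιT v * x) =
      ιT v * x - braidAt k A V 0 (ιT v * braidedInt k A V n x) := by
  rw [braidedInt, Finset.sum_range_succ', add_comm, LinearMap.add_apply, sub_eq_add_neg]
  congr 1
  · simp [braidChain]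
  · simp only [braidedInt, LinearMap.sum_apply, Finset.mul_sum, map_sum, ← Finset.sum_neg_distrib,
      braidChain_succ, LinearMap.smul_apply, Module.End.mul_apply, shift_ι_mul, mul_smul_comm,
      map_smul, pow_succ, mul_neg_one, neg_smul]

/-- Both sides satisfy the same recursion in the first letter. This is the bridge from braided
integers to skew derivations. -/
theorem coordContract_braidedInt (i : ι) {n : ℕ} {x : T} (hx : x ∈ tensorDeg k V n) :
    coordContract e i (braidedInt k A V n x) = deriv A e i x := by
  induction hx using tensorDeg_induction_left generalizing i with
  | algebraMap r => simp [braidedInt, deriv_one, Algebra.algebraMap_eq_smul_one]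
  | add n x y _ _ hx hy => simp only [map_add, hx, hy]
  | mul n x v hx' hx =>
    rw [braidedInt_succ, map_sub, coordContract_ι_mul, coordContract_braidAt_zero, deriv_ι_mul]
    simp only [hx]

theorem factorialSum_of_mem {n : ℕ} {x : T} (hx : x ∈ tensorDeg k V n) :
    factorialSum k A V x = braidedFactorial k A V n x := by
  lift x to tensorDeg k V n using hx
  simp only [factorialSum, LinearMap.comp_apply, LinearEquiv.coe_coe,
    DirectSum.decomposeLinearEquiv_apply, DirectSum.decompose_coe]
  rw [← DirectSum.lof_eq_of k, DirectSum.toModule_lof]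
  rfl

theorem algebraMapInv_factorialSum (x : T) : εT (factorialSum k A V x) = εT x := by
  induction x using homogeneous_induction with
  | add x y hx hy => simp only [map_add, hx, hy]
  | h m x hx =>
    rw [factorialSum_of_mem hx]
    rcases m with _ | m
    · simp [braidedFactorial]
    · rw [braidedFactorial, Module.End.mul_apply, algebraMapInv_shift, algebraMapInv_of_mem hx]

end Grading

/-! ### The duality pairing and its radical -/

section Pairing

variable {k A V ι : Type*} [Field k] [Ring A] [HopfAlgebra k A]
  [AddCommGroup V] [Module k V] [CrossedModule k A V] [Fintype ι] [DecidableEq ι]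
  (g : Metric k A V) (e : Module.Basis ι k V)

local notation "T" => TensorAlgebra k V
local notation "act" => CrossedModule.act (k := k) (A := A) (V := V)
local notation "ιT" => TensorAlgebra.ι k (M := V)
local notation "εT" => TensorAlgebra.algebraMapInv (R := k) (M := V)

/-- The skew derivation `∑ᵢ (e_j, eᵢ) ∂ᵢ` given by the interior product with `e_j`. -/
def metricDeriv (j : ι) : Module.End k T := ∑ i, g.form (e j) (e i) • deriv A e i

theorem metricDeriv_apply (j : ι) (x : T) :
    metricDeriv g e j x = ∑ i, g.form (e j) (e i) • deriv A e i x := by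
  simp [metricDeriv]

theorem deriv_eq_sum_metricDeriv (i : ι) (x : T) :
    deriv A e i x = ∑ j, g.coeff e i j • metricDeriv g e j x := by
  simp only [metricDeriv_apply, Finset.smul_sum, smul_smul]
  rw [Finset.sum_comm]
  simp only [← Finset.sum_smul, g.sum_coeff_form]
  simp

theorem contract_braidedInt (j : ι) {n : ℕ} {x : T} (hx : x ∈ tensorDeg k V n) :
    contract g (e j) (braidedInt k A V n x) = metricDeriv g e j x := by
  rw [contract_eq_sum g e, metricDeriv_apply]
  simp only [coordContract_braidedInt e _ hx]

theorem pairT_apply (x y : T) : pairT g x y = nestedEval g x (factorialSum k A V y) := rfl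

theorem pairT_one (y : T) : pairT g 1 y = εT y := by
  rw [pairT_apply, nestedEval_one, algebraMapInv_factorialSum]

/-- The last letter of the first argument meets the first letter of (id ⊗ [n-1,-Ψ]!)[n,-Ψ]y.
Contracting it turns [n,-Ψ] into D_j and leaves [n-1,-Ψ]!, which is again the pairing. In degree
zero both sides vanish. -/
theorem pairT_mul_ι (x : T) (j : ι) (y : T) :
    pairT g (x * ιT (e j)) y = pairT g x (metricDeriv g e j y) := by
  induction y using homogeneous_induction with
  | add y z hy hz => simp only [map_add, hy, hz]
  | h n y hy =>
    rw [pairT_apply, nestedEval_mul_ι, pairT_apply, factorialSum_of_mem hy]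
    rcases n with _ | n
    · rw [mem_tensorDeg_zero hy, Algebra.algebraMap_eq_smul_one]
      simp [braidedFactorial, contract_one, metricDeriv_apply, deriv_one]
    · have hD : metricDeriv g e j y ∈ tensorDeg k V n := by
        rw [metricDeriv_apply]
        exact sum_mem fun i _ => Submodule.smul_mem _ _ (deriv_mem e i hy)
      rw [factorialSum_of_mem hD, braidedFactorial, Module.End.mul_apply, contract_shift,
        contract_braidedInt g e j hy]

/-- The radical of the pairing in the second argument. -/
def radical : Submodule k T := LinearMap.ker (pairT g).flip

theorem mem_radical {y : T} : y ∈ radical g ↔ ∀ x, pairT g x y = 0 := by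
  rw [radical, LinearMap.mem_ker, LinearMap.ext_iff]
  simp

theorem algebraMapInv_of_mem_radical {y : T} (hy : y ∈ radical g) : εT y = 0 := by
  rw [← pairT_one g, (mem_radical g).mp hy]

/-- The operators D_j preserve the radical, being adjoint to right multiplications, and the matrix
g_ab is invertible, so each ∂_i is a combination of them. -/
theorem deriv_mem_radical (i : ι) {y : T} (hy : y ∈ radical g) : deriv A e i y ∈ radical g := by
  rw [deriv_eq_sum_metricDeriv g e]
  refine sum_mem fun j _ => Submodule.smul_mem _ _ ((mem_radical g).mpr fun x => ?_)
  rw [← pairT_mul_ι, (mem_radical g).mp hy]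

theorem metricDeriv_mem_radical (i : ι) {y : T} (hy : y ∈ radical g) :
    metricDeriv g e i y ∈ radical g := by
  rw [metricDeriv_apply]
  exact sum_mem fun j _ => Submodule.smul_mem _ _ (deriv_mem_radical g e j hy)

/-- The radical is the largest subspace of `ker ε` that is stable under the skew derivations. -/
theorem le_radical {N : Submodule k T} (h0 : ∀ y ∈ N, εT y = 0)
    (h : ∀ y ∈ N, ∀ i, deriv A e i y ∈ N) : N ≤ radical g := by
  intro y hy
  rw [mem_radical]
  intro x
  induction x using tensorAlgebra_induction_right e generalizing y with
  | one => rw [pairT_one, h0 y hy]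
  | add x x' hx hx' => rw [map_add, LinearMap.add_apply, hx hy, hx' hy, add_zero]
  | smul c x hx => rw [map_smul, LinearMap.smul_apply, hx hy, smul_zero]
  | mul x j hx =>
    rw [pairT_mul_ι]
    refine hx ?_
    rw [metricDeriv_apply]
    exact sum_mem fun i _ => Submodule.smul_mem _ _ (h y hy i)

/-- The span of all y ◁ a is ∂-stable by equivariance of the derivations, so the maximality in
`le_radical` applies. The next closure properties use the same device with other subspaces. -/
theorem actT_mem_radical (e : Module.Basis ι k V) {y : T} (hy : y ∈ radical g) (a : A) :
    actT k A V y a ∈ radical g := by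
  let N : Submodule k T := Submodule.span k {z | ∃ y ∈ radical g, ∃ a : A, z = actT k A V y a}
  refine le_radical g e (N := N) ?_ ?_ (Submodule.subset_span ⟨y, hy, a, rfl⟩)
  · intro z hz
    induction hz using Submodule.span_induction with
    | mem z hz =>
      obtain ⟨y, hy, a, rfl⟩ := hz
      rw [algebraMapInv_actT e, algebraMapInv_of_mem_radical g hy, zero_mul]
    | zero => simp
    | add x y _ _ hx hy => rw [map_add, hx, hy, add_zero]
    | smul c x _ hx => rw [map_smul, hx, smul_zero]
  · intro z hz i
    induction hz using Submodule.span_induction with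
    | mem z hz =>
      obtain ⟨y, hy, a, rfl⟩ := hz
      rw [deriv_actT]
      exact sum_mem fun j _ => Submodule.subset_span ⟨_, deriv_mem_radical g e j hy, _, rfl⟩
    | zero => simp
    | add x y _ _ hx hy => rw [map_add]; exact add_mem hx hy
    | smul c x _ hx => rw [map_smul]; exact Submodule.smul_mem _ _ hx

theorem parityT_mem_radical (e : Module.Basis ι k V) {y : T} (hy : y ∈ radical g) :
    parityT k V y ∈ radical g := by
  refine le_radical g e (N := (radical g).map (parityT k V).toLinearMap) ?_ ?_
    (Submodule.mem_map_of_mem hy)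
  · rintro _ ⟨y, hy, rfl⟩
    simp [algebraMapInv_parityT, algebraMapInv_of_mem_radical g hy]
  · rintro _ ⟨y, hy, rfl⟩ i
    refine ⟨- deriv A e i y, neg_mem (deriv_mem_radical g e i hy), ?_⟩
    simp [deriv_parityT]

/-- The Leibniz rule applies both parity and action to the left factor, so stability of the radical
under these two must come first. -/
theorem mul_mem_radical_right (e : Module.Basis ι k V) {y : T} (hy : y ∈ radical g) (x : T) :
    y * x ∈ radical g := by
  refine le_radical g e (N := radical g * ⊤) ?_ ?_ (Submodule.mul_mem_mul hy trivial)
  · intro z hz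
    induction hz using Submodule.mul_induction_on' with
    | mem_mul_mem y hy x _ => simp [algebraMapInv_of_mem_radical g hy]
    | add x _ y _ hx hy => rw [map_add, hx, hy, add_zero]
  · intro z hz i
    induction hz using Submodule.mul_induction_on' with
    | mem_mul_mem y hy x _ =>
      rw [deriv_mul]
      refine add_mem (Submodule.mul_mem_mul (deriv_mem_radical g e i hy) trivial)
        (sum_mem fun j _ => Submodule.mul_mem_mul ?_ trivial)
      exact actT_mem_radical g e (parityT_mem_radical g e hy) _
    | add x _ y _ hx hy => rw [map_add]; exact add_mem hx hy

theorem mul_mem_radical_left (e : Module.Basis ι k V) {y : T} (hy : y ∈ radical g) (x : T) :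
    x * y ∈ radical g := by
  refine le_radical g e (N := ⊤ * radical g) ?_ ?_ (Submodule.mul_mem_mul trivial hy)
  · intro z hz
    induction hz using Submodule.mul_induction_on' with
    | mem_mul_mem y _ x hx => simp [algebraMapInv_of_mem_radical g hx]
    | add x _ y _ hx hy => rw [map_add, hx, hy, add_zero]
  · intro z hz i
    induction hz using Submodule.mul_induction_on' with
    | mem_mul_mem y _ x hx =>
      rw [deriv_mul]
      exact add_mem (Submodule.mul_mem_mul trivial hx)
        (sum_mem fun j _ => Submodule.mul_mem_mul trivial (deriv_mem_radical g e j hx))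
    | add x _ y _ hx hy => rw [map_add]; exact add_mem hx hy

theorem degProj_mem_radical (e : Module.Basis ι k V) {y : T} (hy : y ∈ radical g) (n : ℕ) :
    degProj n y ∈ radical g := by
  refine le_radical g e (N := ⨆ n, (radical g).map (degProj n)) ?_ ?_
    (Submodule.mem_iSup_of_mem n (Submodule.mem_map_of_mem hy))
  · intro z hz
    induction hz using Submodule.iSup_induction' with
    | mem n z hz =>
      obtain ⟨y, hy, rfl⟩ := hz
      rcases n with _ | n
      · rw [degProj_zero, algebraMapInv_of_mem_radical g hy, map_zero, map_zero]
      · exact algebraMapInv_of_mem (degProj_mem _ _)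
    | zero => simp
    | add x y _ _ hx hy => rw [map_add, hx, hy, add_zero]
  · intro z hz i
    induction hz using Submodule.iSup_induction' with
    | mem n z hz =>
      obtain ⟨y, hy, rfl⟩ := hz
      rcases n with _ | n
      · rw [deriv_of_mem_zero e i (degProj_mem _ _)]; exact zero_mem _
      · rw [deriv_degProj]
        exact Submodule.mem_iSup_of_mem n (Submodule.mem_map_of_mem (deriv_mem_radical g e i hy))
    | zero => simp
    | add x y _ _ hx hy => rw [map_add]; exact add_mem hx hy

/-! ### Nondegeneracy of the nested evaluation and the kernel of the braided factorials -/

theorem coordContract_eq_sum_contract (i : ι) (x : T) :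
    coordContract e i x = ∑ j, g.coeff e i j • contract g (e j) x := by
  simp only [contract_eq_sum g e, Finset.smul_sum, smul_smul]
  rw [Finset.sum_comm]
  simp only [← Finset.sum_smul, g.sum_coeff_form]
  simp

theorem coordContract_degProj (n : ℕ) (i : ι) (x : T) :
    coordContract e i (degProj (n + 1) x) = degProj n (coordContract e i x) := by
  refine degProj_comm (fun x hx => ?_) (fun n x hx => ?_) n x
  · rw [mem_tensorDeg_zero hx, Algebra.algebraMap_eq_smul_one, map_smul, coordContract_one,
      smul_zero]
  · rw [tensorDeg, pow_succ'] at hx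
    induction hx using Submodule.mul_induction_on' with
    | mem_mul_mem m hm y hy =>
      obtain ⟨v, rfl⟩ := hm
      rw [coordContract_ι_mul]
      exact Submodule.smul_mem _ _ hy
    | add x _ y _ hx hy => rw [map_add]; exact add_mem hx hy

theorem algebraMap_add_cons_split (e : Module.Basis ι k V) (x : T) :
    algebraMap k T (εT x) + cons k V (split k V x) = x := by
  induction x using tensorAlgebra_induction_left e with
  | one => simp [split_one]
  | add x y hx hy =>
    conv_rhs => rw [← hx, ← hy]
    simp only [map_add]
    abel
  | smul c x hx =>
    conv_rhs => rw [← hx]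
    simp [Algebra.algebraMap_eq_smul_one, smul_smul]
  | mul x j hx => simp [split_ι_mul, cons_tmul]

/-- Induction on the degree: since g_ab is invertible, contractions against basis vectors recover
every coefficient of the first letter, and each of these pairs to zero with all words again. -/
theorem nestedEval_nondegenerate (e : Module.Basis ι k V) {z : T}
    (hz : ∀ x, nestedEval g x z = 0) : z = 0 := by
  refine eq_zero_of_degProj fun n => ?_
  induction n generalizing z with
  | zero => rw [degProj_zero, ← nestedEval_one g, hz, map_zero]
  | succ n ih =>
    rw [← algebraMap_add_cons_split e (degProj (n + 1) z),
      algebraMapInv_of_mem (degProj_mem _ _), split_eq_sum e]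
    simp only [coordContract_degProj]
    have h : ∀ i, degProj n (coordContract e i z) = 0 := fun i => ih fun x => by
      rw [coordContract_eq_sum_contract g e, map_sum]
      refine Finset.sum_eq_zero fun j _ => ?_
      rw [map_smul, ← nestedEval_mul_ι, hz, smul_zero]
    simp [h]

/-- The pairing is the nested evaluation precomposed with the factorials, and the evaluation is
nondegenerate. Hence the relations defining Λ are exactly the radical. -/
theorem mem_radical_iff_factorialSum (e : Module.Basis ι k V) {y : T} :
    y ∈ radical g ↔ factorialSum k A V y = 0 := by
  rw [mem_radical]
  exact ⟨fun h => nestedEval_nondegenerate g e h, fun h x => by rw [pairT_apply, h, map_zero]⟩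

theorem pairT_parityT (e : Module.Basis ι k V) (x y : T) :
    pairT g (parityT k V x) y = pairT g x (parityT k V y) := by
  induction x using tensorAlgebra_induction_right e generalizing y with
  | one => rw [map_one, pairT_one, pairT_one, algebraMapInv_parityT]
  | add x x' hx hx' => simp only [map_add, LinearMap.add_apply, hx, hx']
  | smul c x hx => simp only [map_smul, LinearMap.smul_apply, hx]
  | mul x j hx =>
    simp [parityT_ι, pairT_mul_ι, hx, metricDeriv_apply, deriv_parityT]

theorem pairT_apply_one (e : Module.Basis ι k V) (x : T) : pairT g x 1 = εT x := by
  induction x using tensorAlgebra_induction_right e with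
  | one => rw [pairT_one]
  | add x x' hx hx' => simp only [map_add, LinearMap.add_apply, hx, hx']
  | smul c x hx => simp only [map_smul, LinearMap.smul_apply, hx]
  | mul x j hx => simp [pairT_mul_ι, metricDeriv_apply, deriv_one]

/-! ### Invariance of the pairing and its radical in the first argument -/

theorem convLeft_convLeft (φ ψ : A →ₗ[k] k) (a : A) :
    convLeft φ (convLeft ψ a) = convLeft (φ ∘ₗ convLeft ψ) a := by
  have h := congrArg (TensorProduct.lid k A)
    (map_convLeft_comul ψ φ (LinearMap.id : A →ₗ[k] A) a)
  exact h

/-- The skew derivations `D_j` are equivariant. -/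
theorem sum_metricDeriv_actT (hS : Function.Bijective (HopfAlgebra.antipode k : A →ₗ[k] A))
    (j : ι) (y : T) (a : A) :
    ∑ l, metricDeriv g e l (actT k A V y (convLeft (actCoeff A e l j) a)) =
      actT k A V (metricDeriv g e j y) a := by
  -- Invariance of the form, transported from functionals on A to the operators `convLeft`.
  have h : ∀ m, ∑ l, ∑ i, g.form (e l) (e i) •
      convLeft (actCoeff A e i m) (convLeft (actCoeff A e l j) a) = g.form (e j) (e m) • a := by
    intro m
    have h1 : ∑ l, ∑ i, g.form (e l) (e i) • (actCoeff A e i m ∘ₗ convLeft (actCoeff A e l j)) =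
        g.form (e j) (e m) • (counit (R := k) : A →ₗ[k] k) := by
      ext x
      simpa using g.sum_form_actCoeff_mul e hS j m x
    have h2 := congrArg (fun φ => TensorProduct.lid k A (LinearMap.rTensorHom A φ (comul a))) h1
    simp only [map_sum, map_smul, LinearMap.sum_apply, LinearMap.smul_apply] at h2
    simp only [convLeft_convLeft]
    refine h2.trans ?_
    simp
  simp only [metricDeriv_apply, deriv_actT, Finset.smul_sum, map_sum, LinearMap.sum_apply,
    map_smul, LinearMap.smul_apply]
  have h3 := fun m => congrArg (actT k A V (deriv A e m y)) (h m)
  simp only [map_sum, map_smul] at h3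
  rw [Finset.sum_comm_cycle]
  exact Finset.sum_congr rfl fun m _ => h3 m

/-- The pairing is invariant under the action. -/
theorem pairT_actT_actT (e : Module.Basis ι k V)
    (hS : Function.Bijective (HopfAlgebra.antipode k : A →ₗ[k] A)) (x y : T) (a : A) :
    TensorProduct.lift (pairT g) (TensorProduct.map (actT k A V x) (actT k A V y) (comul a)) =
      pairT g x y * counit (R := k) a := by
  induction x using tensorAlgebra_induction_right e generalizing y a with
  | one =>
    have h : ∀ w : A ⊗[k] A, TensorProduct.lift (pairT g)
        (TensorProduct.map (actT k A V 1) (actT k A V y) w) =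
        εT y * counit (R := k) (TensorProduct.lid k A ((counit (R := k)).rTensor A w)) := by
      intro w
      induction w using TensorProduct.induction_on with
      | zero => simp
      | add x y hx hy => simp only [map_add, hx, hy, mul_add]
      | tmul x z =>
        simp [actT_one, Algebra.algebraMap_eq_smul_one, pairT_one, algebraMapInv_actT e]
        ring
    rw [h, Coalgebra.rTensor_counit_comul, TensorProduct.lid_tmul, one_smul, pairT_one]
  | add x x' hx hx' =>
    simp only [map_add, TensorProduct.map_add_left, LinearMap.add_apply, hx, hx', add_mul]
  | smul c x hx =>
    simp only [map_smul, TensorProduct.map_smul_left, LinearMap.smul_apply, hx, smul_mul_assoc]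
  | mul x j hx =>
    have h : ∀ w : A ⊗[k] A, TensorProduct.lift (pairT g)
        (TensorProduct.map (actT k A V (x * ιT (e j))) (actT k A V y) w) =
        ∑ l, TensorProduct.lift (pairT g)
        (TensorProduct.map (actT k A V x ∘ₗ convRight (actCoeff A e l j))
          (metricDeriv g e l ∘ₗ actT k A V y) w) := by
      intro w
      induction w using TensorProduct.induction_on with
      | zero => simp
      | add x y hx hy => simp only [map_add, hx, hy, Finset.sum_add_distrib]
      | tmul x z => simp [actT_mul_ι, pairT_mul_ι]
    have h' : actT k A V (metricDeriv g e j y) =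
        ∑ l, (metricDeriv g e l ∘ₗ actT k A V y) ∘ₗ convLeft (actCoeff A e l j) := by
      ext a
      simp [← sum_metricDeriv_actT g e hS j y a]
    rw [h, pairT_mul_ι, ← hx, h']
    simp only [← map_comp_convLeft_comul]
    rw [← TensorProduct.mapBilinear_apply]
    simp only [map_sum, LinearMap.sum_apply, TensorProduct.mapBilinear_apply]

/-- Coinvariance of the form rewrites (e_j, e_i)x as Σ (e_p, e_q)(x ◁ t_pj) ◁ t_qi; summing over i,
invariance of the pairing then cancels t_qi against t_im and leaves δ_qm. -/
theorem sum_pairT_coactCoeff (hS : Function.Bijective (HopfAlgebra.antipode k : A →ₗ[k] A))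
    (x y : T) (j m : ι) :
    ∑ i, g.form (e j) (e i) • pairT g x (actT k A V y (coactCoeff A e i m)) =
      ∑ i, g.form (e i) (e m) • pairT g (actT k A V x (coactCoeff A e i j)) y := by
  have h1 : ∀ i, g.form (e j) (e i) • x = ∑ p, ∑ q, g.form (e p) (e q) •
      actT k A V (actT k A V x (coactCoeff A e p j)) (coactCoeff A e q i) := by
    intro i
    have := congrArg (actT k A V x) (g.sum_form_coactCoeff_mul (A := A) e j i)
    simp only [map_sum, map_smul, actT_act_one e, actT_act_mul e] at this
    exact this.symm
  have h2 : ∀ p q, ∑ i, pairT g (actT k A V (actT k A V x (coactCoeff A e p j))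
      (coactCoeff A e q i)) (actT k A V y (coactCoeff A e i m)) =
      pairT g (actT k A V x (coactCoeff A e p j)) y * if q = m then 1 else 0 := by
    intro p q
    have := pairT_actT_actT g e hS (actT k A V x (coactCoeff A e p j)) y (coactCoeff A e q m)
    rw [counit_coactCoeff, comul_coactCoeff] at this
    simpa using this
  have h3 : ∀ i z, g.form (e j) (e i) • pairT g x z = ∑ p, ∑ q, g.form (e p) (e q) • pairT g
      (actT k A V (actT k A V x (coactCoeff A e p j)) (coactCoeff A e q i)) z := by
    intro i z
    have := congrArg (fun u => pairT g u z) (h1 i)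
    simpa only [map_sum, map_smul, LinearMap.sum_apply, LinearMap.smul_apply] using this
  simp only [h3]
  rw [Finset.sum_comm]
  refine Finset.sum_congr rfl fun p _ => ?_
  rw [Finset.sum_comm]
  simp only [← Finset.smul_sum, h2]
  simp

/-- The mirror image of `pairT_mul_ι`. The pairing is asymmetric by construction, so this needs the
invariance lemmas; it makes the radical lie in the left kernel as well, which is what lets the
pairing descend in both variables. -/
theorem pairT_mul_ι_right (hS : Function.Bijective (HopfAlgebra.antipode k : A →ₗ[k] A))
    (x y : T) (m : ι) :
    pairT g x (y * ιT (e m)) = ∑ i, g.form (e i) (e m) • pairT g (deriv A e i x) y := by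
  induction x using tensorAlgebra_induction_right e generalizing y with
  | one => simp [pairT_one, deriv_one]
  | add x x' hx hx' =>
    simp only [map_add, LinearMap.add_apply, hx, hx', smul_add, Finset.sum_add_distrib]
  | smul c x hx =>
    simp only [map_smul, LinearMap.smul_apply, hx, Finset.smul_sum, smul_comm c]
  | mul x j hx =>
    have h := sum_pairT_coactCoeff g e hS x (parityT k V y) j m
    simp only [← pairT_parityT g e, parityT_actT e] at h
    rw [pairT_mul_ι, metricDeriv_apply]
    simp only [deriv_mul_ι, map_add, smul_add, map_sum, map_smul, Finset.sum_add_distrib, h,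
      LinearMap.add_apply]
    congr 1
    simp only [hx, pairT_mul_ι, metricDeriv_apply, map_sum, map_smul, Finset.smul_sum]
    rw [Finset.sum_comm]
    exact Finset.sum_congr rfl fun i _ => Finset.sum_congr rfl fun l _ => smul_comm _ _ _

theorem pairT_of_mem_radical (e : Module.Basis ι k V)
    (hS : Function.Bijective (HopfAlgebra.antipode k : A →ₗ[k] A)) {x : T}
    (hx : x ∈ radical g) (y : T) : pairT g x y = 0 := by
  induction y using tensorAlgebra_induction_right e generalizing x with
  | one => rw [pairT_apply_one g e, algebraMapInv_of_mem_radical g hx]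
  | add y y' hy hy' => rw [map_add, hy hx, hy' hx, add_zero]
  | smul c y hy => rw [map_smul, hy hx, smul_zero]
  | mul y m hy =>
    rw [pairT_mul_ι_right g e hS]
    exact Finset.sum_eq_zero fun i _ => by rw [hy (deriv_mem_radical g e i hx), smul_zero]

end Pairing

/-! ### The coproduct of the tensor algebra -/

section Coproduct

variable {k A V ι : Type*} [Field k] [Ring A] [HopfAlgebra k A]
  [AddCommGroup V] [Module k V] [CrossedModule k A V] [Fintype ι] [DecidableEq ι]
  (g : Metric k A V) (e : Module.Basis ι k V)

local notation "T" => TensorAlgebra k V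
local notation "act" => CrossedModule.act (k := k) (A := A) (V := V)
local notation "ιT" => TensorAlgebra.ι k (M := V)
local notation "εT" => TensorAlgebra.algebraMapInv (R := k) (M := V)

variable (A) in
/-- Right multiplication by `e_m ⊗ 1 + 1 ⊗ e_m` in the super-braided tensor product algebra. -/
def coprodRight (m : ι) : Module.End k (T ⊗[k] T) :=
  (mulRight k (ιT (e m))).lTensor T + ∑ i, TensorProduct.map (mulRight k (ιT (e i)))
    ((actT k A V).flip (coactCoeff A e i m) ∘ₗ (parityT k V).toLinearMap)

theorem coprodRight_tmul (m : ι) (c d : T) :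
    coprodRight A e m (c ⊗ₜ d) = c ⊗ₜ (d * ιT (e m)) +
      ∑ i, (c * ιT (e i)) ⊗ₜ actT k A V (parityT k V d) (coactCoeff A e i m) := by
  simp [coprodRight]

theorem coprodStep_tmul (v : V) (c d : T) :
    coprodStep k A V v (c ⊗ₜ d) = (ιT v * c) ⊗ₜ d +
      (actMul k A V v).lTensor T (TensorProduct.assoc k T A T
        (coactT k A V (parityT k V c) ⊗ₜ d)) := by
  simp [coprodStep]

theorem actMul_tmul (v : V) (a : A) (d : T) :
    actMul k A V v (a ⊗ₜ d) = ιT (act v a) * d := by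
  simp [actMul]

theorem coactT_ι (m : ι) :
    coactT k A V (ιT (e m)) = ∑ i, ιT (e i) ⊗ₜ[k] coactCoeff A e i m := by
  simp [coactT, coact_basis]

/-- Left and right multiplications commute in an associative algebra. Here associativity of the
super-braided tensor square is verified only for primitive factors, without constructing that
algebra. -/
theorem coprodStep_coprodRight (v : V) (m : ι) (z : T ⊗[k] T) :
    coprodStep k A V v (coprodRight A e m z) = coprodRight A e m (coprodStep k A V v z) := by
  induction z using TensorProduct.induction_on with
  | zero => simp
  | add x y hx hy => simp only [map_add, hx, hy]
  | tmul c d =>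
    -- The coaction of the parity-twisted c is replaced by an arbitrary w. The minus sign is the
    -- parity of the extra letter on the first leg.
    have h1 : ∀ w : T ⊗[k] A, (actMul k A V v).lTensor T (TensorProduct.assoc k T A T
        (w ⊗ₜ (d * ιT (e m)))) - ∑ i, (actMul k A V v).lTensor T (TensorProduct.assoc k T A T
        ((∑ l, w * (ιT (e l) ⊗ₜ[k] coactCoeff A e l i)) ⊗ₜ
          (actT k A V (parityT k V d) (coactCoeff A e i m)))) =
        coprodRight A e m ((actMul k A V v).lTensor T (TensorProduct.assoc k T A T (w ⊗ₜ d))) := by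
      intro w
      induction w using TensorProduct.induction_on with
      | zero => simp
      | add x y hx hy =>
        simp only [TensorProduct.add_tmul, map_add, ← hx, ← hy, add_mul, Finset.sum_add_distrib]
        abel
      | tmul p b =>
        simp only [Algebra.TensorProduct.tmul_mul_tmul, TensorProduct.sum_tmul, map_sum,
          TensorProduct.assoc_tmul, LinearMap.lTensor_tmul, actMul_tmul, coprodRight_tmul,
          CrossedModule.act_mul, map_mul, parityT_ι, neg_mul, map_neg, LinearMap.neg_apply,
          actT_mul_coactCoeff, actT_ι, TensorProduct.tmul_neg, TensorProduct.tmul_sum,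
          Finset.sum_neg_distrib, mul_assoc, sub_eq_add_neg]
        rw [Finset.sum_comm]
    have h2 := h1 (coactT k A V (parityT k V c))
    have h3 : ∀ i, parityT k V (c * ιT (e i)) = (-1 : k) • (parityT k V c * ιT (e i)) := by
      intro i; simp [parityT_ι]
    simp only [coprodRight_tmul, map_add, map_sum, coprodStep_tmul, h3, map_mul, map_smul,
      coactT_ι, ← h2, Finset.sum_add_distrib, Finset.mul_sum, ← TensorProduct.smul_tmul',
      ← Finset.smul_sum, mul_assoc]
    rw [neg_one_smul]
    abel

theorem coprodT_one : coprodT k A V 1 = 1 ⊗ₜ 1 := by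
  simp [coprodT]

/-- The coproduct is defined from the left; the new letter moves to the right because the two
multiplications commute and agree on 1 ⊗ 1. -/
theorem coprodT_mul_ι (x : T) (m : ι) :
    coprodT k A V (x * ιT (e m)) = coprodRight A e m (coprodT k A V x) := by
  have h : ∀ z, TensorAlgebra.lift k (coprodStep k A V) x (coprodRight A e m z) =
      coprodRight A e m (TensorAlgebra.lift k (coprodStep k A V) x z) := by
    induction x using TensorAlgebra.induction with
    | algebraMap r => intro z; simp [Algebra.algebraMap_eq_smul_one]
    | ι v => intro z; simp only [TensorAlgebra.lift_ι_apply, coprodStep_coprodRight]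
    | mul a b ha hb => intro z; simp only [map_mul, Module.End.mul_apply, ha, hb]
    | add a b ha hb => intro z; simp only [map_add, LinearMap.add_apply, ha, hb]
  have h1 : coprodStep k A V (e m) (1 ⊗ₜ 1) = coprodRight A e m (1 ⊗ₜ 1) := by
    rw [coprodStep_tmul, coprodRight_tmul]
    simp [Algebra.TensorProduct.one_def, actMul_tmul, CrossedModule.act_one, actT_one,
      counit_coactCoeff, apply_ite (algebraMap k T), add_comm, TensorProduct.tmul_ite]
  simp only [coprodT, LinearMap.comp_apply, LinearMap.applyₗ_apply_apply, AlgHom.toLinearMap_apply,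
    map_mul, Module.End.mul_apply, TensorAlgebra.lift_ι_apply, ← h, ← h1]

/-! ### Equivariance of the coproduct -/

variable (k A V) in
/-- The diagonal action on `T ⊗ T`. -/
def actPair (w : A ⊗[k] A) : Module.End k (T ⊗[k] T) :=
  TensorProduct.map (TensorProduct.lift (actT k A V)) (TensorProduct.lift (actT k A V)) ∘ₗ
    (TensorProduct.tensorTensorTensorComm k T T A A).toLinearMap ∘ₗ
    (TensorProduct.mk k (T ⊗[k] T) (A ⊗[k] A)).flip w

theorem actPair_tmul (w : A ⊗[k] A) (c d : T) :
    actPair k A V w (c ⊗ₜ d) = TensorProduct.map (actT k A V c) (actT k A V d) w := by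
  induction w using TensorProduct.induction_on with
  | zero => simp [actPair]
  | add x y hx hy =>
    rw [map_add, ← hx, ← hy]
    simp [actPair, TensorProduct.tmul_add]
  | tmul x y => simp [actPair]

theorem coprodRight_map (m : ι) (f h : A →ₗ[k] T) (w : A ⊗[k] A) :
    coprodRight A e m (TensorProduct.map f h w) =
      TensorProduct.map f (mulRight k (ιT (e m)) ∘ₗ h) w +
      ∑ i, TensorProduct.map (mulRight k (ιT (e i)) ∘ₗ f)
        ((actT k A V).flip (coactCoeff A e i m) ∘ₗ (parityT k V).toLinearMap ∘ₗ h) w := by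
  induction w using TensorProduct.induction_on with
  | zero => simp
  | add x y hx hy => simp only [map_add, hx, hy, Finset.sum_add_distrib]; abel
  | tmul x y => simp [coprodRight_tmul]

theorem map_sum_left {M N P Q κ : Type*} [AddCommGroup M] [Module k M] [AddCommGroup N]
    [Module k N] [AddCommGroup P] [Module k P] [AddCommGroup Q] [Module k Q] [Fintype κ]
    (f : κ → M →ₗ[k] P) (h : N →ₗ[k] Q) :
    TensorProduct.map (∑ i, f i) h = ∑ i, TensorProduct.map (f i) h := by
  ext; simp [TensorProduct.sum_tmul]

theorem map_sum_right {M N P Q κ : Type*} [AddCommGroup M] [Module k M] [AddCommGroup N]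
    [Module k N] [AddCommGroup P] [Module k P] [AddCommGroup Q] [Module k Q] [Fintype κ]
    (h : M →ₗ[k] P) (f : κ → N →ₗ[k] Q) :
    TensorProduct.map h (∑ i, f i) = ∑ i, TensorProduct.map h (f i) := by
  ext; simp [TensorProduct.tmul_sum]

theorem actT_mul_ι_eq_sum (x : T) (m : ι) :
    actT k A V (x * ιT (e m)) =
      ∑ l, (mulRight k (ιT (e l)) ∘ₗ actT k A V x) ∘ₗ convRight (actCoeff A e l m) := by
  ext a; simp [actT_mul_ι]

theorem sum_actT_actT (x : T) (i m : ι) (a : A) :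
    ∑ l, actT k A V (actT k A V x (convRight (actCoeff A e l m) a)) (coactCoeff A e i l) =
      ∑ l, actT k A V (actT k A V x (coactCoeff A e l m)) (convLeft (actCoeff A e i l) a) := by
  simpa only [map_sum, actT_act_mul e] using
    congrArg (actT k A V x) (sum_convRight_mul_coactCoeff A e i m a)

/-- The element e_m ⊗ 1 + 1 ⊗ e_m transforms like e_m. Its second summand meets d ◁ t_im, and there
the crossed module compatibility, through `sum_actT_actT`, matches the two sides. -/
theorem actPair_coprodRight (m : ι) (a : A) (z : T ⊗[k] T) :
    actPair k A V (comul a) (coprodRight A e m z) =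
      ∑ l, coprodRight A e l (actPair k A V (comul (convRight (actCoeff A e l m) a)) z) := by
  induction z using TensorProduct.induction_on with
  | zero => simp
  | add x y hx hy => simp only [map_add, hx, hy, Finset.sum_add_distrib]
  | tmul c d =>
    have hl : actPair k A V (comul a) (coprodRight A e m (c ⊗ₜ d)) =
        ∑ l, TensorProduct.map (actT k A V c) ((mulRight k (ιT (e l)) ∘ₗ actT k A V d) ∘ₗ
          convRight (actCoeff A e l m)) (comul a) + ∑ i, ∑ l,
        TensorProduct.map (mulRight k (ιT (e l)) ∘ₗ actT k A V c)
          (actT k A V (actT k A V (parityT k V d) (coactCoeff A e i m)) ∘ₗ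
            convLeft (actCoeff A e l i)) (comul a) := by
      rw [coprodRight_tmul, map_add, map_sum, actPair_tmul, actT_mul_ι_eq_sum, map_sum_right,
        LinearMap.sum_apply]
      congr 1
      refine Finset.sum_congr rfl fun i _ => ?_
      rw [actPair_tmul, actT_mul_ι_eq_sum, map_sum_left, LinearMap.sum_apply]
      simp only [map_comp_convLeft_comul]
    have hr : ∀ l, coprodRight A e l
        (actPair k A V (comul (convRight (actCoeff A e l m) a)) (c ⊗ₜ d)) =
        TensorProduct.map (actT k A V c) ((mulRight k (ιT (e l)) ∘ₗ actT k A V d) ∘ₗ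
          convRight (actCoeff A e l m)) (comul a) + ∑ i,
        TensorProduct.map (mulRight k (ιT (e i)) ∘ₗ actT k A V c)
          ((actT k A V).flip (coactCoeff A e i l) ∘ₗ (parityT k V).toLinearMap ∘ₗ
            actT k A V d ∘ₗ convRight (actCoeff A e l m)) (comul a) := by
      intro l
      rw [actPair_tmul, map_convRight_comul, coprodRight_map, LinearMap.comp_assoc]
    rw [hl, Finset.sum_congr rfl fun l _ => hr l, Finset.sum_add_distrib, add_right_inj,
      Finset.sum_comm]
    refine Eq.trans (Finset.sum_congr rfl fun i _ => ?_) Finset.sum_comm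
    have key : ∑ l, actT k A V (actT k A V (parityT k V d) (coactCoeff A e l m)) ∘ₗ
        convLeft (actCoeff A e i l) = ∑ l, (actT k A V).flip (coactCoeff A e i l) ∘ₗ
        (parityT k V).toLinearMap ∘ₗ actT k A V d ∘ₗ convRight (actCoeff A e l m) := by
      ext b
      simpa [parityT_actT e] using (sum_actT_actT e (parityT k V d) i m b).symm
    have key' := congrArg (fun F => TensorProduct.map (mulRight k (ιT (e i)) ∘ₗ actT k A V c) F
      (comul a)) key
    simpa only [map_sum_right, LinearMap.sum_apply] using key'

theorem coprodT_actT (e : Module.Basis ι k V) (x : T) (a : A) :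
    coprodT k A V (actT k A V x a) = actPair k A V (comul a) (coprodT k A V x) := by
  induction x using tensorAlgebra_induction_right e generalizing a with
  | one =>
    have h : ∀ w : A ⊗[k] A, TensorProduct.map (actT k A V 1) (actT k A V 1) w =
        counit (R := k) (TensorProduct.lid k A ((counit (R := k)).rTensor A w)) • (1 ⊗ₜ[k] 1) := by
      intro w
      induction w using TensorProduct.induction_on with
      | zero => simp
      | add x y hx hy => simp only [map_add, hx, hy, add_smul]
      | tmul x z =>
        simp only [TensorProduct.map_tmul, actT_one, Algebra.algebraMap_eq_smul_one,
          TensorProduct.smul_tmul_smul, LinearMap.rTensor_tmul, TensorProduct.lid_tmul, map_smul,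
          smul_eq_mul]
    rw [coprodT_one, actPair_tmul, h, Coalgebra.rTensor_counit_comul, TensorProduct.lid_tmul,
      one_smul, actT_one, Algebra.algebraMap_eq_smul_one, map_smul, coprodT_one]
  | add x y hx hy => simp only [map_add, LinearMap.add_apply, hx, hy]
  | smul c x hx => simp only [map_smul, LinearMap.smul_apply, hx]
  | mul x m hx =>
    rw [coprodT_mul_ι, actPair_coprodRight, actT_mul_ι, map_sum]
    simp only [coprodT_mul_ι, hx]

theorem coprodT_parityT (e : Module.Basis ι k V) (x : T) :
    coprodT k A V (parityT k V x) =
      TensorProduct.map (parityT k V).toLinearMap (parityT k V).toLinearMap (coprodT k A V x) := by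
  induction x using tensorAlgebra_induction_right e with
  | one => simp [coprodT_one]
  | add x y hx hy => simp only [map_add, hx, hy]
  | smul c x hx => simp only [map_smul, hx]
  | mul x m hx =>
    rw [map_mul, parityT_ι, mul_neg, map_neg, coprodT_mul_ι, hx, coprodT_mul_ι]
    generalize coprodT k A V x = z
    induction z using TensorProduct.induction_on with
    | zero => simp
    | add x y hx hy => simp only [map_add, neg_add, hx, hy]
    | tmul c d =>
      simp [coprodRight_tmul, parityT_ι, parityT_actT e, TensorProduct.neg_tmul,
        TensorProduct.tmul_neg, add_comm]

/-- Both sides obey the same recursion in the last letter, once equivariance of Δ is used for the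
term x ◁ t_im. With the counit, this identifies interior products with skew derivations. -/
theorem coprodT_deriv (i : ι) (x : T) :
    (deriv A e i).rTensor T (coprodT k A V x) = coprodT k A V (deriv A e i x) := by
  induction x using tensorAlgebra_induction_right e with
  | one => simp [coprodT_one, deriv_one]
  | add x y hx hy => simp only [map_add, hx, hy]
  | smul c x hx => simp only [map_smul, hx]
  | mul x m hx =>
    rw [deriv_mul_ι, map_add, coprodT_actT e, coprodT_parityT e, coprodT_mul_ι, coprodT_mul_ι, ← hx]
    generalize coprodT k A V x = z
    induction z using TensorProduct.induction_on with
    | zero => simp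
    | add x y hx hy =>
      simp only [map_add, hx, hy]; abel
    | tmul c d =>
      simp only [coprodRight_tmul, map_add, map_sum, LinearMap.rTensor_tmul, deriv_mul_ι,
        TensorProduct.add_tmul, Finset.sum_add_distrib, TensorProduct.map_tmul, actPair_tmul,
        comul_coactCoeff, AlgHom.toLinearMap_apply]
      abel

theorem coprodT_metricDeriv (j : ι) (x : T) :
    (metricDeriv g e j).rTensor T (coprodT k A V x) = coprodT k A V (metricDeriv g e j x) := by
  have h : (metricDeriv g e j).rTensor T =
      ∑ i, g.form (e j) (e i) • (deriv A e i).rTensor T := by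
    ext c d; simp [metricDeriv, TensorProduct.sum_tmul, TensorProduct.smul_tmul']
  rw [h, metricDeriv]
  simp only [LinearMap.sum_apply, LinearMap.smul_apply, coprodT_deriv, map_sum, map_smul]

theorem counit_coprodT (e : Module.Basis ι k V) (x : T) :
    TensorProduct.lid k T ((εT).toLinearMap.rTensor T (coprodT k A V x)) = x := by
  induction x using tensorAlgebra_induction_right e with
  | one => simp [coprodT_one]
  | add x y hx hy => simp only [map_add, hx, hy]
  | smul c x hx => simp only [map_smul, hx]
  | mul x m hx =>
    rw [coprodT_mul_ι]
    conv_rhs => rw [← hx]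
    generalize coprodT k A V x = z
    induction z using TensorProduct.induction_on with
    | zero => simp
    | add x y hx hy => simp only [map_add, hx, hy, add_mul]
    | tmul c d => simp [coprodRight_tmul]

/-- The interior product `⟨x, y₁⟩ y₂`. -/
def interior (x y : T) : T :=
  TensorProduct.lid k T ((pairT g x).rTensor T (coprodT k A V y))

theorem interior_one (e : Module.Basis ι k V) (y : T) : interior g 1 y = y := by
  have : pairT g 1 = (εT).toLinearMap := by ext y; simp [pairT_one]
  rw [interior, this, counit_coprodT e]

theorem interior_mul_ι (x : T) (j : ι) (y : T) :
    interior g (x * ιT (e j)) y = interior g x (metricDeriv g e j y) := by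
  have : pairT g (x * ιT (e j)) = pairT g x ∘ₗ metricDeriv g e j := by
    ext y; simp [pairT_mul_ι]
  rw [interior, interior, ← coprodT_metricDeriv, this, LinearMap.rTensor_comp,
    LinearMap.comp_apply]

theorem interior_ι (j : ι) (y : T) : interior g (ιT (e j)) y = metricDeriv g e j y := by
  rw [← one_mul (ιT (e j)), interior_mul_ι, interior_one g e]

/-- Interior products by words are composites of the operators D_j, which preserve the radical. -/
theorem interior_mem_radical (e : Module.Basis ι k V) (x : T) {y : T} (hy : y ∈ radical g) :
    interior g x y ∈ radical g := by
  induction x using tensorAlgebra_induction_right e generalizing y with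
  | one => rwa [interior_one g e]
  | add x x' hx hx' =>
    have : interior g (x + x') y = interior g x y + interior g x' y := by
      simp [interior, LinearMap.rTensor_add]
    rw [this]; exact add_mem (hx hy) (hx' hy)
  | smul c x hx =>
    have : interior g (c • x) y = c • interior g x y := by
      simp [interior, LinearMap.rTensor_smul]
    rw [this]; exact Submodule.smul_mem _ _ (hx hy)
  | mul x j hx => rw [interior_mul_ι]; exact hx (metricDeriv_mem_radical g e j hy)

/-! ### The antipode of the tensor algebra -/

variable (A) in
/-- The map `y ↦ -∑ᵢ eᵢ (π y ◁ tᵢₘ)`. -/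
def antipodeStep (m : ι) : Module.End k T :=
  -∑ i, mulLeft k (ιT (e i)) ∘ₗ (actT k A V).flip (coactCoeff A e i m) ∘ₗ
    (parityT k V).toLinearMap

theorem antipodeStep_apply (m : ι) (y : T) :
    antipodeStep A e m y =
      -∑ i, ιT (e i) * actT k A V (parityT k V y) (coactCoeff A e i m) := by
  simp [antipodeStep]

variable (A) in
/-- The antipode of the tensor algebra. -/
def antipodeT : Module.End k T :=
  -- Passing to the opposite endomorphism algebra makes the last letter act outermost, as the
  -- braided antimultiplicativity of S requires.
  LinearMap.applyₗ (1 : T) ∘ₗ (MulOpposite.opLinearEquiv k).symm.toLinearMap ∘ₗ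
    (TensorAlgebra.lift k ((MulOpposite.opLinearEquiv k).toLinearMap ∘ₗ
      e.constr k (antipodeStep A e))).toLinearMap

theorem antipodeT_one : antipodeT A e 1 = 1 := by
  simp [antipodeT]

theorem antipodeT_mul_ι (x : T) (m : ι) :
    antipodeT A e (x * ιT (e m)) =
      -∑ i, ιT (e i) * actT k A V (parityT k V (antipodeT A e x)) (coactCoeff A e i m) := by
  rw [← antipodeStep_apply]
  simp [antipodeT]

theorem antipodeT_parityT (x : T) :
    antipodeT A e (parityT k V x) = parityT k V (antipodeT A e x) := by
  induction x using tensorAlgebra_induction_right e with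
  | one => simp [antipodeT_one]
  | add x y hx hy => simp only [map_add, hx, hy]
  | smul c x hx => simp only [map_smul, hx]
  | mul x m hx => simp [parityT_ι, antipodeT_mul_ι, hx, parityT_actT e]

theorem antipodeT_actT (x : T) (a : A) :
    antipodeT A e (actT k A V x a) = actT k A V (antipodeT A e x) a := by
  induction x using tensorAlgebra_induction_right e generalizing a with
  | one => simp [actT_one, antipodeT_one, Algebra.algebraMap_eq_smul_one]
  | add x y hx hy => simp only [map_add, LinearMap.add_apply, hx, hy]
  | smul c x hx => simp only [map_smul, LinearMap.smul_apply, hx]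
  | mul x m hx =>
    simp only [actT_mul_ι, map_sum, antipodeT_mul_ι, hx, map_neg, LinearMap.neg_apply,
      LinearMap.sum_apply, actT_ι_mul, Finset.sum_neg_distrib, parityT_actT e]
    congr 1
    rw [Finset.sum_comm]
    conv_rhs => rw [Finset.sum_comm]
    refine Finset.sum_congr rfl fun i _ => ?_
    rw [← Finset.mul_sum, ← Finset.mul_sum, sum_actT_actT]

theorem antipodeT_left (x : T) :
    LinearMap.mul' k T ((antipodeT A e).rTensor T (coprodT k A V x)) = algebraMap k T (εT x) := by
  induction x using tensorAlgebra_induction_right e with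
  | one => simp [coprodT_one, antipodeT_one]
  | add x y hx hy => simp only [map_add, hx, hy]
  | smul c x hx => simp only [map_smul, hx, Algebra.algebraMap_eq_smul_one, smul_assoc]
  | mul x m hx =>
    -- Under multiplication after S ⊗ id, appending e_m becomes u ↦ u e_m - Σ_i e_i (parity(u) ◁
    -- t_im). By induction u is a scalar, and there this vanishes since ε(t_im) = δ_im.
    have h : ∀ z, LinearMap.mul' k T ((antipodeT A e).rTensor T (coprodRight A e m z)) =
        LinearMap.mul' k T ((antipodeT A e).rTensor T z) * ιT (e m) - ∑ i, ιT (e i) *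
          actT k A V (parityT k V (LinearMap.mul' k T ((antipodeT A e).rTensor T z)))
            (coactCoeff A e i m) := by
      intro z
      induction z using TensorProduct.induction_on with
      | zero => simp
      | add x y hx hy =>
        simp only [map_add, hx, hy, add_mul, mul_add, Finset.sum_add_distrib, LinearMap.add_apply]
        abel
      | tmul c d =>
        simp only [coprodRight_tmul, map_add, map_sum, LinearMap.rTensor_tmul, antipodeT_mul_ι,
          LinearMap.mul'_apply, neg_mul, Finset.sum_neg_distrib, Finset.sum_mul, map_mul,
          actT_mul_coactCoeff, Finset.mul_sum, mul_assoc, sub_eq_add_neg]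
        rw [Finset.sum_comm]
    rw [coprodT_mul_ι, h, hx]
    simp [Algebra.algebraMap_eq_smul_one, actT_one, counit_coactCoeff, apply_ite]

theorem antipodeT_right (x : T) :
    LinearMap.mul' k T ((antipodeT A e).lTensor T (coprodT k A V x)) = algebraMap k T (εT x) := by
  induction x using tensorAlgebra_induction_right e with
  | one => simp [coprodT_one, antipodeT_one]
  | add x y hx hy => simp only [map_add, hx, hy]
  | smul c x hx => simp only [map_smul, hx, Algebra.algebraMap_eq_smul_one, smul_assoc]
  | mul x m hx =>
    rw [coprodT_mul_ι, map_mul, algebraMapInv_ι, mul_zero, map_zero]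
    generalize coprodT k A V x = z
    induction z using TensorProduct.induction_on with
    | zero => simp
    | add x y hx hy => simp only [map_add, hx, hy, add_zero]
    | tmul c d =>
      simp [coprodRight_tmul, antipodeT_mul_ι, antipodeT_actT, antipodeT_parityT, Finset.mul_sum,
        mul_assoc]

/-! ### Compatibility with the grading -/

theorem actT_mem (e : Module.Basis ι k V) {n : ℕ} {x : T} (hx : x ∈ tensorDeg k V n) (a : A) :
    actT k A V x a ∈ tensorDeg k V n := by
  induction hx using tensorDeg_induction_left generalizing a with
  | algebraMap r =>
    rw [Algebra.algebraMap_eq_smul_one, map_smul, LinearMap.smul_apply, actT_one]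
    exact Submodule.smul_mem _ _ (Submodule.algebraMap_mem _)
  | add n x y _ _ hx hy => rw [map_add, LinearMap.add_apply]; exact add_mem (hx a) (hy a)
  | mul n x v _ hx =>
    rw [← e.sum_repr v, map_sum, Finset.sum_mul, map_sum, LinearMap.sum_apply]
    refine sum_mem fun j _ => ?_
    rw [map_smul, smul_mul_assoc, map_smul, LinearMap.smul_apply, actT_ι_mul]
    exact Submodule.smul_mem _ _ (sum_mem fun i _ => ι_mul_mem _ (hx _))

theorem parityT_of_mem {n : ℕ} {x : T} (hx : x ∈ tensorDeg k V n) :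
    parityT k V x = (-1 : k) ^ n • x := by
  induction hx using tensorDeg_induction_left with
  | algebraMap r => simp
  | add n x y _ _ hx hy => rw [map_add, hx, hy, smul_add]
  | mul n x v _ hx => rw [map_mul, parityT_ι, hx]; simp [pow_succ]

theorem antipodeT_mem {n : ℕ} {x : T} (hx : x ∈ tensorDeg k V n) :
    antipodeT A e x ∈ tensorDeg k V n := by
  induction hx using tensorDeg_induction_right with
  | algebraMap r =>
    rw [Algebra.algebraMap_eq_smul_one, map_smul, antipodeT_one]
    exact Submodule.smul_mem _ _ (Submodule.one_le.mp (pow_zero (M := Submodule k T) _).ge)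
  | add n x y _ _ hx hy => rw [map_add]; exact add_mem hx hy
  | mul n x v _ hx =>
    rw [← e.sum_repr v, map_sum, Finset.mul_sum, map_sum]
    refine sum_mem fun j _ => ?_
    rw [map_smul, mul_smul_comm, map_smul, antipodeT_mul_ι]
    refine Submodule.smul_mem _ _ (neg_mem (sum_mem fun i _ => ι_mul_mem _ (actT_mem e ?_ _)))
    rw [parityT_of_mem hx]
    exact Submodule.smul_mem _ _ hx

/-! ### Triangularity of the coproduct -/

variable (k V) in
/-- The subspace of `T ⊗ T` of tensors whose first leg has degree less than `n`. -/
def lowerTensors (n : ℕ) : Submodule k (T ⊗[k] T) :=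
  Submodule.span k {z | ∃ m < n, ∃ c ∈ tensorDeg k V m, ∃ d, z = c ⊗ₜ d}

theorem coprodRight_mem_lowerTensors {n : ℕ} {z : T ⊗[k] T} (hz : z ∈ lowerTensors k V n) (m : ι) :
    coprodRight A e m z ∈ lowerTensors k V (n + 1) := by
  induction hz using Submodule.span_induction with
  | mem z hz =>
    obtain ⟨p, hp, c, hc, d, rfl⟩ := hz
    rw [coprodRight_tmul]
    exact add_mem (Submodule.subset_span ⟨p, by omega, c, hc, _, rfl⟩)
      (sum_mem fun i _ => Submodule.subset_span ⟨p + 1, by omega, _, mul_ι_mem _ hc, _, rfl⟩)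
  | zero => rw [map_zero]; exact zero_mem _
  | add x y _ _ hx hy => rw [map_add]; exact add_mem hx hy
  | smul c x _ hx => rw [map_smul]; exact Submodule.smul_mem _ _ hx

/-- Appending a primitive letter raises the degree of the first leg by at most one, and only x ⊗ 1
contributes to its top degree. This is what makes convolution inverses unique. -/
theorem coprodT_sub_mem (e : Module.Basis ι k V) {n : ℕ} {x : T} (hx : x ∈ tensorDeg k V n) :
    coprodT k A V x - x ⊗ₜ 1 ∈ lowerTensors k V n := by
  induction hx using tensorDeg_induction_right with
  | algebraMap r =>
    rw [Algebra.algebraMap_eq_smul_one, map_smul, coprodT_one, ← TensorProduct.smul_tmul', sub_self]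
    exact zero_mem _
  | add n x y _ _ hx hy =>
    rw [map_add, TensorProduct.add_tmul, add_sub_add_comm]; exact add_mem hx hy
  | mul n x v hx' hx =>
    rw [← e.sum_repr v, map_sum, Finset.mul_sum, map_sum, TensorProduct.sum_tmul,
      ← Finset.sum_sub_distrib]
    refine sum_mem fun j _ => ?_
    have hs : ∀ (c : k) (y z : T ⊗[k] T), c • y - c • z = c • (y - z) :=
      fun c y z => (smul_sub c y z).symm
    rw [map_smul, mul_smul_comm, map_smul, ← TensorProduct.smul_tmul', hs]
    refine Submodule.smul_mem _ _ ?_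
    have h1 : coprodRight A e j (x ⊗ₜ 1) = x ⊗ₜ ιT (e j) + (x * ιT (e j)) ⊗ₜ 1 := by
      simp [coprodRight_tmul, actT_one, counit_coactCoeff, apply_ite (algebraMap k T),
        TensorProduct.tmul_ite]
    have h2 : coprodT k A V (x * ιT (e j)) - (x * ιT (e j)) ⊗ₜ 1 =
        coprodRight A e j (coprodT k A V x - x ⊗ₜ 1) + x ⊗ₜ ιT (e j) := by
      rw [coprodT_mul_ι, map_sub, h1]; abel
    rw [h2]
    exact add_mem (coprodRight_mem_lowerTensors e hx j)
      (Submodule.subset_span ⟨n, by omega, x, hx', _, rfl⟩)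

end Coproduct

/-! ### Descent of the structure maps to the braided exterior algebra -/

section Descent

variable {k A V ι : Type*} [Field k] [Ring A] [HopfAlgebra k A]
  [AddCommGroup V] [Module k V] [CrossedModule k A V] [Fintype ι] [DecidableEq ι]
  (g : Metric k A V) (e : Module.Basis ι k V)

local notation "T" => TensorAlgebra k V
local notation "Λ" => BExt k A V
local notation "π" => proj k A V
local notation "ιT" => TensorAlgebra.ι k (M := V)
local notation "εT" => TensorAlgebra.algebraMapInv (R := k) (M := V)

theorem proj_surjective : Function.Surjective π := RingQuot.mkAlgHom_surjective _ _

/-- The radical of the pairing as a two-sided ideal. -/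
def radicalIdeal : TwoSidedIdeal T :=
  TwoSidedIdeal.mk' (radical g : Set T) (zero_mem _) add_mem neg_mem
    (fun hy => mul_mem_radical_left g e hy _) (fun hy => mul_mem_radical_right g e hy _)

/-- A ring quotient kills the ideal generated by its relations. Here the relations already form a
two-sided ideal, so mapping to the quotient by that ideal shows that nothing more is killed. -/
theorem proj_eq_zero_iff (e : Module.Basis ι k V) {x : T} : π x = 0 ↔ x ∈ radical g := by
  constructor
  · intro h
    have hI : ∀ y, (radicalIdeal g e).ringCon.mk' y = 0 ↔ y ∈ radical g := by
      intro y
      rw [← TwoSidedIdeal.mem_ker, TwoSidedIdeal.ker_ringCon_mk', radicalIdeal,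
        TwoSidedIdeal.mem_mk']
      rfl
    have w : ∀ ⦃x y : T⦄, (factorialSum k A V x = 0 ∧ y = 0) →
        (radicalIdeal g e).ringCon.mk' x = (radicalIdeal g e).ringCon.mk' y := by
      rintro x _ ⟨hx, rfl⟩
      rw [map_zero, hI, mem_radical_iff_factorialSum g e, hx]
    have h2 : RingQuot.lift ⟨_, w⟩ (π x) = (radicalIdeal g e).ringCon.mk' x := by
      rw [proj, ← AlgHom.coe_toRingHom, RingQuot.mkAlgHom_coe, RingQuot.lift_mkRingHom_apply]
    rw [← hI, ← h2, h, map_zero]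
  · intro h
    have := RingQuot.mkAlgHom_rel k
      (s := fun x y : T => factorialSum k A V x = 0 ∧ y = 0) (x := x) (y := 0)
      ⟨(mem_radical_iff_factorialSum g e).1 h, rfl⟩
    rw [proj, this, map_zero]

/-- The choice in `induced` has its intended value as soon as some map satisfies the specification,
that is, as soon as f kills the radical. -/
theorem induced_proj (e : Module.Basis ι k V) {M : Type*} [AddCommMonoid M] [Module k M]
    {f : T →ₗ[k] M} (hf : ∀ x ∈ radical g, f x = 0) (x : T) :
    induced (A := A) f (π x) = f x := by
  have hker : ∀ x y, π x = π y → f x = f y := fun x y h => by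
    have : f (x - y) = 0 := hf _ ((proj_eq_zero_iff g e).1 (by rw [map_sub, h, sub_self]))
    rw [← sub_add_cancel x y, map_add, this, zero_add]
  have hinv := Function.surjInv_eq (proj_surjective (k := k) (A := A) (V := V))
  have : ∃ h : Λ →ₗ[k] M, ∀ x, h (π x) = f x :=
    ⟨{ toFun := fun y => f (Function.surjInv proj_surjective y)
       map_add' := fun y z => by
        rw [← map_add]
        exact hker _ _ (by rw [map_add, hinv, hinv, hinv])
       map_smul' := fun c y => by
        rw [← map_smul]
        exact hker _ _ (by rw [map_smul, hinv, hinv]; rfl) }, fun x => hker _ _ (hinv _)⟩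
  exact Classical.epsilon_spec this x

theorem induced_proj_comp (e : Module.Basis ι k V) {f : Module.End k T}
    (hf : ∀ x ∈ radical g, f x ∈ radical g) (x : T) :
    induced (A := A) ((π).toLinearMap ∘ₗ f) (π x) = π (f x) :=
  induced_proj g e (fun y hy => (proj_eq_zero_iff g e).2 (hf y hy)) x

include g in
theorem actE_proj (e : Module.Basis ι k V) (x : T) (a : A) :
    actE k A V (π x) a = π (actT k A V x a) := by
  rw [actE, induced_proj g e]
  · rfl
  · intro y hy
    ext a
    exact (proj_eq_zero_iff g e).2 (actT_mem_radical g e hy a)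

include g in
theorem counitE_proj (e : Module.Basis ι k V) (x : T) : counitE k A V (π x) = εT x := by
  rw [counitE, induced_proj g e]
  · rfl
  · intro y hy; exact algebraMapInv_of_mem_radical g hy

/-- The second variable descends by definition of the radical, the first by `pairT_of_mem_radical`.
-/
theorem pairE_proj (e : Module.Basis ι k V)
    (hS : Function.Bijective (HopfAlgebra.antipode k : A →ₗ[k] A)) (x y : T) :
    pairE g (π x) (π y) = pairT g x y := by
  have : ∃ P : Λ →ₗ[k] Λ →ₗ[k] k, ∀ x y, P (π x) (π y) = pairT g x y := by
    let F : T →ₗ[k] Λ →ₗ[k] k := (LinearMap.flip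
      (induced (A := A) (pairT g).flip))
    have hF : ∀ x y, F x (π y) = pairT g x y := fun x y => by
      change induced (A := A) (pairT g).flip (π y) x = _
      rw [induced_proj g e]
      · rfl
      · intro y hy; exact hy
    refine ⟨induced (A := A) F, fun x y => ?_⟩
    rw [induced_proj g e, hF]
    intro x hx
    ext y
    obtain ⟨y, rfl⟩ := proj_surjective (k := k) (A := A) y
    rw [hF, pairT_of_mem_radical g e hS hx]; rfl
  exact Classical.epsilon_spec this x y

theorem pairE_nondegenerate (e : Module.Basis ι k V)
    (hS : Function.Bijective (HopfAlgebra.antipode k : A →ₗ[k] A)) {y : Λ}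
    (h : ∀ x, pairE g x y = 0) : y = 0 := by
  obtain ⟨y, rfl⟩ := proj_surjective y
  rw [proj_eq_zero_iff g e, mem_radical]
  intro x
  rw [← pairE_proj g e hS, h]

/-- A family of functionals separating points of `M` separates tensors in `M ⊗ N`. -/
theorem tensor_eq_zero_of_separating {X M N : Type*} [AddCommGroup M] [Module k M]
    [AddCommGroup N] [Module k N] (P : X → M →ₗ[k] k) (hP : ∀ m, (∀ x, P x m = 0) → m = 0)
    {w : M ⊗[k] N} (h : ∀ x, TensorProduct.lid k N ((P x).rTensor N w) = 0) : w = 0 := by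
  let b := Module.Basis.ofVectorSpace k N
  classical
  refine (TensorProduct.equivFinsuppOfBasisRight (M := M) b).injective ?_
  rw [map_zero]
  ext i
  refine hP _ fun x => ?_
  have key : ∀ w : M ⊗[k] N, P x (TensorProduct.equivFinsuppOfBasisRight b w i) =
      b.coord i (TensorProduct.lid k N ((P x).rTensor N w)) := by
    intro w
    induction w using TensorProduct.induction_on with
    | zero => simp
    | add u v hu hv => simp only [map_add, Finsupp.add_apply, hu, hv]
    | tmul m n => simp [TensorProduct.equivFinsuppOfBasisRight_apply_tmul_apply, mul_comm]
  rw [key, h, map_zero]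

/-- For y in the radical, (π ⊗ π)Δy is tested on its first leg by the functionals ⟨x, ·⟩, which
separate points of Λ; each test gives the class of an interior product of y, hence zero. -/
theorem coprodE_proj (g : Metric k A V) (e : Module.Basis ι k V)
    (hS : Function.Bijective (HopfAlgebra.antipode k : A →ₗ[k] A)) (x : T) :
    coprodE k A V (π x) =
      TensorProduct.map (π).toLinearMap (π).toLinearMap (coprodT k A V x) := by
  rw [coprodE, induced_proj g e]
  · rfl
  intro y hy
  refine tensor_eq_zero_of_separating (fun x : T => pairE g (π x))
    (fun m hm => pairE_nondegenerate g e hS fun x => ?_) fun x => ?_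
  · obtain ⟨x, rfl⟩ := proj_surjective x; exact hm x
  · have h1 : ∀ w : T ⊗[k] T, TensorProduct.lid k Λ ((pairE g (π x)).rTensor Λ
        (TensorProduct.map (π).toLinearMap (π).toLinearMap w)) =
        π (TensorProduct.lid k T ((pairT g x).rTensor T w)) := by
      intro w
      induction w using TensorProduct.induction_on with
      | zero => simp
      | add u v hu hv => simp only [map_add, hu, hv]
      | tmul m n => simp [pairE_proj g e hS]
    rw [LinearMap.comp_apply, h1, proj_eq_zero_iff g e]
    exact interior_mem_radical g e x hy

/-! ### Parity, skew derivations and grading on Λ -/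

variable (k A V) in
/-- The parity automorphism of `Λ`. -/
def parityE : Module.End k Λ := induced ((π).toLinearMap ∘ₗ (parityT k V).toLinearMap)

variable (A) in
/-- The skew derivations `∂_i` of `Λ`. -/
def derivE (i : ι) : Module.End k Λ := induced ((π).toLinearMap ∘ₗ deriv A e i)

variable (k A V) in
/-- The projection of `Λ` onto its component of degree `n`. -/
def degE (n : ℕ) : Module.End k Λ := induced ((π).toLinearMap ∘ₗ degProj n)

include g in
theorem parityE_proj (e : Module.Basis ι k V) (x : T) :
    parityE k A V (π x) = π (parityT k V x) :=
  induced_proj_comp g e (f := (parityT k V).toLinearMap)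
    (fun _ hy => parityT_mem_radical g e hy) x

include g in
theorem derivE_proj (i : ι) (x : T) : derivE A e i (π x) = π (deriv A e i x) :=
  induced_proj_comp g e (fun _ hy => deriv_mem_radical g e i hy) x

include g in
theorem degE_proj (e : Module.Basis ι k V) (n : ℕ) (x : T) :
    degE k A V n (π x) = π (degProj n x) :=
  induced_proj_comp g e (fun _ hy => degProj_mem_radical g e hy n) x

include g in
theorem degE_of_mem (e : Module.Basis ι k V) (n : ℕ) {m : ℕ} {x : Λ} (hx : x ∈ extDeg k A V m) :
    degE k A V n x = if n = m then x else 0 := by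
  obtain ⟨x, hx, rfl⟩ := hx
  have := degE_proj g e n x
  rw [degProj_of_mem hx] at this
  split_ifs at this ⊢ <;> simpa using this

theorem exterior_induction {P : Λ → Prop} (add : ∀ x y, P x → P y → P (x + y))
    (h : ∀ m, ∀ x ∈ extDeg k A V m, P x) (x : Λ) : P x := by
  obtain ⟨x, rfl⟩ := proj_surjective x
  induction x using homogeneous_induction with
  | add x y hx hy => rw [map_add]; exact add _ _ hx hy
  | h m x hx => exact h m _ ⟨x, hx, rfl⟩

/-- Every degree is the image of a finite-dimensional tensor power, and those above the top degree
vanish. Duality and dimension counts on Λ depend on this. -/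
theorem TopForm.finiteDimensional [FiniteDimensional k V] (t : TopForm k A V) :
    FiniteDimensional k Λ := by
  have hι : (LinearMap.range ιT).FG := by
    rw [← Submodule.map_top]; exact Module.Finite.fg_top.map _
  have hfg : ∀ m, (extDeg k A V m).FG := fun m => (hι.pow m).map _
  refine ⟨?_⟩
  have : (⊤ : Submodule k Λ) = ⨆ m : Fin (t.degree + 1), extDeg k A V m := by
    refine (eq_top_iff.2 fun x _ => ?_).symm
    refine exterior_induction (P := fun x => x ∈ ⨆ m : Fin (t.degree + 1), extDeg k A V m)
      (fun _ _ => add_mem) (fun m x hx => ?_) x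
    by_cases hm : m < t.degree + 1
    · exact Submodule.mem_iSup_of_mem (⟨m, hm⟩ : Fin (t.degree + 1)) hx
    · rw [t.top m (by omega), Submodule.mem_bot] at hx
      rw [hx]; exact zero_mem _
  rw [this]
  exact Submodule.fg_iSup _ fun m => hfg m

/-! ### The antipode of the braided exterior algebra -/

/-- Convolution with π on the right is injective: since Δx is x ⊗ 1 plus terms with first leg of
lower degree, the values are determined by induction on the degree. -/
theorem eq_of_conv_proj (e : Module.Basis ι k V) {Y Z : T →ₗ[k] Λ}
    (h : ∀ x, LinearMap.mul' k Λ (TensorProduct.map Y (π).toLinearMap (coprodT k A V x)) =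
      LinearMap.mul' k Λ (TensorProduct.map Z (π).toLinearMap (coprodT k A V x))) :
    Y = Z := by
  have : ∀ n, ∀ x ∈ tensorDeg k V n, Y x = Z x := by
    intro n
    induction n using Nat.strong_induction_on with
    | _ n ih =>
      intro x hx
      have h1 : ∀ z ∈ lowerTensors k V n,
          LinearMap.mul' k Λ (TensorProduct.map Y (π).toLinearMap z) =
            LinearMap.mul' k Λ (TensorProduct.map Z (π).toLinearMap z) := by
        intro z hz
        induction hz using Submodule.span_induction with
        | mem z hz =>
          obtain ⟨m, hm, c, hc, d, rfl⟩ := hz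
          simp [ih m hm c hc]
        | zero => simp
        | add x y _ _ hx hy => simp only [map_add, hx, hy]
        | smul c x _ hx => simp only [map_smul, hx]
      have h2 := h1 _ (coprodT_sub_mem (A := A) e hx)
      have h3 := h x
      rw [← sub_add_cancel (coprodT k A V x) (x ⊗ₜ 1)] at h3
      simpa only [map_add, h2, add_right_inj, TensorProduct.map_tmul, LinearMap.mul'_apply,
        AlgHom.toLinearMap_apply, map_one, mul_one] using h3
  ext1 x
  induction x using homogeneous_induction with
  | add x y hx hy => rw [map_add, hx, hy, map_add]
  | h m x hx => exact this m x hx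

/-- That S on the tensor algebra preserves the radical is not checked directly. Any left convolution
inverse X on Λ satisfies X ∘ π = π ∘ S, because both sides have the same convolution with π; it is
then a right inverse as well, since S is one on the tensor algebra. -/
theorem antipodeE_proj (g : Metric k A V) (e : Module.Basis ι k V)
    (hS : Function.Bijective (HopfAlgebra.antipode k : A →ₗ[k] A)) [FiniteDimensional k Λ] (x : T) :
    antipodeE k A V (π x) = π (antipodeT A e x) := by
  have hmul : ∀ z : T ⊗[k] T, LinearMap.mul' k Λ (TensorProduct.map (π).toLinearMap
      (π).toLinearMap z) = π (LinearMap.mul' k T z) := by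
    intro z
    induction z using TensorProduct.induction_on with
    | zero => simp
    | add u v hu hv => simp only [map_add, hu, hv]
    | tmul m n => simp
  have hr : ∀ (X : Module.End k Λ) (z : T ⊗[k] T), X.rTensor Λ (TensorProduct.map (π).toLinearMap
      (π).toLinearMap z) = TensorProduct.map (X ∘ₗ (π).toLinearMap) (π).toLinearMap z :=
    fun X z => LinearMap.congr_fun (LinearMap.rTensor_comp_map _ _ _ _) z
  have hl : ∀ (X : Module.End k Λ) (z : T ⊗[k] T), X.lTensor Λ (TensorProduct.map (π).toLinearMap
      (π).toLinearMap z) = TensorProduct.map (π).toLinearMap (X ∘ₗ (π).toLinearMap) z :=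
    fun X z => LinearMap.congr_fun (LinearMap.lTensor_comp_map _ _ _ _) z
  let F : Module.End k Λ →ₗ[k] Module.End k Λ :=
    LinearMap.compRight k (LinearMap.mul' k Λ) ∘ₗ LinearMap.lcomp k _ (coprodE k A V) ∘ₗ
      LinearMap.rTensorHom Λ
  have hF : ∀ X y, F X y = LinearMap.mul' k Λ (X.rTensor Λ (coprodE k A V y)) := fun _ _ => rfl
  have hsub : ∀ X : Module.End k Λ, (∀ y, F X y = algebraMap k Λ (counitE k A V y)) →
      X ∘ₗ (π).toLinearMap = (π).toLinearMap ∘ₗ antipodeT A e := by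
    intro X hX
    refine eq_of_conv_proj e fun x => ?_
    have h1 := hX (π x)
    rw [hF, coprodE_proj g e hS, hr, counitE_proj g e] at h1
    have h2 : TensorProduct.map ((π).toLinearMap ∘ₗ antipodeT A e) (π).toLinearMap
        (coprodT k A V x) = TensorProduct.map (π).toLinearMap (π).toLinearMap
          ((antipodeT A e).rTensor T (coprodT k A V x)) :=
      (LinearMap.congr_fun (LinearMap.map_comp_rTensor _ _ _ _) _).symm
    rw [h1, h2, hmul, antipodeT_left e, AlgHom.commutes]
  have hinj : Function.Injective F := by
    intro X Y hXY
    have : X ∘ₗ (π).toLinearMap = Y ∘ₗ (π).toLinearMap := eq_of_conv_proj e fun x => by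
      rw [← hr, ← hr, ← coprodE_proj g e hS, ← hF, ← hF, hXY]
    ext1 y
    obtain ⟨y, rfl⟩ := proj_surjective y
    exact LinearMap.congr_fun this y
  -- Existence of a left inverse by dimension count: X ↦ X * id is an injective endomorphism of a
  -- finite-dimensional space.
  obtain ⟨X, hX⟩ := LinearMap.surjective_of_injective hinj
    (Algebra.linearMap k Λ ∘ₗ counitE k A V)
  have hXp := hsub X fun y => LinearMap.congr_fun hX y
  have hex : ∃ S : Λ →ₗ[k] Λ,
      LinearMap.mul' k Λ ∘ₗ S.rTensor Λ ∘ₗ coprodE k A V =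
          Algebra.linearMap k Λ ∘ₗ counitE k A V ∧
      LinearMap.mul' k Λ ∘ₗ S.lTensor Λ ∘ₗ coprodE k A V =
          Algebra.linearMap k Λ ∘ₗ counitE k A V := by
    refine ⟨X, hX, ?_⟩
    ext1 y
    obtain ⟨y, rfl⟩ := proj_surjective y
    have h2 : TensorProduct.map (π).toLinearMap ((π).toLinearMap ∘ₗ antipodeT A e)
        (coprodT k A V y) = TensorProduct.map (π).toLinearMap (π).toLinearMap
          ((antipodeT A e).lTensor T (coprodT k A V y)) :=
      (LinearMap.congr_fun (LinearMap.map_comp_lTensor _ _ _ _) _).symm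
    simp only [LinearMap.comp_apply]
    rw [coprodE_proj g e hS, hl, hXp, h2, hmul, antipodeT_right e, AlgHom.commutes,
      counitE_proj g e]
    rfl
  have := hsub _ fun y => LinearMap.congr_fun (Classical.epsilon_spec hex).1 y
  exact LinearMap.congr_fun this x

end Descent

/-! ### Structure maps of the braided exterior algebra -/

section ExteriorStructure

variable {k A V ι : Type*} [Field k] [Ring A] [HopfAlgebra k A]
  [AddCommGroup V] [Module k V] [CrossedModule k A V] [Fintype ι] [DecidableEq ι]
  (g : Metric k A V) (e : Module.Basis ι k V)

local notation "T" => TensorAlgebra k V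
local notation "Λ" => BExt k A V
local notation "π" => proj k A V
local notation "ιT" => TensorAlgebra.ι k (M := V)
local notation "εT" => TensorAlgebra.algebraMapInv (R := k) (M := V)

theorem proj_mem_extDeg {n : ℕ} {x : T} (hx : x ∈ tensorDeg k V n) : π x ∈ extDeg k A V n :=
  ⟨x, hx, rfl⟩

theorem one_mem_extDeg : (1 : Λ) ∈ extDeg k A V 0 :=
  ⟨1, by simp, by simp⟩

theorem mem_extDeg_zero {x : Λ} (hx : x ∈ extDeg k A V 0) : ∃ c : k, x = c • 1 := by
  obtain ⟨x, hx, rfl⟩ := hx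
  refine ⟨εT x, ?_⟩
  conv_lhs => rw [mem_tensorDeg_zero hx]
  rw [AlgHom.toLinearMap_apply, AlgHom.commutes, Algebra.algebraMap_eq_smul_one]

theorem mul_mem_extDeg {m n : ℕ} {x y : Λ} (hx : x ∈ extDeg k A V m) (hy : y ∈ extDeg k A V n) :
    x * y ∈ extDeg k A V (m + n) := by
  obtain ⟨x, hx, rfl⟩ := hx
  obtain ⟨y, hy, rfl⟩ := hy
  refine ⟨x * y, ?_, by simp⟩
  have := Submodule.mul_mem_mul hx hy
  rwa [← pow_add] at this

include g in
theorem actE_mem_extDeg (e : Module.Basis ι k V) {n : ℕ} {x : Λ} (hx : x ∈ extDeg k A V n)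
    (a : A) : actE k A V x a ∈ extDeg k A V n := by
  obtain ⟨x, hx, rfl⟩ := hx
  exact ⟨_, actT_mem e hx a, (actE_proj g e x a).symm⟩

include g in
theorem actE_incl (e : Module.Basis ι k V) (v : V) (a : A) :
    actE k A V (incl k A V v) a = incl k A V (CrossedModule.act (k := k) (A := A) v a) := by
  rw [incl, LinearMap.comp_apply, LinearMap.comp_apply, AlgHom.toLinearMap_apply, actE_proj g e,
    actT_ι, AlgHom.toLinearMap_apply]

include g in
theorem actE_one (e : Module.Basis ι k V) (a : A) :
    actE k A V 1 a = counit (R := k) a • (1 : Λ) := by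
  rw [← map_one π, actE_proj g e, actT_one, AlgHom.commutes, Algebra.algebraMap_eq_smul_one,
    map_one]

include g in
theorem actE_act_one (e : Module.Basis ι k V) (x : Λ) : actE k A V x 1 = x := by
  obtain ⟨x, rfl⟩ := proj_surjective x
  rw [actE_proj g e, actT_act_one e]

include g in
theorem actE_act_mul (e : Module.Basis ι k V) (x : Λ) (a b : A) :
    actE k A V x (a * b) = actE k A V (actE k A V x a) b := by
  obtain ⟨x, rfl⟩ := proj_surjective x
  simp only [actE_proj g e, actT_act_mul e]

include g in
theorem actE_mul (e : Module.Basis ι k V) (x y : Λ) (a : A) :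
    actE k A V (x * y) a =
      LinearMap.mul' k Λ (TensorProduct.map (actE k A V x) (actE k A V y) (comul a)) := by
  obtain ⟨x, rfl⟩ := proj_surjective x
  obtain ⟨y, rfl⟩ := proj_surjective y
  rw [← map_mul, actE_proj g e, actT_mul e]
  generalize comul (R := k) a = w
  induction w using TensorProduct.induction_on with
  | zero => simp
  | add u v hu hv => simp only [map_add, hu, hv]
  | tmul b c => simp [actE_proj g e]

include g in
theorem actE_mul_coactCoeff (x y : Λ) (i j : ι) :
    actE k A V (x * y) (coactCoeff A e i j) =
      ∑ l, actE k A V x (coactCoeff A e i l) * actE k A V y (coactCoeff A e l j) := by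
  rw [actE_mul g e, comul_coactCoeff]
  simp

include g in
theorem parityE_mul (e : Module.Basis ι k V) (x y : Λ) :
    parityE k A V (x * y) = parityE k A V x * parityE k A V y := by
  obtain ⟨x, rfl⟩ := proj_surjective x
  obtain ⟨y, rfl⟩ := proj_surjective y
  rw [← map_mul, parityE_proj g e, parityE_proj g e, parityE_proj g e, map_mul, map_mul]

include g in
theorem parityE_actE (e : Module.Basis ι k V) (x : Λ) (a : A) :
    parityE k A V (actE k A V x a) = actE k A V (parityE k A V x) a := by
  obtain ⟨x, rfl⟩ := proj_surjective x
  rw [actE_proj g e, parityE_proj g e, parityE_proj g e, actE_proj g e, parityT_actT e]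

include g in
theorem parityE_of_mem (e : Module.Basis ι k V) {n : ℕ} {x : Λ} (hx : x ∈ extDeg k A V n) :
    parityE k A V x = (-1 : k) ^ n • x := by
  obtain ⟨x, hx, rfl⟩ := hx
  rw [AlgHom.toLinearMap_apply, parityE_proj g e, parityT_of_mem hx, map_smul]

include g in
theorem derivE_mul (i : ι) (x y : Λ) :
    derivE A e i (x * y) = derivE A e i x * y +
      ∑ j, actE k A V (parityE k A V x) (coactCoeff A e i j) * derivE A e j y := by
  obtain ⟨x, rfl⟩ := proj_surjective x
  obtain ⟨y, rfl⟩ := proj_surjective y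
  simp only [← map_mul, derivE_proj g e, deriv_mul, parityE_proj g e, actE_proj g e, map_add,
    map_sum]

include g in
theorem derivE_mem_extDeg_zero (i : ι) {x : Λ} (hx : x ∈ extDeg k A V 0) : derivE A e i x = 0 := by
  obtain ⟨x, hx, rfl⟩ := hx
  rw [AlgHom.toLinearMap_apply, derivE_proj g e, deriv_of_mem_zero e i hx, map_zero]

include g in
theorem derivE_mem_extDeg {n : ℕ} (i : ι) {x : Λ} (hx : x ∈ extDeg k A V (n + 1)) :
    derivE A e i x ∈ extDeg k A V n := by
  obtain ⟨x, hx, rfl⟩ := hx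
  exact ⟨_, deriv_mem e i hx, (derivE_proj g e i x).symm⟩

theorem pairE_parityE (e : Module.Basis ι k V)
    (hS : Function.Bijective (HopfAlgebra.antipode k : A →ₗ[k] A)) (x y : Λ) :
    pairE g (parityE k A V x) y = pairE g x (parityE k A V y) := by
  obtain ⟨x, rfl⟩ := proj_surjective x
  obtain ⟨y, rfl⟩ := proj_surjective y
  rw [parityE_proj g e, parityE_proj g e, pairE_proj g e hS, pairE_proj g e hS, pairT_parityT g e]

theorem pairE_one (e : Module.Basis ι k V)
    (hS : Function.Bijective (HopfAlgebra.antipode k : A →ₗ[k] A)) (y : Λ) :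
    pairE g 1 y = counitE k A V y := by
  obtain ⟨y, rfl⟩ := proj_surjective y
  rw [← map_one π, pairE_proj g e hS, pairT_one, counitE_proj g e]

theorem pairE_act (e : Module.Basis ι k V)
    (hS : Function.Bijective (HopfAlgebra.antipode k : A →ₗ[k] A)) (x y : Λ) (a : A) :
    TensorProduct.lift (pairE g)
      (TensorProduct.map (actE k A V x) (actE k A V y) (comul a)) =
      pairE g x y * counit (R := k) a := by
  obtain ⟨x, rfl⟩ := proj_surjective x
  obtain ⟨y, rfl⟩ := proj_surjective y
  rw [pairE_proj g e hS, ← pairT_actT_actT g e hS]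
  generalize comul (R := k) a = w
  induction w using TensorProduct.induction_on with
  | zero => simp
  | add u v hu hv => simp only [map_add, hu, hv]
  | tmul b c => simp [actE_proj g e, pairE_proj g e hS]

theorem sum_pairE_act_coactCoeff
    (hS : Function.Bijective (HopfAlgebra.antipode k : A →ₗ[k] A)) (x y : Λ) (i j : ι) :
    ∑ l, pairE g (actE k A V x (coactCoeff A e i l)) (actE k A V y (coactCoeff A e l j)) =
      pairE g x y * if i = j then 1 else 0 := by
  have := pairE_act g e hS x y (coactCoeff A e i j)
  rw [comul_coactCoeff, counit_coactCoeff] at this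
  simpa using this

/-- The adjoint of `∂_i` with respect to the pairing. -/
def derivAdjoint (i : ι) (x : Λ) : Λ := ∑ m, g.coeff e i m • (x * incl k A V (e m))

theorem pairE_derivAdjoint
    (hS : Function.Bijective (HopfAlgebra.antipode k : A →ₗ[k] A)) (i : ι) (x y : Λ) :
    pairE g (derivAdjoint g e i x) y = pairE g x (derivE A e i y) := by
  obtain ⟨x, rfl⟩ := proj_surjective x
  obtain ⟨y, rfl⟩ := proj_surjective y
  have h : ∀ m, pairE g (π x * incl k A V (e m)) (π y) = pairT g x (metricDeriv g e m y) := by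
    intro m
    rw [incl, LinearMap.comp_apply, AlgHom.toLinearMap_apply, ← map_mul, pairE_proj g e hS,
      pairT_mul_ι]
  rw [derivE_proj g e, pairE_proj g e hS, deriv_eq_sum_metricDeriv g e, derivAdjoint]
  simp [h]

theorem pairT_degProj (e : Module.Basis ι k V) (n : ℕ) {x : T} (hx : x ∈ tensorDeg k V n) (y : T) :
    pairT g x y = pairT g x (degProj n y) := by
  induction hx using tensorDeg_induction_right generalizing y with
  | algebraMap r =>
    rw [Algebra.algebraMap_eq_smul_one, map_smul, LinearMap.smul_apply, LinearMap.smul_apply,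
      pairT_one, pairT_one, degProj_zero]
    simp
  | add n x x' _ _ hx hx' => rw [map_add, LinearMap.add_apply, LinearMap.add_apply, hx, hx']
  | mul n x v _ hx =>
    rw [← e.sum_repr v]
    simp only [Finset.mul_sum, map_sum, LinearMap.sum_apply, map_smul, mul_smul_comm,
      LinearMap.smul_apply, pairT_mul_ι]
    refine Finset.sum_congr rfl fun j _ => ?_
    rw [hx, metricDeriv_apply, metricDeriv_apply]
    simp only [map_sum, map_smul, deriv_degProj]

theorem pairE_degE (e : Module.Basis ι k V)
    (hS : Function.Bijective (HopfAlgebra.antipode k : A →ₗ[k] A)) (n : ℕ) (x y : Λ) :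
    pairE g (degE k A V n x) y = pairE g x (degE k A V n y) := by
  obtain ⟨x, rfl⟩ := proj_surjective x
  obtain ⟨y, rfl⟩ := proj_surjective y
  rw [degE_proj g e, degE_proj g e, pairE_proj g e hS, pairE_proj g e hS]
  induction x using homogeneous_induction with
  | add x x' hx hx' => simp only [map_add, LinearMap.add_apply, hx, hx']
  | h m x hx =>
    rw [degProj_of_mem hx, pairT_degProj g e m hx (degProj n y), degProj_of_mem (degProj_mem n y)]
    by_cases h : n = m
    · subst h; simp [← pairT_degProj g e n hx y]
    · simp [h, Ne.symm h]

variable [FiniteDimensional k (BExt k A V)]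

theorem antipodeE_one (g : Metric k A V) (e : Module.Basis ι k V)
    (hS : Function.Bijective (HopfAlgebra.antipode k : A →ₗ[k] A)) :
    antipodeE k A V 1 = 1 := by
  rw [← map_one π, antipodeE_proj g e hS, antipodeT_one]

theorem antipodeE_mem_extDeg (g : Metric k A V) (e : Module.Basis ι k V)
    (hS : Function.Bijective (HopfAlgebra.antipode k : A →ₗ[k] A)) {n : ℕ} {x : Λ}
    (hx : x ∈ extDeg k A V n) : antipodeE k A V x ∈ extDeg k A V n := by
  obtain ⟨x, hx, rfl⟩ := hx
  exact ⟨_, antipodeT_mem e hx, (antipodeE_proj g e hS x).symm⟩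

theorem antipodeE_mul_incl (g : Metric k A V) (e : Module.Basis ι k V)
    (hS : Function.Bijective (HopfAlgebra.antipode k : A →ₗ[k] A)) (x : Λ) (m : ι) :
    antipodeE k A V (x * incl k A V (e m)) = -∑ i, incl k A V (e i) *
      actE k A V (parityE k A V (antipodeE k A V x)) (coactCoeff A e i m) := by
  obtain ⟨x, rfl⟩ := proj_surjective x
  simp only [incl, LinearMap.comp_apply, AlgHom.toLinearMap_apply, ← map_mul,
    antipodeE_proj g e hS, antipodeT_mul_ι, parityE_proj g e, actE_proj g e, map_neg, map_sum]

theorem antipodeE_actE (g : Metric k A V) (e : Module.Basis ι k V)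
    (hS : Function.Bijective (HopfAlgebra.antipode k : A →ₗ[k] A)) (x : Λ) (a : A) :
    antipodeE k A V (actE k A V x a) = actE k A V (antipodeE k A V x) a := by
  obtain ⟨x, rfl⟩ := proj_surjective x
  simp only [antipodeE_proj g e hS, actE_proj g e, antipodeT_actT]

theorem antipodeE_parityE (g : Metric k A V) (e : Module.Basis ι k V)
    (hS : Function.Bijective (HopfAlgebra.antipode k : A →ₗ[k] A)) (x : Λ) :
    antipodeE k A V (parityE k A V x) = parityE k A V (antipodeE k A V x) := by
  obtain ⟨x, rfl⟩ := proj_surjective x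
  simp only [antipodeE_proj g e hS, parityE_proj g e, antipodeT_parityT]

end ExteriorStructure

/-! ### The Hodge star on the braided exterior algebra -/

section HodgeStar

variable {k A V ι : Type*} [Field k] [Ring A] [HopfAlgebra k A]
  [AddCommGroup V] [Module k V] [CrossedModule k A V] [Fintype ι] [DecidableEq ι]
  (H : HodgeData k A V) (e : Module.Basis ι k V)

local notation "T" => TensorAlgebra k V
local notation "Λ" => BExt k A V
local notation "π" => proj k A V
local notation "ιT" => TensorAlgebra.ι k (M := V)

namespace HodgeData

/-- A functional that does not vanish on Vol, precomposed with the projection to the top degree and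
normalised, meets the specification. -/
theorem integral_spec (e : Module.Basis ι k V) : H.integral H.topForm.vol = 1 ∧
    ∀ m, m ≠ H.deg → ∀ x ∈ extDeg k A V m, H.integral x = 0 := by
  have hvol : H.topForm.vol ∈ extDeg k A V H.deg := by
    rw [H.topForm.top_eq]; exact Submodule.mem_span_singleton_self _
  obtain ⟨φ, hφ⟩ : ∃ φ : Module.Dual k Λ, φ H.topForm.vol ≠ 0 := by
    by_contra! h
    exact H.topForm.vol_ne_zero ((Module.forall_dual_apply_eq_zero_iff k _).1 h)
  have : ∃ I : Λ →ₗ[k] k, I H.topForm.vol = 1 ∧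
      ∀ m, m ≠ H.deg → ∀ x ∈ extDeg k A V m, I x = 0 := by
    refine ⟨(φ H.topForm.vol)⁻¹ • (φ ∘ₗ degE k A V H.deg), ?_, fun m hm x hx => ?_⟩
    · simp [degE_of_mem H.metric e H.deg hvol, hφ]
    · simp [degE_of_mem H.metric e H.deg hx, hm.symm]
  exact Classical.epsilon_spec this

theorem integral_degE (e : Module.Basis ι k V) (x : Λ) :
    H.integral (degE k A V H.deg x) = H.integral x := by
  induction x using exterior_induction with
  | add x y hx hy => rw [map_add, map_add, hx, hy, map_add]
  | h m x hx =>
    rw [degE_of_mem H.metric e _ hx]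
    split_ifs with h
    · rfl
    · rw [map_zero, (H.integral_spec e).2 m (Ne.symm h) x hx]

theorem integral_actE (e : Module.Basis ι k V) (x : Λ) (a : A) :
    H.integral (actE k A V x a) = counit (R := k) a * H.integral x := by
  induction x using exterior_induction with
  | add x y hx hy => simp only [map_add, LinearMap.add_apply, hx, hy, mul_add]
  | h m x hx =>
    by_cases hm : m = H.deg
    · subst hm
      rw [H.topForm.top_eq, Submodule.mem_span_singleton] at hx
      obtain ⟨c, rfl⟩ := hx
      simp [H.topForm.central, mul_left_comm]
    · rw [(H.integral_spec e).2 m hm _ (actE_mem_extDeg H.metric e hx a),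
        (H.integral_spec e).2 m hm _ hx, mul_zero]

/-- A braided Stokes theorem: a top-degree value could come only from degree n + 1, which is zero.
-/
theorem integral_derivE (i : ι) (x : Λ) : H.integral (derivE A e i x) = 0 := by
  induction x using exterior_induction with
  | add x y hx hy => rw [map_add, map_add, hx, hy, add_zero]
  | h m x hx =>
    rcases m with _ | m
    · rw [derivE_mem_extDeg_zero H.metric e i hx, map_zero]
    · by_cases hm : m = H.deg
      · rw [H.topForm.top (m + 1) (by subst hm; exact Nat.lt_succ_self _), Submodule.mem_bot] at hx
        rw [hx, map_zero, map_zero]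
      · exact (H.integral_spec e).2 m hm _ (derivE_mem_extDeg H.metric e i hx)

theorem integral_parityE (e : Module.Basis ι k V) (x : Λ) :
    H.integral (parityE k A V x) = (-1 : k) ^ H.deg * H.integral x := by
  induction x using exterior_induction with
  | add x y hx hy => simp only [map_add, hx, hy, mul_add]
  | h m x hx =>
    rw [parityE_of_mem H.metric e hx, map_smul, smul_eq_mul]
    by_cases hm : m = H.deg
    · rw [hm]
    · rw [(H.integral_spec e).2 m hm _ hx, mul_zero, mul_zero]

theorem intE_apply_eq (hS : Function.Bijective (HopfAlgebra.antipode k : A →ₗ[k] A))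
    (l : ι) (x : T) : H.intE (e l) (π x) = π (metricDeriv H.metric e l x) := by
  change TensorProduct.lid k Λ
    ((pairE H.metric (π (ιT (e l)))).rTensor Λ (coprodE k A V (π x))) = _
  rw [coprodE_proj H.metric e hS, ← interior_ι, interior]
  generalize coprodT k A V x = w
  induction w using TensorProduct.induction_on with
  | zero => simp
  | add u v hu hv => simp only [map_add, hu, hv]
  | tmul m n => simp [pairE_proj H.metric e hS]

theorem intE_basis (hS : Function.Bijective (HopfAlgebra.antipode k : A →ₗ[k] A))
    (l : ι) (x : Λ) :
    H.intE (e l) x = ∑ i, H.metric.form (e l) (e i) • derivE A e i x := by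
  obtain ⟨x, rfl⟩ := proj_surjective x
  simp only [H.intE_apply_eq e hS, metricDeriv_apply, derivE_proj H.metric e, map_sum, map_smul]

variable [FiniteDimensional k (BExt k A V)]

theorem exp_spec (e : Module.Basis ι k V)
    (hS : Function.Bijective (HopfAlgebra.antipode k : A →ₗ[k] A)) :
    (∀ x, TensorProduct.lid k Λ ((pairE H.metric x).rTensor Λ H.exp) = x) ∧
      ∀ y, TensorProduct.rid k Λ (((pairE H.metric).flip y).lTensor Λ H.exp) = y := by
  have hinj : Function.Injective ((pairE H.metric).flip : Λ →ₗ[k] Module.Dual k Λ) := by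
    intro y z hyz
    have h0 : (pairE H.metric).flip (y - z) = 0 := by rw [map_sub, hyz, sub_self]
    exact eq_of_sub_eq_zero (pairE_nondegenerate H.metric e hS fun x => LinearMap.congr_fun h0 x)
  have hsurj : Function.Surjective ((pairE H.metric).flip : Λ →ₗ[k] Module.Dual k Λ) :=
    (LinearMap.injective_iff_surjective_of_finrank_eq_finrank
      Subspace.dual_finrank_eq.symm).1 hinj
  let b := Module.finBasis k Λ
  -- The family c is dual to the basis b for the pairing, so Σ c_i ⊗ b_i is the coevaluation; its
  -- second identity follows from the first by nondegeneracy.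
  choose c hc using fun i => hsurj (b.coord i)
  have hc' : ∀ i x, pairE H.metric x (c i) = b.coord i x := fun i x => LinearMap.congr_fun (hc i) x
  have : ∃ E : Λ ⊗[k] Λ, (∀ x, TensorProduct.lid k Λ ((pairE H.metric x).rTensor Λ E) = x) ∧
      ∀ y, TensorProduct.rid k Λ (((pairE H.metric).flip y).lTensor Λ E) = y := by
    have h1 : ∀ x, TensorProduct.lid k Λ ((pairE H.metric x).rTensor Λ (∑ i, c i ⊗ₜ b i)) = x := by
      intro x
      simp [hc', b.sum_repr]
    refine ⟨∑ i, c i ⊗ₜ b i, h1, fun y => eq_of_sub_eq_zero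
      (pairE_nondegenerate H.metric e hS fun x => ?_)⟩
    rw [map_sub, sub_eq_zero]
    conv_rhs => rw [← h1 x]
    simp [mul_comm]
  exact Classical.epsilon_spec this

theorem pairE_ext_left (e : Module.Basis ι k V)
    (hS : Function.Bijective (HopfAlgebra.antipode k : A →ₗ[k] A)) {x x' : Λ}
    (h : ∀ y, pairE H.metric x y = pairE H.metric x' y) : x = x' := by
  rw [← (H.exp_spec e hS).1 x, ← (H.exp_spec e hS).1 x', LinearMap.ext h]

/-- This characterises ♯, so that properties of the Hodge star reduce to properties of the integral
through `pairE_ext_left`. -/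
theorem pairE_sharp (e : Module.Basis ι k V)
    (hS : Function.Bijective (HopfAlgebra.antipode k : A →ₗ[k] A)) (x y : Λ) :
    pairE H.metric (H.sharp x) y = H.integral (x * y) := by
  conv_rhs => rw [← (H.exp_spec e hS).2 y]
  simp only [sharp, LinearMap.comp_apply, LinearMap.flip_apply, TensorProduct.mk_apply]
  generalize H.exp = w
  induction w using TensorProduct.induction_on with
  | zero => simp
  | add u v hu hv =>
    simp only [TensorProduct.tmul_add, map_add, LinearMap.add_apply, mul_add, hu, hv]
  | tmul m n => simp [mul_comm]

/-- Pairing and integral are both invariant, so with Δt_ij = Σ_l t_il ⊗ t_lj the two candidates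
agree against z ◁ t_lj summed over l. Inserting S⁻¹ of a coefficient in z isolates a single term. -/
theorem sharp_actE (hS : Function.Bijective (HopfAlgebra.antipode k : A →ₗ[k] A)) (x : Λ)
    (i j : ι) : H.sharp (actE k A V x (coactCoeff A e i j)) =
      actE k A V (H.sharp x) (coactCoeff A e i j) := by
  refine H.pairE_ext_left e hS fun y => ?_
  let S := LinearEquiv.ofBijective _ hS
  -- This is S⁻¹(a₂)a₁ = ε(a) for a = t_lm, obtained by applying S to both sides.
  have hSt : ∀ l m, ∑ r, S.symm (coactCoeff A e r m) * coactCoeff A e l r =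
      if l = m then 1 else 0 := by
    intro l m
    apply hS.1
    have h1 := HopfAlgebra.mul_antipode_rTensor_comul_apply (R := k) (coactCoeff A e l m)
    rw [comul_coactCoeff, counit_coactCoeff] at h1
    have h2 : ∀ x, HopfAlgebra.antipode k (S.symm x) = x := S.apply_symm_apply
    simp only [map_sum, HopfAlgebra.antipode_mul_antidistrib, h2]
    simpa [apply_ite (HopfAlgebra.antipode k : A → A), apply_ite (algebraMap k A)] using h1
  have hact : ∀ m, ∑ r, ∑ l, pairE H.metric (H.sharp (actE k A V x (coactCoeff A e i l)))
        (actE k A V (actE k A V y (S.symm (coactCoeff A e r m))) (coactCoeff A e l r)) =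
      ∑ r, ∑ l, pairE H.metric (actE k A V (H.sharp x) (coactCoeff A e i l))
        (actE k A V (actE k A V y (S.symm (coactCoeff A e r m))) (coactCoeff A e l r)) := by
    intro m
    refine Finset.sum_congr rfl fun r _ => ?_
    rw [sum_pairE_act_coactCoeff H.metric e hS, H.pairE_sharp e hS]
    simp only [H.pairE_sharp e hS]
    rw [← map_sum, ← actE_mul_coactCoeff H.metric e, H.integral_actE e, counit_coactCoeff,
      mul_comm]
  have hsum : ∀ (F : ι → Λ) (m : ι), ∑ r, ∑ l, pairE H.metric (F l)
        (actE k A V (actE k A V y (S.symm (coactCoeff A e r m))) (coactCoeff A e l r)) =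
      pairE H.metric (F m) y := by
    intro F m
    rw [Finset.sum_comm]
    simp only [← actE_act_mul H.metric e, ← map_sum, hSt]
    simp [apply_ite (actE k A V y), apply_ite, actE_act_one H.metric e, Finset.sum_ite_eq]
  rw [← hsum (fun l => H.sharp (actE k A V x (coactCoeff A e i l))), hact,
    hsum (fun l => actE k A V (H.sharp x) (coactCoeff A e i l))]

/-- Parity multiplies the integral by (-1)^n, because only degree n contributes. This is the source
of the sign (-1)^n in the codifferential. -/
theorem parityE_sharp_parityE (e : Module.Basis ι k V)
    (hS : Function.Bijective (HopfAlgebra.antipode k : A →ₗ[k] A)) (x : Λ) :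
    parityE k A V (H.sharp (parityE k A V x)) = (-1 : k) ^ H.deg • H.sharp x := by
  refine H.pairE_ext_left e hS fun y => ?_
  rw [pairE_parityE H.metric e hS, H.pairE_sharp e hS, ← parityE_mul H.metric e,
    H.integral_parityE e, map_smul, LinearMap.smul_apply, H.pairE_sharp e hS, smul_eq_mul]

/-- The product Vol · y sees only the scalar part of y, so its integral is the counit, that is, the
pairing with 1. -/
theorem sharp_vol (e : Module.Basis ι k V)
    (hS : Function.Bijective (HopfAlgebra.antipode k : A →ₗ[k] A)) :
    H.sharp H.topForm.vol = 1 := by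
  refine H.pairE_ext_left e hS fun y => ?_
  have hvol : H.topForm.vol ∈ extDeg k A V H.deg := by
    rw [H.topForm.top_eq]; exact Submodule.mem_span_singleton_self _
  rw [H.pairE_sharp e hS, pairE_one H.metric e hS]
  induction y using exterior_induction with
  | add x y hx hy => rw [mul_add, map_add, map_add, hx, hy]
  | h m y hy =>
    rcases m with _ | m
    · obtain ⟨c, rfl⟩ := mem_extDeg_zero hy
      rw [mul_smul_comm, mul_one, map_smul, map_smul, (H.integral_spec e).1, ← map_one π,
        counitE_proj H.metric e, map_one]
    · have h0 : H.topForm.vol * y = 0 := by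
        have := mul_mem_extDeg hvol hy
        rwa [H.topForm.top _ (by change H.topForm.degree < H.topForm.degree + _; omega), Submodule.mem_bot] at this
      obtain ⟨y, hy, rfl⟩ := hy
      rw [h0, map_zero, AlgHom.toLinearMap_apply, counitE_proj H.metric e,
        algebraMapInv_of_mem hy]

theorem sharp_one_mem (e : Module.Basis ι k V)
    (hS : Function.Bijective (HopfAlgebra.antipode k : A →ₗ[k] A)) :
    H.sharp 1 ∈ extDeg k A V H.deg := by
  have h : degE k A V H.deg (H.sharp 1) = H.sharp 1 := H.pairE_ext_left e hS fun y => by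
    rw [pairE_degE H.metric e hS, H.pairE_sharp e hS, H.pairE_sharp e hS, one_mul, one_mul,
      H.integral_degE e]
  obtain ⟨y, hy⟩ := proj_surjective (k := k) (A := A) (H.sharp 1)
  rw [← h, ← hy, degE_proj H.metric e]
  exact proj_mem_extDeg (degProj_mem _ _)

/-- Integration by parts: ∫∂_i(xy) = 0 and the Leibniz rule put the derivation on y, from where it
returns as an adjoint acting on ♯ of the twisted x. -/
theorem sharp_derivE (hS : Function.Bijective (HopfAlgebra.antipode k : A →ₗ[k] A)) (i : ι)
    (x : Λ) : H.sharp (derivE A e i x) = -∑ j, derivAdjoint H.metric e j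
      (actE k A V (H.sharp (parityE k A V x)) (coactCoeff A e i j)) := by
  refine H.pairE_ext_left e hS fun y => ?_
  have h := H.integral_derivE e i (x * y)
  rw [derivE_mul H.metric e, map_add, map_sum, ← eq_neg_iff_add_eq_zero] at h
  rw [H.pairE_sharp e hS, h, map_neg, map_sum, LinearMap.neg_apply, LinearMap.sum_apply]
  simp only [pairE_derivAdjoint H.metric e hS, ← H.sharp_actE e hS, H.pairE_sharp e hS]

theorem antipodeE_sharp_derivE (hS : Function.Bijective (HopfAlgebra.antipode k : A →ₗ[k] A))
    (i : ι) (x : Λ) : antipodeE k A V (H.sharp (derivE A e i x)) = (-1 : k) ^ H.deg •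
      ∑ r, H.metric.coeff e i r • (incl k A V (e r) * antipodeE k A V (H.sharp x)) := by
  have hpar : ∀ j, parityE k A V (antipodeE k A V
      (actE k A V (H.sharp (parityE k A V x)) (coactCoeff A e i j))) =
      (-1 : k) ^ H.deg • actE k A V (antipodeE k A V (H.sharp x)) (coactCoeff A e i j) := by
    intro j
    rw [antipodeE_actE H.metric e hS, parityE_actE H.metric e, ← antipodeE_parityE H.metric e hS,
      H.parityE_sharp_parityE e hS, map_smul, map_smul, LinearMap.smul_apply]
  have hadj : ∀ j, antipodeE k A V (derivAdjoint H.metric e j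
      (actE k A V (H.sharp (parityE k A V x)) (coactCoeff A e i j))) =
      -∑ m, ∑ r, (-1 : k) ^ H.deg • (incl k A V (e r) * actE k A V (antipodeE k A V (H.sharp x))
        (H.metric.coeff e j m • (coactCoeff A e i j * coactCoeff A e r m))) := by
    intro j
    rw [derivAdjoint, map_sum, ← Finset.sum_neg_distrib]
    refine Finset.sum_congr rfl fun m _ => ?_
    rw [map_smul, antipodeE_mul_incl H.metric e hS, hpar, smul_neg, Finset.smul_sum]
    refine congrArg _ (Finset.sum_congr rfl fun r _ => ?_)
    rw [map_smul, map_smul, LinearMap.smul_apply, actE_act_mul H.metric e, mul_smul_comm,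
      mul_smul_comm, smul_comm]
  rw [H.sharp_derivE e hS, map_neg, map_sum]
  simp only [hadj]
  -- The sign of integration by parts cancels that of the antipode. For fixed r, the sum over j and
  -- m of g^{jm} t_ij t_rm is g^{ir} by coinvariance of the metric.
  rw [Finset.sum_neg_distrib, neg_neg, Finset.smul_sum, Finset.sum_comm_cycle]
  refine Finset.sum_congr rfl fun r _ => ?_
  simp only [← Finset.smul_sum, ← Finset.mul_sum, ← map_sum]
  rw [H.metric.sum_coactCoeff_mul, map_smul, actE_act_one H.metric e,
    mul_smul_comm]

/-- Up to sign, `S♯` intertwines interior and exterior products. -/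
theorem antipodeE_sharp_intE (e : Module.Basis ι k V)
    (hS : Function.Bijective (HopfAlgebra.antipode k : A →ₗ[k] A)) (v : V) (x : Λ) :
    antipodeE k A V (H.sharp (H.intE v x)) =
      (-1 : k) ^ H.deg • (incl k A V v * antipodeE k A V (H.sharp x)) := by
  suffices h : (antipodeE k A V ∘ₗ H.sharp) ∘ₗ H.intE.flip x = (-1 : k) ^ H.deg •
      (LinearMap.mulRight k (antipodeE k A V (H.sharp x)) ∘ₗ incl k A V) from
    LinearMap.congr_fun h v
  -- On a basis vector the interior product is Σ_i g_li ∂_i, and Σ_i g_li g^{ir} = δ_lr leaves left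
  -- multiplication by e_l.
  refine e.ext fun l => ?_
  simp only [LinearMap.comp_apply, LinearMap.flip_apply, LinearMap.smul_apply,
    LinearMap.mulRight_apply]
  rw [H.intE_basis e hS]
  simp only [map_sum, map_smul, H.antipodeE_sharp_derivE e hS, Finset.smul_sum]
  rw [Finset.sum_comm]
  have h : ∀ r i, H.metric.form (e l) (e i) • (-1 : k) ^ H.deg • H.metric.coeff e i r •
      (incl k A V (e r) * antipodeE k A V (H.sharp x)) = (H.metric.form (e l) (e i) *
        H.metric.coeff e i r) • (-1 : k) ^ H.deg •
          (incl k A V (e r) * antipodeE k A V (H.sharp x)) := by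
    intro r i; simp only [smul_smul]; congr 1; ring
  simp only [h, ← Finset.sum_smul, H.metric.sum_form_coeff]
  simp

/-- The image contains 1 = S♯Vol and, by the intertwining identity, is stable under left
multiplication by generators, so it is all of Λ. Finite dimension gives injectivity. -/
theorem antipodeE_sharp_bijective (e : Module.Basis ι k V)
    (hS : Function.Bijective (HopfAlgebra.antipode k : A →ₗ[k] A)) :
    Function.Bijective (antipodeE k A V ∘ₗ H.sharp : Λ →ₗ[k] Λ) := by
  have hsurj : Function.Surjective (antipodeE k A V ∘ₗ H.sharp : Λ →ₗ[k] Λ) := by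
    intro y
    obtain ⟨y, rfl⟩ := proj_surjective y
    induction y using tensorAlgebra_induction_left e with
    | one => exact ⟨H.topForm.vol, by
        rw [LinearMap.comp_apply, H.sharp_vol e hS, antipodeE_one H.metric e hS, map_one]⟩
    | add x y hx hy =>
      obtain ⟨x', hx⟩ := hx
      obtain ⟨y', hy⟩ := hy
      exact ⟨x' + y', by rw [map_add, map_add, hx, hy]⟩
    | smul c x hx =>
      obtain ⟨x', hx⟩ := hx
      exact ⟨c • x', by rw [map_smul, map_smul, hx]⟩
    | mul x j hx =>
      obtain ⟨x', hx⟩ := hx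
      refine ⟨(-1 : k) ^ H.deg • H.intE (e j) x', ?_⟩
      rw [map_smul, LinearMap.comp_apply, H.antipodeE_sharp_intE e hS, smul_smul, ← mul_pow,
        neg_one_mul, neg_neg, one_pow, one_smul, map_mul, ← hx]
      rfl
  exact ⟨LinearMap.injective_iff_surjective.2 hsurj, hsurj⟩

end HodgeData

end HodgeStar

/-! ### The exterior algebra `Ω` -/

section ExteriorAlgebra

variable {k A V ι : Type*} [Field k] [Ring A] [HopfAlgebra k A]
  [AddCommGroup V] [Module k V] [CrossedModule k A V]

local notation "Λ" => BExt k A V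
local notation "Ω" => Omega k A V

theorem smash_tmul {X : Type*} [AddCommGroup X] [Module k X] (r : X →ₗ[k] A →ₗ[k] X)
    (β : X →ₗ[k] Λ →ₗ[k] Λ) (a b : A) (x : X) (y : Λ) :
    smash r β (a ⊗ₜ x) (b ⊗ₜ y) =
      TensorProduct.map (mulLeft k a) (β.flip y ∘ₗ r x) (comul b) := by
  simp only [smash, TensorProduct.lift.tmul, LinearMap.mk₂_apply, LinearMap.comp_apply,
    LinearMap.rTensor_tmul]
  generalize comul (R := k) b = w
  induction w using TensorProduct.induction_on with
  | zero => simp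
  | add u v hu hv => simp only [TensorProduct.add_tmul, map_add, hu, hv]
  | tmul b c => simp

theorem smash_smul {X : Type*} [AddCommGroup X] [Module k X] (r : X →ₗ[k] A →ₗ[k] X)
    (β : X →ₗ[k] Λ →ₗ[k] Λ) (f : A) (η : A ⊗[k] X) (ω : Ω) :
    smash r β (f • η) ω = f • smash r β η ω := by
  induction η using TensorProduct.induction_on with
  | zero => simp
  | add u v hu hv => simp only [smul_add, map_add, LinearMap.add_apply, hu, hv]
  | tmul a x =>
    induction ω using TensorProduct.induction_on with
    | zero => simp
    | add u v hu hv => simp only [smul_add, map_add, hu, hv]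
    | tmul b y =>
      rw [TensorProduct.smul_tmul', smash_tmul, smash_tmul]
      generalize comul (R := k) b = w
      induction w using TensorProduct.induction_on with
      | zero => simp
      | add u v hu hv => simp only [map_add, smul_add, hu, hv]
      | tmul b c => simp [TensorProduct.smul_tmul', mul_assoc]

theorem mulO_smul (f : A) (η ω : Ω) : mulO k A V (f • η) ω = f • mulO k A V η ω :=
  smash_smul _ _ f η ω

theorem ofOne_smul (f : A) (η : A ⊗[k] V) : ofOne k A V (f • η) = f • ofOne k A V η := by
  induction η using TensorProduct.induction_on with
  | zero => simp
  | add u v hu hv => simp only [smul_add, map_add, hu, hv]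
  | tmul a x => simp [ofOne, TensorProduct.smul_tmul']

theorem smul_fn (f g : A) : f • fn A V (k := k) g = fn A V (f * g) := by
  simp [fn, TensorProduct.smul_tmul']

theorem lTensor_smul_left {M N : Type*} [AddCommMonoid M] [Module k M] [AddCommMonoid N]
    [Module k N] (φ : M →ₗ[k] N) (f : A) (x : A ⊗[k] M) :
    φ.lTensor A (f • x) = f • φ.lTensor A x := by
  induction x using TensorProduct.induction_on with
  | zero => simp
  | add u v hu hv => simp only [smul_add, map_add, hu, hv]
  | tmul a x => simp [TensorProduct.smul_tmul']

variable [Fintype ι] [DecidableEq ι]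

theorem mulO_ofOne_tmul (g : Metric k A V) (e : Module.Basis ι k V) (a b : A) (v : V) (y : Λ) :
    mulO k A V (ofOne k A V (a ⊗ₜ v)) (b ⊗ₜ y) = TensorProduct.map (mulLeft k a)
      (mulRight k y ∘ₗ incl k A V ∘ₗ CrossedModule.act (k := k) (A := A) v) (comul b) := by
  rw [mulO, ofOne, LinearMap.lTensor_tmul, smash_tmul]
  congr 2
  ext a
  simp [actE_incl g e]

theorem fn_one_mulO (g : Metric k A V) (e : Module.Basis ι k V) (ω : Ω) :
    mulO k A V (fn A V 1) ω = ω := by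
  induction ω using TensorProduct.induction_on with
  | zero => simp
  | add u v hu hv => simp only [map_add, hu, hv]
  | tmul b y =>
    rw [mulO, fn, smash_tmul]
    have h : ∀ w : A ⊗[k] A, TensorProduct.map (mulLeft k (1 : A))
        ((LinearMap.mul k Λ).flip y ∘ₗ actE k A V 1) w =
        TensorProduct.rid k A ((counit (R := k)).lTensor A w) ⊗ₜ y := by
      intro w
      induction w using TensorProduct.induction_on with
      | zero => simp
      | add u v hu hv => simp only [map_add, TensorProduct.add_tmul, hu, hv]
      | tmul b c => simp [actE_one g e, TensorProduct.smul_tmul]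
    rw [h, Coalgebra.lTensor_counit_comul]
    simp

theorem fn_mulO (g : Metric k A V) (e : Module.Basis ι k V) (f : A) (ω : Ω) :
    mulO k A V (fn A V f) ω = f • ω := by
  rw [← mul_one f, ← smul_fn, mulO_smul, fn_one_mulO g e, mul_one]

theorem sum_coord_tmul (e : Module.Basis ι k V) (x : A ⊗[k] V) :
    x = ∑ a, TensorProduct.rid k A ((e.coord a).lTensor A x) ⊗ₜ e a := by
  induction x using TensorProduct.induction_on with
  | zero => simp
  | add u v hu hv =>
    simp only [map_add, TensorProduct.add_tmul, Finset.sum_add_distrib, ← hu, ← hv]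
  | tmul b v =>
    conv_lhs => rw [← e.sum_repr v, TensorProduct.tmul_sum]
    simp [TensorProduct.smul_tmul]

end ExteriorAlgebra

namespace HodgeData

variable {k A V ι : Type*} [Field k] [Ring A] [HopfAlgebra k A]
  [AddCommGroup V] [Module k V] [CrossedModule k A V] (H : HodgeData k A V)

local notation "Λ" => BExt k A V
local notation "Ω" => Omega k A V

/-! ### The exterior derivative -/

/-- These facts hold for every element of the subtype from which `dE` is chosen, whatever the
choice. -/
theorem dE_one : H.dE 1 = 0 := (Subtype.property (p := fun d : Module.End k Λ =>
  d 1 = 0 ∧ ∀ n, ∀ x ∈ extDeg k A V n, d x ∈ extDeg k A V (n + 1)) _).1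

theorem dE_mem {n : ℕ} {x : Λ} (hx : x ∈ extDeg k A V n) : H.dE x ∈ extDeg k A V (n + 1) :=
  (Subtype.property (p := fun d : Module.End k Λ =>
    d 1 = 0 ∧ ∀ n, ∀ x ∈ extDeg k A V n, d x ∈ extDeg k A V (n + 1)) _).2 n x hx

theorem coe_piEps (a : A) :
    ((piEps k A a : Augmentation k A) : A) = a - algebraMap k A (counit (R := k) a) := rfl

theorem piEps_one : piEps k A 1 = 0 := by
  ext; simp [coe_piEps]

/-- Since fa - ε(fa) = (f - ε(f))a + ε(f)(a - ε(a)) and ϖ is a right module map, ϖπ_ε is a cocycle.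
This is the Leibniz rule of d on A before the coproduct is applied. -/
theorem varpi_piEps_mul (f a : A) :
    H.calculus.varpi (piEps k A (f * a)) =
      CrossedModule.act (k := k) (A := A) (H.calculus.varpi (piEps k A f)) a +
        counit (R := k) f • H.calculus.varpi (piEps k A a) := by
  rw [← H.calculus.map_act]
  have : ((piEps k A f : Augmentation k A) : A) = f - counit (R := k) f • (1 : A) := by
    rw [coe_piEps, Algebra.algebraMap_eq_smul_one]
  rw [this, sub_mul, smul_mul_assoc, one_mul, map_sub, map_sub, map_smul, map_smul,
    sub_add_cancel]

theorem dFn_one : H.dFn 1 = 0 := by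
  simp [dFn, Bialgebra.comul_one, Algebra.TensorProduct.one_def, piEps_one]

theorem d_tmul (a : A) (η : Λ) : H.d (a ⊗ₜ η) =
    mulO k A V (ofOne k A V (H.dFn a)) (1 ⊗ₜ[k] η) + a ⊗ₜ[k] H.dE η := rfl

variable [Fintype ι] [DecidableEq ι] (e : Module.Basis ι k V)

theorem d_smul (e : Module.Basis ι k V) (f : A) (ω : Ω) :
    H.d (f • ω) = mulO k A V (ofOne k A V (H.dFn f)) ω + f • H.d ω := by
  induction ω using TensorProduct.induction_on with
  | zero => simp
  | add u v hu hv => simp only [smul_add, map_add, hu, hv]; abel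
  | tmul a η =>
    -- Here w stands for Δf. The cocycle property splits each term: the acted part forms (df)(aη),
    -- and the counit part restores f in front of (da)η.
    have key : ∀ w : A ⊗[k] A,
        mulO k A V (ofOne k A V
          ((H.calculus.varpi ∘ₗ piEps k A).lTensor A (w * comul a))) (1 ⊗ₜ η) =
        mulO k A V (ofOne k A V ((H.calculus.varpi ∘ₗ piEps k A).lTensor A w)) (a ⊗ₜ η) +
        TensorProduct.rid k A ((counit (R := k)).lTensor A w) •
          mulO k A V (ofOne k A V
            ((H.calculus.varpi ∘ₗ piEps k A).lTensor A (comul a))) (1 ⊗ₜ η) := by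
      intro w
      induction w using TensorProduct.induction_on with
      | zero => simp
      | add u v hu hv =>
        simp only [add_mul, map_add, LinearMap.add_apply, hu, hv, add_smul]; abel
      | tmul b c =>
        rw [LinearMap.lTensor_tmul, mulO_ofOne_tmul H.metric e b a]
        generalize comul (R := k) a = z
        induction z using TensorProduct.induction_on with
        | zero => simp
        | add u v hu hv =>
          simp only [mul_add, map_add, LinearMap.add_apply, hu, hv, smul_add]; abel
        | tmul p q =>
          simp only [Algebra.TensorProduct.tmul_mul_tmul, LinearMap.lTensor_tmul,
            mulO_ofOne_tmul H.metric e, Bialgebra.comul_one, Algebra.TensorProduct.one_def,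
            TensorProduct.map_tmul, LinearMap.comp_apply, LinearMap.mulLeft_apply,
            LinearMap.mulRight_apply, CrossedModule.act_one, H.varpi_piEps_mul, mul_one,
            map_add, map_smul, LinearMap.add_apply, add_mul, TensorProduct.tmul_add, TensorProduct.rid_tmul,
            TensorProduct.smul_tmul', smul_mul_assoc, smul_eq_mul, TensorProduct.tmul_smul]
    have h1 := key (comul f)
    rw [← Bialgebra.comul_mul, Coalgebra.lTensor_counit_comul, TensorProduct.rid_tmul,
      one_smul] at h1
    rw [TensorProduct.smul_tmul', smul_eq_mul, d_tmul, d_tmul, smul_add,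
      TensorProduct.smul_tmul', smul_eq_mul, ← add_assoc]
    exact congrArg (· + _) h1

theorem d_fn (e : Module.Basis ι k V) (f : A) : H.d (fn A V f) = ofOne k A V (H.dFn f) := by
  rw [fn, d_tmul, dE_one, TensorProduct.tmul_zero, add_zero]
  generalize H.dFn f = η
  induction η using TensorProduct.induction_on with
  | zero => simp
  | add u v hu hv => simp only [map_add, LinearMap.add_apply, hu, hv]
  | tmul b v =>
    rw [mulO_ofOne_tmul H.metric e, Bialgebra.comul_one, Algebra.TensorProduct.one_def]
    simp [CrossedModule.act_one, ofOne]

theorem dFn_eq_sum (f : A) : H.dFn f = ∑ a, H.partialDeriv e a f • (1 : A) ⊗ₜ[k] e a := by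
  simpa [TensorProduct.smul_tmul', partialDeriv] using sum_coord_tmul e (H.dFn f)

theorem ofOne_dFn_eq_sum (f : A) :
    ofOne k A V (H.dFn f) = ∑ a, H.partialDeriv e a f • H.form (e a) := by
  conv_lhs => rw [H.dFn_eq_sum e f]
  simp only [map_sum, ofOne_smul]
  rfl

theorem intO_smul (f : A) (η : A ⊗[k] V) (ω : Ω) : H.intO (f • η) ω = f • H.intO η ω :=
  smash_smul _ _ f η ω

theorem intO_dFn (f : A) (ω : Ω) :
    H.intO (H.dFn f) ω = ∑ a, H.partialDeriv e a f • H.intO (1 ⊗ₜ[k] e a) ω := by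
  conv_lhs => rw [H.dFn_eq_sum e f]
  simp only [map_sum, LinearMap.sum_apply, intO_smul]

theorem intO_one_tmul (v : V) (ω : Λ) : H.intO (1 ⊗ₜ v) (1 ⊗ₜ ω) = 1 ⊗ₜ H.intE v ω := by
  rw [intO, smash_tmul, Bialgebra.comul_one, Algebra.TensorProduct.one_def, TensorProduct.map_tmul]
  simp [CrossedModule.act_one]

theorem intE_incl (hS : Function.Bijective (HopfAlgebra.antipode k : A →ₗ[k] A)) (a b : ι) :
    H.intE (e a) (incl k A V (e b)) = H.metric.form (e a) (e b) • 1 := by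
  have h : ∀ i, derivE A e i (incl k A V (e b)) = if i = b then 1 else 0 := by
    intro i
    have := derivE_proj H.metric e i (TensorAlgebra.ι k (e b))
    rw [← one_mul (TensorAlgebra.ι k (e b)), deriv_mul_ι] at this
    rw [one_mul] at this
    refine this.trans ?_
    simp only [deriv_one, zero_mul, map_one, actT_one, counit_coactCoeff, zero_add]
    split_ifs <;> simp
  simp [H.intE_basis e hS, h]

theorem intE_one (e : Module.Basis ι k V)
    (hS : Function.Bijective (HopfAlgebra.antipode k : A →ₗ[k] A)) (v : V) :
    H.intE v 1 = 0 := by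
  have : H.intE.flip 1 = 0 := e.ext fun l => by
    simp [H.intE_basis e hS, derivE_mem_extDeg_zero H.metric e _ one_mem_extDeg]
  exact LinearMap.congr_fun this v

theorem intO_form (hS : Function.Bijective (HopfAlgebra.antipode k : A →ₗ[k] A)) (a b : ι) :
    H.intO (1 ⊗ₜ e a) (H.form (e b)) = H.metric.form (e a) (e b) • fn A V 1 := by
  rw [form, ofOne, LinearMap.lTensor_tmul, intO_one_tmul, H.intE_incl e hS,
    TensorProduct.tmul_smul, fn]

theorem intO_dFn_form (hS : Function.Bijective (HopfAlgebra.antipode k : A →ₗ[k] A)) (f : A)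
    (b : ι) : H.intO (H.dFn f) (H.form (e b)) =
      ∑ a, H.metric.form (e a) (e b) • fn A V (H.partialDeriv e a f) := by
  rw [H.intO_dFn e]
  refine Finset.sum_congr rfl fun a _ => ?_
  rw [H.intO_form e hS, smul_comm, smul_fn, mul_one]

end HodgeData

/-! ### The codifferential and the Hodge Laplacian -/

namespace HodgeData

variable {k A V ι : Type*} [Field k] [Ring A] [HopfAlgebra k A]
  [AddCommGroup V] [Module k V] [CrossedModule k A V] (H : HodgeData k A V)
  [Fintype ι] [DecidableEq ι] (e : Module.Basis ι k V)

local notation "Λ" => BExt k A V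
local notation "Ω" => Omega k A V

theorem antipodeSharp_eq_lTensor :
    H.antipodeSharp = (antipodeE k A V ∘ₗ H.sharp).lTensor A :=
  (LinearMap.lTensor_comp _ _ _).symm

theorem antipodeSharp_tmul (a : A) (x : Λ) :
    H.antipodeSharp (a ⊗ₜ x) = a ⊗ₜ antipodeE k A V (H.sharp x) := rfl

theorem antipodeSharp_smul (f : A) (ω : Ω) : H.antipodeSharp (f • ω) = f • H.antipodeSharp ω := by
  rw [antipodeSharp_eq_lTensor, lTensor_smul_left]

variable [FiniteDimensional k (BExt k A V)]

theorem isUnit_antipodeSharp (e : Module.Basis ι k V)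
    (hS : Function.Bijective (HopfAlgebra.antipode k : A →ₗ[k] A)) : IsUnit H.antipodeSharp := by
  rw [Module.End.isUnit_iff, antipodeSharp_eq_lTensor]
  exact ((LinearEquiv.ofBijective _ (H.antipodeE_sharp_bijective e hS)).lTensor A).bijective

/-- Both ⊢ and the product on Ω come from `smash`, which moves a function past a one-form by the
same action on V. The identity on Λ therefore extends. -/
theorem antipodeSharp_intO (e : Module.Basis ι k V)
    (hS : Function.Bijective (HopfAlgebra.antipode k : A →ₗ[k] A)) (η : A ⊗[k] V) (ω : Ω) :
    H.antipodeSharp (H.intO η ω) =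
      (-1 : k) ^ H.deg • mulO k A V (ofOne k A V η) (H.antipodeSharp ω) := by
  induction η using TensorProduct.induction_on with
  | zero => simp
  | add u v hu hv => simp only [map_add, LinearMap.add_apply, hu, hv, smul_add]
  | tmul a v =>
    induction ω using TensorProduct.induction_on with
    | zero => simp
    | add u v hu hv => simp only [map_add, hu, hv, smul_add]
    | tmul b y =>
      rw [antipodeSharp_tmul, mulO_ofOne_tmul H.metric e, intO, smash_tmul]
      generalize comul (R := k) b = w
      induction w using TensorProduct.induction_on with
      | zero => simp
      | add u v hu hv => simp only [map_add, hu, hv, smul_add]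
      | tmul p q =>
        simp [antipodeSharp_tmul, H.antipodeE_sharp_intE e hS]

theorem antipodeSharp_codiff (e : Module.Basis ι k V)
    (hS : Function.Bijective (HopfAlgebra.antipode k : A →ₗ[k] A)) (ω : Ω) :
    H.antipodeSharp (H.codiff ω) = H.d (H.antipodeSharp ω) := by
  have h : H.antipodeSharp * H.codiff = H.d * H.antipodeSharp := by
    rw [codiff, mul_assoc, Ring.mul_inverse_cancel_left _ _ (H.isUnit_antipodeSharp e hS)]
  exact LinearMap.congr_fun h ω

theorem antipodeSharp_injective (e : Module.Basis ι k V)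
    (hS : Function.Bijective (HopfAlgebra.antipode k : A →ₗ[k] A)) :
    Function.Injective H.antipodeSharp :=
  ((Module.End.isUnit_iff _).1 (H.isUnit_antipodeSharp e hS)).1

/-- After applying the injective S♯, this is the Leibniz rule d(f S♯ω) = (df)S♯ω + f d S♯ω, with
(df)S♯ω = (-1)^n S♯(df ⊢ ω). -/
theorem codiff_smul (e : Module.Basis ι k V)
    (hS : Function.Bijective (HopfAlgebra.antipode k : A →ₗ[k] A)) (f : A) (ω : Ω) :
    H.codiff (f • ω) = f • H.codiff ω + (-1 : k) ^ H.deg • H.intO (H.dFn f) ω := by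
  apply H.antipodeSharp_injective e hS
  rw [H.antipodeSharp_codiff e hS, antipodeSharp_smul, H.d_smul e, map_add, antipodeSharp_smul,
    H.antipodeSharp_codiff e hS, map_smul, H.antipodeSharp_intO e hS, smul_smul, ← mul_pow,
    neg_one_mul, neg_neg, one_pow, one_smul, add_comm]

/-- S♯1 lies in the top degree, so its differential is zero and δ1 = 0; interior products kill 1, so
the Leibniz rule extends the vanishing to all functions. -/
theorem codiff_fn (e : Module.Basis ι k V)
    (hS : Function.Bijective (HopfAlgebra.antipode k : A →ₗ[k] A)) (f : A) :
    H.codiff (fn A V f) = 0 := by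
  have h1 : H.codiff (fn A V 1) = 0 := by
    apply H.antipodeSharp_injective e hS
    have h0 : H.dE (antipodeE k A V (H.sharp 1)) = 0 := by
      have := H.dE_mem (antipodeE_mem_extDeg H.metric e hS (H.sharp_one_mem e hS))
      rwa [H.topForm.top _ (Nat.lt_succ_self _), Submodule.mem_bot] at this
    rw [H.antipodeSharp_codiff e hS, fn, antipodeSharp_tmul, d_tmul, dFn_one, h0]
    simp
  have h2 : ∀ η : A ⊗[k] V, H.intO η (fn A V 1) = 0 := by
    intro η
    induction η using TensorProduct.induction_on with
    | zero => simp
    | add u v hu hv => rw [map_add, LinearMap.add_apply, hu, hv, add_zero]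
    | tmul a v =>
      rw [← mul_one a, ← smul_eq_mul, ← TensorProduct.smul_tmul', intO_smul, fn, intO_one_tmul,
        H.intE_one e hS, TensorProduct.tmul_zero, smul_zero]
  rw [← mul_one f, ← smul_fn, H.codiff_smul e hS, h1, h2, smul_zero, smul_zero, add_zero]

/-! ### The Laplacian on products and in coordinates -/

theorem box_fn_eq (e : Module.Basis ι k V)
    (hS : Function.Bijective (HopfAlgebra.antipode k : A →ₗ[k] A)) (f : A) :
    H.box (fn A V f) = H.codiff (H.d (fn A V f)) := by
  change H.d (H.codiff (fn A V f)) + H.codiff (H.d (fn A V f)) = _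
  rw [H.codiff_fn e hS, map_zero, zero_add]

theorem leibnizator_one (ω η : Ω) : H.leibnizator 1 ω η =
    H.codiff (mulO k A V ω η) - mulO k A V (H.codiff ω) η + mulO k A V ω (H.codiff η) := by
  have h : ∀ z : Ω, ((-1 : k) ^ 1) • z = -z := fun z => by
    rw [pow_one]; exact (neg_smul (1 : k) z).trans (congrArg _ (one_smul k z))
  rw [leibnizator, h, sub_neg_eq_add]

/-- In dδ(fω) + δd(fω), the terms δ((df)ω) and (df)δω form the Leibnizator plus (δdf)ω, and the two
interior product terms form the Lie derivative. Finally δf = 0 identifies δdf with □f. -/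
theorem box_smul (e : Module.Basis ι k V)
    (hS : Function.Bijective (HopfAlgebra.antipode k : A →ₗ[k] A)) (f : A) (ω : Ω) :
    H.box (f • ω) = mulO k A V (H.box (fn A V f)) ω + f • H.box ω
      + H.leibnizator 1 (H.d (fn A V f)) ω + (-1 : k) ^ H.deg • H.lie (H.dFn f) ω := by
  rw [H.box_fn_eq e hS]
  change H.d (H.codiff (f • ω)) + H.codiff (H.d (f • ω)) = _ +
    f • (H.d (H.codiff ω) + H.codiff (H.d ω)) + _ + _
  rw [H.codiff_smul e hS, H.d_smul e, map_add, map_add, H.d_smul e, H.codiff_smul e hS, map_smul,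
    leibnizator_one, lie, H.d_fn e, smul_add, smul_add]
  abel

theorem codiff_sum_smul_form
    (hS : Function.Bijective (HopfAlgebra.antipode k : A →ₗ[k] A)) (α : ι → A) :
    H.codiff (∑ a, α a • H.form (e a)) =
      ∑ a, α a • H.codiff (H.form (e a)) + (-1 : k) ^ H.deg • ∑ a, ∑ b,
        H.metric.form (e a) (e b) • fn A V (H.partialDeriv e a (α b)) := by
  rw [map_sum, Finset.sum_comm (γ := ι), Finset.smul_sum, ← Finset.sum_add_distrib]
  refine Finset.sum_congr rfl fun c _ => ?_
  rw [H.codiff_smul e hS, H.intO_dFn_form e hS]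

/-- The Leibnizator fails to be A-linear only through its two δ terms in which f is differentiated,
which give df ⊢ (e_b e_c) and -(df ⊢ e_b)e_c. -/
theorem leibnizator_smul_form
    (hS : Function.Bijective (HopfAlgebra.antipode k : A →ₗ[k] A)) (f : A) (b c : ι) :
    H.leibnizator 1 (f • H.form (e b)) (H.form (e c)) =
      f • H.leibnizator 1 (H.form (e b)) (H.form (e c)) + (-1 : k) ^ H.deg • ∑ a,
        H.partialDeriv e a f • (H.intO (1 ⊗ₜ e a) (mulO k A V (H.form (e b)) (H.form (e c)))
          - H.metric.form (e a) (e b) • H.form (e c)) := by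
  have h : mulO k A V (H.intO (H.dFn f) (H.form (e b))) (H.form (e c)) =
      ∑ a, H.partialDeriv e a f • H.metric.form (e a) (e b) • H.form (e c) := by
    rw [H.intO_dFn_form e hS, map_sum, LinearMap.sum_apply]
    refine Finset.sum_congr rfl fun a _ => ?_
    rw [map_smul, LinearMap.smul_apply, fn_mulO H.metric e, smul_comm]
  simp only [smul_sub, Finset.sum_sub_distrib]
  rw [← h, ← H.intO_dFn e, leibnizator_one, leibnizator_one, mulO_smul, mulO_smul, H.codiff_smul e hS,
    H.codiff_smul e hS, map_add, LinearMap.add_apply, mulO_smul, map_smul, LinearMap.smul_apply]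
  simp only [smul_sub, smul_add]
  abel

/-- As e_b ⊢ e_c is the constant g_bc, the only correction is d(f g_bc) = g_bc df. -/
theorem lie_smul_form
    (hS : Function.Bijective (HopfAlgebra.antipode k : A →ₗ[k] A)) (f : A) (b c : ι) :
    H.lie (f • (1 ⊗ₜ e b)) (H.form (e c)) =
      f • H.lie (1 ⊗ₜ e b) (H.form (e c)) +
        ∑ a, H.partialDeriv e a f • H.metric.form (e b) (e c) • H.form (e a) := by
  have h1 : H.d (fn A V 1) = 0 := by rw [H.d_fn e, dFn_one, map_zero]
  have h2 : ∑ a, H.partialDeriv e a f • H.metric.form (e b) (e c) • H.form (e a) =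
      H.metric.form (e b) (e c) • ofOne k A V (H.dFn f) := by
    rw [H.ofOne_dFn_eq_sum e, Finset.smul_sum]
    exact Finset.sum_congr rfl fun a _ => smul_comm _ _ _
  rw [h2, lie, lie, intO_smul, intO_smul, H.intO_form e hS, smul_comm f, LinearMap.map_smul H.d,
    LinearMap.map_smul H.d, h1, smul_zero, add_zero, smul_fn, mul_one, H.d_fn e]

/-- Pure relabelling: the summand is indexed by the component of the form, whereas the final
formulas order the sums by the derivatives. -/
theorem _root_.Finset.sum_add_sum_add_smul_sum {M : Type*} [AddCommMonoid M] [Module k M] (r : k)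
    (X : ι → M) (Z : ι → ι → M) (W : ι → ι → ι → M) :
    ∑ c, (X c + ∑ b, Z b c + r • ∑ b, ∑ a, W a b c) =
      ∑ c, X c + ∑ a, ∑ b, Z a b + r • ∑ a, ∑ b, ∑ c, W a b c := by
  have h1 : ∑ c, ∑ b, ∑ a, W a b c = ∑ a, ∑ b, ∑ c, W a b c := by
    rw [Finset.sum_comm_cycle]
    exact Finset.sum_congr rfl fun a _ => Finset.sum_comm
  have h2 : ∑ c, ∑ b, Z b c = ∑ a, ∑ b, Z a b := Finset.sum_comm
  rw [Finset.sum_add_distrib, Finset.sum_add_distrib, ← Finset.smul_sum, h1, h2]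

theorem leibnizator_sum_left {κ : Type*} (s : Finset κ) (p : ℕ) (F : κ → Ω) (ω : Ω) :
    H.leibnizator p (∑ i ∈ s, F i) ω = ∑ i ∈ s, H.leibnizator p (F i) ω := by
  simp only [leibnizator, map_sum, LinearMap.sum_apply, Finset.smul_sum, Finset.sum_sub_distrib]

theorem lie_sum_left {κ : Type*} (s : Finset κ) (F : κ → A ⊗[k] V) (ω : Ω) :
    H.lie (∑ i ∈ s, F i) ω = ∑ i ∈ s, H.lie (F i) ω := by
  simp only [lie, map_sum, LinearMap.sum_apply, Finset.sum_add_distrib]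

theorem box_fn (hS : Function.Bijective (HopfAlgebra.antipode k : A →ₗ[k] A)) (f : A) :
    H.box (fn A V f) = ∑ a, H.partialDeriv e a f • H.codiff (H.form (e a))
      + (-1 : k) ^ H.deg • ∑ a, ∑ b, H.metric.form (e a) (e b) •
        fn A V (H.partialDeriv e a (H.partialDeriv e b f)) := by
  rw [H.box_fn_eq e hS, H.d_fn e, H.ofOne_dFn_eq_sum e, H.codiff_sum_smul_form e hS]

/-- The product formula is applied to each α^c e_c with dα^c = Σ_b (∂^b α^c)e_b. The second
derivatives come from the corrections to the Leibnizator and the Lie derivative: the first gives e_a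
⊢ (e_b e_c) - g_ab e_c, the second g_bc e_a. -/
theorem box_sum_smul_form
    (hS : Function.Bijective (HopfAlgebra.antipode k : A →ₗ[k] A)) (α : ι → A) :
    H.box (∑ a, α a • H.form (e a)) =
      ∑ a, α a • H.box (H.form (e a))
        + ∑ a, mulO k A V (H.box (fn A V (α a))) (H.form (e a))
        + ∑ a, ∑ b, H.partialDeriv e a (α b) •
            (H.leibnizator 1 (H.form (e a)) (H.form (e b))
              + (-1 : k) ^ H.deg • H.lie (1 ⊗ₜ[k] e a) (H.form (e b)))
        + (-1 : k) ^ H.deg • ∑ a, ∑ b, ∑ c,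
            H.partialDeriv e a (H.partialDeriv e b (α c)) •
              (H.intO (1 ⊗ₜ[k] e a) (mulO k A V (H.form (e b)) (H.form (e c)))
                + H.metric.form (e b) (e c) • H.form (e a)
                - H.metric.form (e a) (e b) • H.form (e c)) := by
  have key : ∀ c, H.box (α c • H.form (e c)) = α c • H.box (H.form (e c)) +
      mulO k A V (H.box (fn A V (α c))) (H.form (e c)) +
      ∑ b, H.partialDeriv e b (α c) • (H.leibnizator 1 (H.form (e b)) (H.form (e c))
              + (-1 : k) ^ H.deg • H.lie (1 ⊗ₜ[k] e b) (H.form (e c))) +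
      (-1 : k) ^ H.deg • ∑ b, ∑ a, H.partialDeriv e a (H.partialDeriv e b (α c)) •
              (H.intO (1 ⊗ₜ[k] e a) (mulO k A V (H.form (e b)) (H.form (e c)))
                + H.metric.form (e b) (e c) • H.form (e a)
                - H.metric.form (e a) (e b) • H.form (e c)) := by
    intro c
    rw [H.box_smul e hS, H.d_fn e, H.ofOne_dFn_eq_sum e, H.leibnizator_sum_left,
      H.dFn_eq_sum e, H.lie_sum_left, Finset.smul_sum, Finset.smul_sum,
      add_comm (mulO k A V _ _), add_assoc, add_assoc (_ + _) (∑ _, _), ← Finset.sum_add_distrib,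
      ← Finset.sum_add_distrib]
    refine congrArg _ (Finset.sum_congr rfl fun b _ => ?_)
    rw [H.leibnizator_smul_form e hS, H.lie_smul_form e hS]
    simp only [smul_add, smul_sub, Finset.sum_add_distrib, Finset.sum_sub_distrib]
    rw [smul_comm (H.partialDeriv e b (α c)) ((-1 : k) ^ H.deg)]
    abel
  rw [map_sum, Finset.sum_congr rfl fun c _ => key c, Finset.sum_add_sum_add_smul_sum,
    Finset.sum_add_distrib]

/-- Only δd survives, so the two Leibniz rules are expanded directly and the metric terms of the
general formula never arise. -/
theorem box_sum_smul_form_of_codiff_eq_zero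
    (hS : Function.Bijective (HopfAlgebra.antipode k : A →ₗ[k] A)) (α : ι → A)
    (h : H.codiff (∑ a, α a • H.form (e a)) = 0) :
    H.box (∑ a, α a • H.form (e a)) =
      ∑ a, α a • H.codiff (H.d (H.form (e a)))
        + ∑ a, ∑ b, H.partialDeriv e a (α b) •
            (H.codiff (mulO k A V (H.form (e a)) (H.form (e b)))
              + (-1 : k) ^ H.deg • H.intO (1 ⊗ₜ[k] e a) (H.d (H.form (e b))))
        + (-1 : k) ^ H.deg • ∑ a, ∑ b, ∑ c,
            H.partialDeriv e a (H.partialDeriv e b (α c)) •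
              H.intO (1 ⊗ₜ[k] e a) (mulO k A V (H.form (e b)) (H.form (e c))) := by
  change H.d (H.codiff (∑ a, α a • H.form (e a))) + H.codiff (H.d (∑ a, α a • H.form (e a))) = _
  rw [h, map_zero, zero_add, map_sum, map_sum]
  have key : ∀ c, H.codiff (H.d (α c • H.form (e c))) = α c • H.codiff (H.d (H.form (e c))) +
      ∑ b, H.partialDeriv e b (α c) • (H.codiff (mulO k A V (H.form (e b)) (H.form (e c)))
              + (-1 : k) ^ H.deg • H.intO (1 ⊗ₜ[k] e b) (H.d (H.form (e c)))) +
      (-1 : k) ^ H.deg • ∑ b, ∑ a, H.partialDeriv e a (H.partialDeriv e b (α c)) •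
              H.intO (1 ⊗ₜ[k] e a) (mulO k A V (H.form (e b)) (H.form (e c))) := by
    intro c
    rw [H.d_smul e, map_add, H.codiff_smul e hS, H.intO_dFn e, H.ofOne_dFn_eq_sum e, map_sum,
      LinearMap.sum_apply, map_sum, add_left_comm, add_assoc]
    refine congrArg _ ?_
    rw [Finset.smul_sum, Finset.smul_sum, ← Finset.sum_add_distrib, ← Finset.sum_add_distrib]
    refine Finset.sum_congr rfl fun b _ => ?_
    rw [mulO_smul, H.codiff_smul e hS, H.intO_dFn e, smul_add,
      smul_comm (H.partialDeriv e b (α c)) ((-1 : k) ^ H.deg)]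
    abel
  rw [Finset.sum_congr rfl fun c _ => key c, Finset.sum_add_sum_add_smul_sum]

end HodgeData

end BraidedHodge

end

/-! ### The theorem -/

theorem corollary3p8 {k A V : Type*} [Field k] [Ring A] [HopfAlgebra k A]
    [AddCommGroup V] [Module k V] [FiniteDimensional k V] [BraidedHodge.CrossedModule k A V]
    (_hS : Function.Bijective (HopfAlgebra.antipode k : A →ₗ[k] A))
    (H : BraidedHodge.HodgeData k A V) :
    IsUnit H.antipodeSharp ∧
    (∀ (f : A) (ω : BraidedHodge.Omega k A V),
      H.codiff (f • ω) = f • H.codiff ω + (-1 : k) ^ H.deg • H.intO (H.dFn f) ω) ∧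
    (∀ (f : A) (ω : BraidedHodge.Omega k A V),
      H.box (f • ω) =
        BraidedHodge.mulO k A V (H.box (BraidedHodge.fn A V f)) ω + f • H.box ω
          + H.leibnizator 1 (H.d (BraidedHodge.fn A V f)) ω
          + (-1 : k) ^ H.deg • H.lie (H.dFn f) ω) ∧
    (∀ {ι : Type*} [Fintype ι] (e : Module.Basis ι k V),
      (∀ f : A, H.d (BraidedHodge.fn A V f) = ∑ a, H.partialDeriv e a f • H.form (e a)) ∧
      (∀ α : ι → A,
        H.codiff (∑ a, α a • H.form (e a)) =
          ∑ a, α a • H.codiff (H.form (e a))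
            + (-1 : k) ^ H.deg • ∑ a, ∑ b, H.metric.form (e a) (e b) •
                BraidedHodge.fn A V (H.partialDeriv e a (α b))) ∧
      (∀ f : A,
        H.box (BraidedHodge.fn A V f) =
          ∑ a, H.partialDeriv e a f • H.codiff (H.form (e a))
            + (-1 : k) ^ H.deg • ∑ a, ∑ b, H.metric.form (e a) (e b) •
                BraidedHodge.fn A V (H.partialDeriv e a (H.partialDeriv e b f))) ∧
      (∀ α : ι → A,
        H.box (∑ a, α a • H.form (e a)) =
          ∑ a, α a • H.box (H.form (e a))
            + ∑ a, BraidedHodge.mulO k A V (H.box (BraidedHodge.fn A V (α a))) (H.form (e a))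
            + ∑ a, ∑ b, H.partialDeriv e a (α b) •
                (H.leibnizator 1 (H.form (e a)) (H.form (e b))
                  + (-1 : k) ^ H.deg • H.lie (1 ⊗ₜ[k] e a) (H.form (e b)))
            + (-1 : k) ^ H.deg • ∑ a, ∑ b, ∑ c,
                H.partialDeriv e a (H.partialDeriv e b (α c)) •
                  (H.intO (1 ⊗ₜ[k] e a)
                      (BraidedHodge.mulO k A V (H.form (e b)) (H.form (e c)))
                    + H.metric.form (e b) (e c) • H.form (e a)
                    - H.metric.form (e a) (e b) • H.form (e c))) ∧
      (∀ α : ι → A,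
        H.codiff (∑ a, α a • H.form (e a)) = 0 →
        H.box (∑ a, α a • H.form (e a)) =
          ∑ a, α a • H.codiff (H.d (H.form (e a)))
            + ∑ a, ∑ b, H.partialDeriv e a (α b) •
                (H.codiff (BraidedHodge.mulO k A V (H.form (e a)) (H.form (e b)))
                  + (-1 : k) ^ H.deg • H.intO (1 ⊗ₜ[k] e a) (H.d (H.form (e b))))
            + (-1 : k) ^ H.deg • ∑ a, ∑ b, ∑ c,
                H.partialDeriv e a (H.partialDeriv e b (α c)) •
                  H.intO (1 ⊗ₜ[k] e a)
                    (BraidedHodge.mulO k A V (H.form (e b)) (H.form (e c))))) := by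
  classical
  -- An auxiliary basis for the claims whose statement involves none.
  let e₀ := Module.finBasis k V
  have := H.topForm.finiteDimensional
  refine ⟨H.isUnit_antipodeSharp e₀ _hS, H.codiff_smul e₀ _hS, H.box_smul e₀ _hS,
    fun e => ⟨fun f => ?_, H.codiff_sum_smul_form e _hS, H.box_fn e _hS,
      H.box_sum_smul_form e _hS, H.box_sum_smul_form_of_codiff_eq_zero e _hS⟩⟩
  rw [H.d_fn e, H.ofOne_dFn_eq_sum e]
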